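/- **Theorem (Effective resistance estimation).** Let $G$ be a finite undirected graph on a vertex set $V$ with symmetric edge weights $w_{xy}\ge 0$ ($w_{xy}>0$ exactly on the edges) and degrees $d_x=\sum_y w_{xy}$. Let $s\in V$ be a source and $M\subseteq V$, $s\notin M$, a sink that is reachable from $s$. Let $R_s$ be the effective resistance between $s$ and $M$, i.e. the minimum of $\frac12\sum_{(x,y):\,w_{xy}>0} f_{xy}^2/w_{xy}$ over all unit $s$-$M$ flows $f$. Let $\mathrm{ET}_s=\mathbb E[\,1+\max\{t<\tau_M : X_t=s\}\,]$ be the escape time, where $(X_t)_{t\ge 0}$ is the random walk on $G$ started at $X_0=s$, with transition probabilities $w_{xy}/d_x$, and $\tau_M$ is its hitting time of $M$. Let $|\phi_x\rangle=d_x^{-1/2}\sum_y\sqrt{w_{xy}}\,|xy\rangle$ be the star states, and $U=\bigl(\sum_{x\notin\{s\}\cup M}2|\phi_x\rangle\langle\phi_x|-I\bigr)\cdot\mathrm{SWAP}$, with $\mathrm{SWAP}|xy\rangle=|yx\rangle$, the quantum walk operator. A quantum walk algorithm interleaves fixed unitaries and measurements, which do not depend on $w$ and $M$, with quantum walk steps;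 a quantum walk step is a (controlled) application of $U$, or of a unitary $P$ with $P|ss\rangle=|\phi_s\rangle$, or of $P^{-1}$. There is an absolute constant $C>0$ such that for every $V$, every $s\in V$, every $\varepsilon>0$ and every real $\overline{\mathrm{ET}}_s$ there is a quantum walk algorithm which, on every such $w$ and $M$ with $\mathrm{ET}_s\le\overline{\mathrm{ET}}_s$ and for every such $P$, outputs with probability at least $2/3$ a number $r$ with $|r-R_sd_s|\le\varepsilon R_sd_s$, and which uses in expectation at most $$C\,\sqrt{\overline{\mathrm{ET}}_s}\,\Bigl(\frac1\varepsilon+\log(R_sd_s)\Bigr)$$ quantum walk steps. -/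

import Mathlib

open scoped ENNReal Matrix

universe u

noncomputable section

/-! ### Weighted graphs and electric networks -/

/-- A finite undirected weighted graph on `V`: the (ordered) edge set is `{(x, y) | 0 < w x y}`. -/
structure WeightedGraph (V : Type u) where
  w : V → V → ℝ
  nonneg : ∀ x y, 0 ≤ w x y
  symm : ∀ x y, w x y = w y x

namespace WeightedGraph

variable {V : Type u}

/-- The sink `M` can be reached from `s` along edges of `G`. -/
def Reaches (G : WeightedGraph V) (s : V) (M : Finset V) : Prop :=
  ∃ m ∈ M, Relation.ReflTransGen (fun x y => 0 < G.w x y) s m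

variable [Fintype V]

/-- The weighted degree `d_x = ∑_y w_{xy}`. -/
def deg (G : WeightedGraph V) (x : V) : ℝ := ∑ y, G.w x y

/-- Unit flows from the source `s` to the sink `M`. -/
structure IsUnitFlow [DecidableEq V] (G : WeightedGraph V) (s : V) (M : Finset V)
    (f : V → V → ℝ) : Prop where
  supported : ∀ x y, G.w x y = 0 → f x y = 0
  antisymm : ∀ x y, f x y = - f y x
  source : ∑ y, f s y = 1
  sink : ∑ m ∈ M, ∑ y, f y m = 1
  conserved : ∀ x, x ∉ insert s M → ∑ y, f x y = 0

/-- The dissipated energy `½ ∑_{(x,y) ∈ E} f_{xy}² / w_{xy}`.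
For a flow, a pair that is not an edge contributes `0 / 0 = 0`. -/
def energy (G : WeightedGraph V) (f : V → V → ℝ) : ℝ :=
  (1 / 2) * ∑ x, ∑ y, f x y ^ 2 / G.w x y

/-- The effective resistance `R_s` between `s` and `M`: the minimal energy of a unit flow. -/
def effRes [DecidableEq V] (G : WeightedGraph V) (s : V) (M : Finset V) : ℝ :=
  sInf {e | ∃ f, G.IsUnitFlow s M f ∧ e = G.energy f}

/-! ### The random walk and the escape time -/

lemma deg_nonneg (G : WeightedGraph V) (x : V) : 0 ≤ G.deg x :=
  Finset.sum_nonneg fun y _ => G.nonneg x y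

/-- One step of the random walk: from `x`, move to `y` with probability `w_{xy} / d_x`
(an isolated vertex, which is never met by a walk that can reach the sink, is absorbing). -/
def step (G : WeightedGraph V) (x : V) : PMF V :=
  open Classical in
  if h : G.deg x = 0 then PMF.pure x
  else PMF.ofFintype (fun y => ENNReal.ofReal (G.w x y / G.deg x)) (by
    rw [← ENNReal.ofReal_sum_of_nonneg
      (fun y _ => div_nonneg (G.nonneg x y) (G.deg_nonneg x)), ← Finset.sum_div]
    change ENNReal.ofReal (G.deg x / G.deg x) = 1
    rw [div_self h, ENNReal.ofReal_one])

/-- The transition kernel of the random walk. -/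
def stepKernel [MeasurableSpace V] [DiscreteMeasurableSpace V] (G : WeightedGraph V) :
    ProbabilityTheory.Kernel V V where
  toFun x := (G.step x).toMeasure
  measurable' := Measurable.of_discrete

instance [MeasurableSpace V] [DiscreteMeasurableSpace V] (G : WeightedGraph V) :
    ProbabilityTheory.IsMarkovKernel G.stepKernel :=
  ⟨fun x => PMF.toMeasure.isProbabilityMeasure (G.step x)⟩

/-- The law, on trajectories `X : ℕ → V`, of the random walk on `G` with `X 0 = s`. -/
def walkLaw [MeasurableSpace V] [DiscreteMeasurableSpace V] (G : WeightedGraph V) (s : V) :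
    MeasureTheory.Measure (ℕ → V) :=
  ProbabilityTheory.Kernel.traj (X := fun _ => V)
    (fun n => G.stepKernel.comap
      (fun h : (i : Finset.Iic n) → V => h ⟨n, Finset.mem_Iic.2 le_rfl⟩) (measurable_pi_apply _))
    0 (fun _ => s)

/-- `1 + max {t < τ_M : X_t = s}` along a trajectory `X`, where `τ_M` is the first hitting time
of `M`: the time at which the walk leaves `s` for the final time before it hits `M`. -/
def lastExit (s : V) (M : Finset V) (X : ℕ → V) : ℝ≥0∞ :=
  ⨆ (t : ℕ) (_ : X t = s ∧ ∀ r ≤ t, X r ∉ M), ((t : ℝ≥0∞) + 1)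

/-- The escape time `ET_s`. -/
def escapeTime [MeasurableSpace V] [DiscreteMeasurableSpace V] (G : WeightedGraph V)
    (s : V) (M : Finset V) : ℝ≥0∞ :=
  ∫⁻ X, lastExit s M X ∂(G.walkLaw s)

/-! ### The quantum walk operator -/

variable [DecidableEq V]

/-- The star state `|φ_x⟩ = d_x^{-1/2} ∑_y √w_{xy} |x y⟩`. -/
def starState (G : WeightedGraph V) (x : V) : V × V → ℂ :=
  fun e => if e.1 = x then ((√(G.w x e.2 / G.deg x) : ℝ) : ℂ) else 0

/-- `SWAP |x y⟩ = |y x⟩`. -/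
def swapOp (V : Type u) [DecidableEq V] : Matrix (V × V) (V × V) ℂ :=
  Matrix.of fun e e' => if e = e'.swap then 1 else 0

/-- The quantum walk operator `U = (∑_{x ∉ {s} ∪ M} 2 |φ_x⟩⟨φ_x| - I) · SWAP`. -/
def walkOp (G : WeightedGraph V) (s : V) (M : Finset V) : Matrix (V × V) (V × V) ℂ :=
  ((2 : ℂ) • (∑ x ∈ (insert s M)ᶜ,
    Matrix.vecMulVec (G.starState x) (star (G.starState x))) - 1) * swapOp V

end WeightedGraph

/-! ### Quantum walk algorithms -/

/-- A quantum walk algorithm on the register `ℂ^{V × V}` with a workspace `ℂ^{k+1}`.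
It is a finite adaptive sequence of instructions:
stop with a real output; apply a fixed unitary (which cannot depend on the weights or the sink);
apply, controlled on the workspace basis state being in `c`, the quantum walk operator,
the preparation unitary of the source's star state, or the inverse of the latter;
measure (which of the blocks `out ⁻¹ {j}` of basis states) and continue depending on the
result. -/
inductive WalkAlgorithm (V : Type u) [Fintype V] [DecidableEq V] (k : ℕ) : Type u
  | output (r : ℝ) : WalkAlgorithm V k
  | unitary (Q : Matrix.unitaryGroup ((V × V) × Fin (k + 1)) ℂ)
      (next : WalkAlgorithm V k) : WalkAlgorithm V k
  | walk (c : Finset (Fin (k + 1))) (next : WalkAlgorithm V k) : WalkAlgorithm V k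
  | prep (c : Finset (Fin (k + 1))) (next : WalkAlgorithm V k) : WalkAlgorithm V k
  | prepInv (c : Finset (Fin (k + 1))) (next : WalkAlgorithm V k) : WalkAlgorithm V k
  | measure (l : ℕ) (out : (V × V) × Fin (k + 1) → Fin l)
      (next : Fin l → WalkAlgorithm V k) : WalkAlgorithm V k

namespace WalkAlgorithm

variable {V : Type u} [Fintype V] [DecidableEq V] {k : ℕ}

/-- Apply `O` to the register if the workspace is in a basis state of `c`. -/
def ctrl (c : Finset (Fin (k + 1))) (O : Matrix (V × V) (V × V) ℂ)
    (ψ : (V × V) × Fin (k + 1) → ℂ) : (V × V) × Fin (k + 1) → ℂ :=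
  fun i => if i.2 ∈ c then (O *ᵥ fun e => ψ (e, i.2)) i.1 else ψ i

/-- `A.expect U P g n ψ` is `E[g(output, number of quantum walk steps)]` when `A` is run with walk
operator `U` and preparation unitary `P` from the subnormalized state `ψ`, after `n` steps
so far. The squared norm of `ψ` is the probability of having come here, and every (controlled) use
of `U`, `P` or `P⁻¹` counts as one step. -/
def expect (U P : Matrix (V × V) (V × V) ℂ) (g : ℝ → ℕ → ℝ) :
    WalkAlgorithm V k → ℕ → ((V × V) × Fin (k + 1) → ℂ) → ℝ
  | output r, n, ψ => (∑ i, ‖ψ i‖ ^ 2) * g r n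
  | unitary Q next, n, ψ => expect U P g next n (Q.1 *ᵥ ψ)
  | walk c next, n, ψ => expect U P g next (n + 1) (ctrl c U ψ)
  | prep c next, n, ψ => expect U P g next (n + 1) (ctrl c P ψ)
  | prepInv c next, n, ψ => expect U P g next (n + 1) (ctrl c Pᴴ ψ)
  | measure _ out next, n, ψ =>
      ∑ j, expect U P g (next j) n (fun i => if out i = j then ψ i else 0)

/-- The initial basis state `|s s⟩ |0⟩`. -/
def initState (s : V) : (V × V) × Fin (k + 1) → ℂ := Pi.single ((s, s), 0) 1

/-- The expected number of quantum walk steps of `A`, started in `|s s⟩ |0⟩`. -/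
def expectedSteps (A : WalkAlgorithm V k) (s : V) (U P : Matrix (V × V) (V × V) ℂ) : ℝ :=
  A.expect U P (fun _ n => (n : ℝ)) 0 (initState s)

/-- The probability that the output of `A`, started in `|s s⟩ |0⟩`, lies in `S`. -/
def outputProb (A : WalkAlgorithm V k) (s : V) (U P : Matrix (V × V) (V × V) ℂ) (S : Set ℝ) : ℝ :=
  A.expect U P (fun r _ => S.indicator 1 r) 0 (initState s)

end WalkAlgorithm

end

/-! Write x = R_s d_s. Let h (`hit`) be the probability of meeting s before M, and C (`effCond`) the
current that leaves s under the potential h; by Thomson's principle R_s = 1/C. With P the walk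
killed in M, the escape time dominates the partial sums of ∑_t (P^t h)(s), since P^t h(s) is the
chance of a visit to s at or after time t. P is self-adjoint for the weights d, and (I - P)h lives
on s alone, so ⟨h, P^t h⟩ - ⟨h, P^(t+1) h⟩ = C (P^t h)(s). Telescoping gives ∑ d h² ≤ E C
(`sum_deg_hit_sq_le`), where E bounds the escape time.

On the register, let f and c be the normalized edge states with amplitudes √w times the difference
and the sum of the potentials. Then ‖f‖² = 2x, ‖c‖² ≤ 4xE, U f = f and U c = c + 2f - 4x φ_s
(`exists_flowVectors`). Adjoin an additional edge e and a scale t, and put y = 2xt². In the plane of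
e and f, consider the reflection that fixes e + tf and flips ye - tf, followed by the sign flip of
f. The product is a rotation with cosine (1 - y)/(1 + y), which reveals x. Neither f nor the first
reflection is directly accessible, but one use each of U, P⁻¹ and P performs this reflection exactly
in the presence of a catalyst, a private vector that is returned unchanged (`actList_stepOps`). The
weight h = E^(-1/4) between public and private vectors gives catalysts of squared norm O(√E)
(`sqNorm_privVec_le`).

The catalyst is not available and is simply left out. The input is spread over K + 1 packets that
travel through the same catalysts like through a pipeline. Relative to the packets, catalysts for D
rotations have squared norm O(D√E/(K + 1)), and omitting them perturbs the result by at most four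
times that. All rotations are done in parallel, so the cost is only 3(K + D) steps
(`exists_program`), and K of order D√E suffices.

Phase estimation with T of order 1/ε rotations (`exists_phaseEstimation`) determines x up to a
factor 1 ± ε if y is of constant order. The right scale t = 2^(-i) is found by tests of cost O(√E)
that pass with probability about 1/(1 + y). On average O(1 + log x) tests and one estimate are made,
and a premature stop is unlikely (`search_steps`, `search_success`). -/

set_option linter.unusedSectionVars false

noncomputable section

/-! ### The law of the random walk and a lower bound on the escape time -/

open MeasureTheory ProbabilityTheory in
/-- The Markov property of the random walk, for events about the first `k` steps. -/
lemma WeightedGraph.walkLaw_inter_next {V : Type u} [Fintype V] [MeasurableSpace V]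
    [DiscreteMeasurableSpace V] (G : WeightedGraph V) (s : V) (k : ℕ) (x y : V)
    (H : Set (ℕ → V)) (hH : ∀ X X' : ℕ → V, (∀ r ≤ k, X r = X' r) → X ∈ H → X' ∈ H)
    (hx : ∀ X ∈ H, X k = x) :
    G.walkLaw s (H ∩ {X | X (k + 1) = y}) = G.step x y * G.walkLaw s H := by
  classical
  set κ : (n : ℕ) → Kernel (((i : Finset.Iic n) → V)) V := fun n => G.stepKernel.comap
      (fun h : (i : Finset.Iic n) → V => h ⟨n, Finset.mem_Iic.2 le_rfl⟩) (measurable_pi_apply _)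
    with hκ
  -- An event determined by the first `k` steps is a cylinder over a subset of a finite product,
  -- hence measurable.
  let B : Set ((i : Finset.Iic k) → V) := {b | ∃ X ∈ H, ∀ i, X i.1 = b i}
  have hB : MeasurableSet B := (Set.toFinite B).measurableSet
  have hHB : H = (Preorder.frestrictLe (π := fun _ => V) k) ⁻¹' B := by
    ext X
    constructor
    · intro hX
      exact ⟨X, hX, fun i => rfl⟩
    · rintro ⟨X', hX', h⟩
      exact hH X' X (fun r hr => h ⟨r, Finset.mem_Iic.2 hr⟩) hX'
  have key := Kernel.partialTraj_compProd_eq_map_traj (X := fun _ => V) (κ := κ) (Nat.zero_le k)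
    (x₀ := fun _ => s)
  have hmeas : Measurable (fun X : ℕ → V => (Preorder.frestrictLe (π := fun _ => V) k X, X (k + 1))) := by
    fun_prop
  have hset : H ∩ {X | X (k + 1) = y} =
      (fun X : ℕ → V => (Preorder.frestrictLe (π := fun _ => V) k X, X (k + 1))) ⁻¹' (B ×ˢ {y}) := by
    rw [hHB]; ext X; simp
  have hy : MeasurableSet ({y} : Set V) := MeasurableSet.singleton y
  have h1 : G.walkLaw s (H ∩ {X | X (k + 1) = y}) =
      ((Kernel.partialTraj (X := fun _ => V) κ 0 k (fun _ => s)) ⊗ₘ (κ k)) (B ×ˢ {y}) := by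
    rw [key, Measure.map_apply hmeas (hB.prod hy), hset]; rfl
  have h2 : G.walkLaw s H = Kernel.partialTraj (X := fun _ => V) κ 0 k (fun _ => s) B := by
    rw [← Kernel.traj_map_frestrictLe_apply, Measure.map_apply (by fun_prop) hB, hHB]; rfl
  rw [h1, h2, Measure.compProd_apply_prod hB hy]
  have h3 : ∀ b ∈ B, κ k b {y} = G.step x y := by
    rintro b ⟨X, hX, hb⟩
    have : b ⟨k, Finset.mem_Iic.2 le_rfl⟩ = x := by
      rw [← hb]; exact hx X hX
    rw [hκ]
    simp only [Kernel.comap_apply, this]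
    exact PMF.toMeasure_apply_singleton _ _ hy
  rw [setLIntegral_congr_fun hB h3, setLIntegral_const]

lemma WeightedGraph.walkLaw_start {V : Type u} [Fintype V] [MeasurableSpace V]
    [DiscreteMeasurableSpace V] (G : WeightedGraph V) (s : V) : G.walkLaw s {X | X 0 = s} = 1 := by
  have h := ProbabilityTheory.Kernel.traj_map_frestrictLe_apply (X := fun _ => V)
    (κ := fun n => G.stepKernel.comap
      (fun h : (i : Finset.Iic n) → V => h ⟨n, Finset.mem_Iic.2 le_rfl⟩) (measurable_pi_apply _))
      0 0 (fun _ => s)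
  rw [ProbabilityTheory.Kernel.partialTraj_self, ProbabilityTheory.Kernel.id_apply] at h
  have hm : MeasurableSet {b : (i : Finset.Iic 0) → V | b ⟨0, Finset.mem_Iic.2 le_rfl⟩ = s} :=
    (Set.toFinite _).measurableSet
  have h2 := congrArg (fun μ => μ {b : (i : Finset.Iic 0) → V | b ⟨0, Finset.mem_Iic.2 le_rfl⟩ = s}) h
  rw [MeasureTheory.Measure.map_apply (by fun_prop) hm, MeasureTheory.Measure.dirac_apply' _ hm] at h2
  simpa [walkLaw] using h2

namespace WeightedGraph

variable {V : Type u}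

/-- The trajectories that visit `s` at or after time `k`, and before they hit `M`. -/
def visitsFrom (s : V) (M : Finset V) (k : ℕ) : Set (ℕ → V) :=
  {X | ∃ r, k ≤ r ∧ X r = s ∧ ∀ r' ≤ r, X r' ∉ M}

lemma measurableSet_eval_mem [MeasurableSpace V] [DiscreteMeasurableSpace V] (r : ℕ) (A : Set V) :
    MeasurableSet {X : ℕ → V | X r ∈ A} :=
  (measurable_pi_apply (X := fun _ : ℕ => V) r) (MeasurableSet.of_discrete (s := A))

lemma measurableSet_visitsFrom [MeasurableSpace V] [DiscreteMeasurableSpace V] [Countable V] (s : V)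
    (M : Finset V) (k : ℕ) : MeasurableSet (visitsFrom s M k) := by
  have : visitsFrom s M k = ⋃ r, ⋃ (_ : k ≤ r),
      ({X : ℕ → V | X r ∈ ({s} : Set V)} ∩ ⋂ r', ⋂ (_ : r' ≤ r), {X : ℕ → V | X r' ∈ {x | x ∉ M}}) := by
    ext X
    simp only [visitsFrom, Set.mem_ofPred_eq, Set.mem_iUnion, Set.mem_inter_iff, Set.mem_iInter,
      Set.mem_singleton_iff, exists_prop]
  rw [this]
  exact MeasurableSet.iUnion fun r => MeasurableSet.iUnion fun _ =>
    (measurableSet_eval_mem r _).inter (MeasurableSet.iInter fun r' => MeasurableSet.iInter fun _ =>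
      measurableSet_eval_mem r' _)

/-- Layer-cake form of the last exit: a trajectory belongs to `visitsFrom s M t` exactly for the
times t up to its last visit to `s` before `M`, and there are 1 + (last visit) of these. -/
lemma sum_indicator_visitsFrom_le_lastExit (s : V) (M : Finset V) (N : ℕ) (X : ℕ → V) :
    ∑ t ∈ Finset.range N, (visitsFrom s M t).indicator 1 X ≤ lastExit s M X := by
  induction N with
  | zero => simp
  | succ N ih =>
    by_cases h : X ∈ visitsFrom s M N
    · obtain ⟨r, hr, h1⟩ := h
      calc ∑ t ∈ Finset.range (N + 1), (visitsFrom s M t).indicator (1 : (ℕ → V) → ℝ≥0∞) X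
          ≤ ∑ t ∈ Finset.range (N + 1), (1 : ℝ≥0∞) := by
            refine Finset.sum_le_sum fun t _ => ?_
            exact Set.indicator_le_self' (by simp) X
        _ ≤ (r : ℝ≥0∞) + 1 := by
            simp; gcongr
        _ ≤ lastExit s M X := by
            unfold lastExit
            exact le_iSup₂_of_le r h1 le_rfl
    · rw [Finset.sum_range_succ, Set.indicator_of_notMem h, add_zero]
      exact ih

variable [Fintype V]

/-- Only an inequality: at an isolated vertex the quotient is 0 by convention, while the walk stays
there. Lower bounds on probabilities are all that is used. -/
lemma ofReal_le_step (G : WeightedGraph V) (x y : V) :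
    ENNReal.ofReal (G.w x y / G.deg x) ≤ G.step x y := by
  unfold step
  by_cases h : G.deg x = 0
  · simp [h]
  · rw [dif_neg h]; simp

variable [DecidableEq V]

/-- The transition operator of the random walk that is killed in `M`. -/
def killedStep (G : WeightedGraph V) (M : Finset V) (f : V → ℝ) (x : V) : ℝ :=
  if x ∈ M then 0 else ∑ y, G.w x y / G.deg x * f y

/-- The probability that the random walk from `x` meets `s` within `n` steps, and not after
meeting `M`. -/
def hitProb (G : WeightedGraph V) (s : V) (M : Finset V) : ℕ → V → ℝ
  | 0, x => if x = s then 1 else 0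
  | n + 1, x => if x = s then 1 else G.killedStep M (hitProb G s M n) x

lemma killedStep_nonneg (G : WeightedGraph V) (M : Finset V) {f : V → ℝ} (hf : ∀ x, 0 ≤ f x)
    (x : V) : 0 ≤ G.killedStep M f x := by
  unfold killedStep
  split_ifs
  · exact le_rfl
  · exact Finset.sum_nonneg fun y _ =>
      mul_nonneg (div_nonneg (G.nonneg x y) (G.deg_nonneg x)) (hf y)

lemma killedStep_mono (G : WeightedGraph V) (M : Finset V) {f g : V → ℝ} (h : ∀ x, f x ≤ g x)
    (x : V) : G.killedStep M f x ≤ G.killedStep M g x := by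
  unfold killedStep
  split_ifs
  · exact le_rfl
  · exact Finset.sum_le_sum fun y _ =>
      mul_le_mul_of_nonneg_left (h y) (div_nonneg (G.nonneg x y) (G.deg_nonneg x))

lemma killedStep_of_mem (G : WeightedGraph V) {M : Finset V} (f : V → ℝ) {x : V} (hx : x ∈ M) :
    G.killedStep M f x = 0 := if_pos hx

lemma hitProb_nonneg (G : WeightedGraph V) (s : V) (M : Finset V) (n : ℕ) (x : V) :
    0 ≤ G.hitProb s M n x := by
  induction n generalizing x with
  | zero => unfold hitProb; split_ifs <;> norm_num
  | succ n ih =>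
    unfold hitProb
    split_ifs
    · norm_num
    · exact G.killedStep_nonneg M ih x

lemma hitProb_of_mem (G : WeightedGraph V) {s : V} {M : Finset V} (hs : s ∉ M) (n : ℕ) {x : V}
    (hx : x ∈ M) : G.hitProb s M n x = 0 := by
  have : x ≠ s := fun h => hs (h ▸ hx)
  cases n with
  | zero => simp [hitProb, this]
  | succ n => simp [hitProb, this, killedStep, hx]

lemma iterate_killedStep_nonneg (G : WeightedGraph V) (M : Finset V) {f : V → ℝ}
    (hf : ∀ x, 0 ≤ f x) (t : ℕ) (x : V) : 0 ≤ (G.killedStep M)^[t] f x := by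
  induction t generalizing x with
  | zero => exact hf x
  | succ t ih =>
    rw [Function.iterate_succ_apply']
    exact G.killedStep_nonneg M ih x

variable [MeasurableSpace V] [DiscreteMeasurableSpace V]

/-- `f x` bounds from below the probability of `T` given any history up to time `k` that has
avoided `M` and ends in `x`. -/
def IsLowerBoundAt (G : WeightedGraph V) (s : V) (M : Finset V) (k : ℕ) (T : Set (ℕ → V))
    (f : V → ℝ) : Prop :=
  ∀ (x : V) (H : Set (ℕ → V)), (∀ X X' : ℕ → V, (∀ r ≤ k, X r = X' r) → X ∈ H → X' ∈ H) →
    (∀ X ∈ H, X k = x ∧ ∀ r ≤ k, X r ∉ M) →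
    ENNReal.ofReal (f x) * G.walkLaw s H ≤ G.walkLaw s (H ∩ T)

/-- First-step analysis. The history is split according to the next vertex; by the Markov property
each branch outside `M` extends the history by one step, and branches into `M` may be dropped
because `f` vanishes there. -/
lemma IsLowerBoundAt.killedStep {G : WeightedGraph V} {s : V} {M : Finset V} {k : ℕ}
    {T : Set (ℕ → V)} {f : V → ℝ} (hf : ∀ x, 0 ≤ f x) (hM : ∀ x ∈ M, f x = 0)
    (hT : MeasurableSet T) (h : G.IsLowerBoundAt s M (k + 1) T f) :
    G.IsLowerBoundAt s M k T (G.killedStep M f) := by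
  intro x H hH hx
  by_cases hxM : x ∈ M
  · simp [G.killedStep_of_mem f hxM]
  have hterm : ∀ y, ENNReal.ofReal (G.w x y / G.deg x * f y) * G.walkLaw s H ≤
      G.walkLaw s (H ∩ {X | X (k + 1) = y} ∩ T) := by
    intro y
    by_cases hy : y ∈ M
    · simp [hM y hy]
    · refine le_trans ?_ (h y (H ∩ {X | X (k + 1) = y}) ?_ ?_)
      · rw [G.walkLaw_inter_next s k x y H hH fun X hX => (hx X hX).1, mul_comm (_ / _),
          ENNReal.ofReal_mul (hf y), mul_assoc]
        gcongr
        exact G.ofReal_le_step x y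
      · rintro X X' hXX ⟨h1, h2⟩
        exact ⟨hH X X' (fun r hr => hXX r (by omega)) h1, by
          rw [Set.mem_ofPred_eq, ← hXX (k + 1) le_rfl]; exact h2⟩
      · rintro X ⟨h1, h2⟩
        refine ⟨h2, fun r hr => ?_⟩
        rcases Nat.lt_or_ge r (k + 1) with h3 | h3
        · exact (hx X h1).2 r (by omega)
        · have : r = k + 1 := by omega
          rw [this, h2]; exact hy
  have hHm : MeasurableSet H := by
    let B : Set ((i : Finset.Iic k) → V) := {b | ∃ X ∈ H, ∀ i, X i.1 = b i}
    have hHB : H = (Preorder.frestrictLe (π := fun _ => V) k) ⁻¹' B := by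
      ext X
      constructor
      · intro hX
        exact ⟨X, hX, fun i => rfl⟩
      · rintro ⟨X', hX', h⟩
        exact hH X' X (fun r hr => h ⟨r, Finset.mem_Iic.2 hr⟩) hX'
    rw [hHB]
    exact (by fun_prop : Measurable (Preorder.frestrictLe (π := fun _ => V) k))
      (Set.toFinite B).measurableSet
  have hsum : ENNReal.ofReal (G.killedStep M f x) =
      ∑ y, ENNReal.ofReal (G.w x y / G.deg x * f y) := by
    rw [WeightedGraph.killedStep, if_neg hxM, ENNReal.ofReal_sum_of_nonneg]
    exact fun y _ => mul_nonneg (div_nonneg (G.nonneg x y) (G.deg_nonneg x)) (hf y)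
  rw [hsum, Finset.sum_mul]
  refine (Finset.sum_le_sum fun y _ => hterm y).trans ?_
  rw [← MeasureTheory.measure_biUnion_finset]
  · refine MeasureTheory.measure_mono ?_
    simp only [Set.iUnion_subset_iff]
    exact fun y _ X hX => ⟨hX.1.1, hX.2⟩
  · intro y _ z _ hyz
    refine Set.disjoint_left.2 fun X h1 h2 => hyz ?_
    exact h1.1.2.symm.trans h2.1.2
  · exact fun y _ => (hHm.inter (measurableSet_eval_mem (k + 1) {y})).inter hT

lemma isLowerBoundAt_hitProb (G : WeightedGraph V) {s : V} {M : Finset V} (hs : s ∉ M) (n k : ℕ) :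
    G.IsLowerBoundAt s M k (visitsFrom s M k) (G.hitProb s M n) := by
  have base : ∀ k (H : Set (ℕ → V)), (∀ X ∈ H, X k = s ∧ ∀ r ≤ k, X r ∉ M) →
      H ∩ visitsFrom s M k = H := by
    intro k H h
    refine Set.inter_eq_left.2 fun X hX => ⟨k, le_rfl, h X hX⟩
  induction n generalizing k with
  | zero =>
    intro x H hH hx
    by_cases h : x = s
    · subst h
      rw [base k H hx]; simp [hitProb]
    · simp [hitProb, h]
  | succ n ih =>
    intro x H hH hx
    by_cases h : x = s
    · subst h
      rw [base k H hx]; simp [hitProb]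
    · rw [hitProb, if_neg h]
      refine (IsLowerBoundAt.killedStep (G.hitProb_nonneg s M n)
        (fun x hx => G.hitProb_of_mem hs n hx) (measurableSet_visitsFrom s M (k + 1))
        (ih (k + 1)) x H hH hx).trans ?_
      gcongr
      rintro X ⟨r, hr, h⟩
      exact ⟨r, by omega, h⟩

lemma isLowerBoundAt_iterate (G : WeightedGraph V) {s : V} {M : Finset V} (hs : s ∉ M)
    (n t k : ℕ) : G.IsLowerBoundAt s M k (visitsFrom s M (k + t))
      ((G.killedStep M)^[t] (G.hitProb s M n)) := by
  induction t generalizing k with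
  | zero => exact G.isLowerBoundAt_hitProb hs n k
  | succ t ih =>
    rw [Function.iterate_succ_apply']
    refine IsLowerBoundAt.killedStep
      (G.iterate_killedStep_nonneg M (G.hitProb_nonneg s M n) t) ?_
      (measurableSet_visitsFrom s M _) ?_
    · intro x hx
      cases t with
      | zero => exact G.hitProb_of_mem hs n hx
      | succ t => rw [Function.iterate_succ_apply']; exact G.killedStep_of_mem _ hx
    · have := ih (k + 1)
      rwa [show k + 1 + t = k + (t + 1) by ring] at this

/-- The t-th summand bounds the probability of `visitsFrom s M t` from below: t steps outside `M`,
then a visit to `s`. The cutoffs `n` and `N` keep all sums finite; they are removed in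
`sum_iterate_hit_le` and `sum_deg_hit_sq_le`. -/
lemma sum_iterate_hitProb_le_escapeTime (G : WeightedGraph V) {s : V} {M : Finset V}
    (hs : s ∉ M) (n N : ℕ) :
    ENNReal.ofReal (∑ t ∈ Finset.range N, (G.killedStep M)^[t] (G.hitProb s M n) s) ≤
      G.escapeTime s M := by
  rw [ENNReal.ofReal_sum_of_nonneg fun t _ =>
    G.iterate_killedStep_nonneg M (G.hitProb_nonneg s M n) t s]
  calc ∑ t ∈ Finset.range N, ENNReal.ofReal ((G.killedStep M)^[t] (G.hitProb s M n) s)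
      ≤ ∑ t ∈ Finset.range N, G.walkLaw s (visitsFrom s M t) := by
        refine Finset.sum_le_sum fun t _ => ?_
        have h := G.isLowerBoundAt_iterate hs n t 0 s {X | X 0 = s}
          (fun X X' h hX => by rw [Set.mem_ofPred_eq, ← h 0 le_rfl]; exact hX)
          (fun X hX => ⟨hX, fun r hr => by
            have : r = 0 := by omega
            rw [this, hX]; exact hs⟩)
        rw [G.walkLaw_start, mul_one, zero_add] at h
        exact h.trans (MeasureTheory.measure_mono Set.inter_subset_right)
    _ = ∫⁻ X, ∑ t ∈ Finset.range N, (visitsFrom s M t).indicator 1 X ∂(G.walkLaw s) := by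
        rw [MeasureTheory.lintegral_finsetSum _ fun t _ =>
          (measurable_one.indicator (measurableSet_visitsFrom s M t))]
        refine Finset.sum_congr rfl fun t _ => ?_
        rw [MeasureTheory.lintegral_indicator_one (measurableSet_visitsFrom s M t)]
    _ ≤ G.escapeTime s M :=
        MeasureTheory.lintegral_mono fun X => sum_indicator_visitsFrom_le_lastExit s M N X

end WeightedGraph


/-! ### Potential theory: Thomson's principle and the energy bound from the escape time -/

namespace WeightedGraph

variable {V : Type u} [Fintype V]

lemma deg_mul_div (G : WeightedGraph V) (x y : V) : G.deg x * (G.w x y / G.deg x) = G.w x y := by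
  by_cases h : G.deg x = 0
  · have : G.w x y = 0 :=
      (Finset.sum_eq_zero_iff_of_nonneg fun z _ => G.nonneg x z).1 h y (Finset.mem_univ y)
    rw [h, this]; simp
  · field_simp

/-- Summation by parts: potential differences along a flow are paired with its divergence. -/
lemma sum_mul_sub_of_antisymm {f : V → V → ℝ} (hf : ∀ x y, f x y = - f y x) (v : V → ℝ) :
    ∑ x, ∑ y, f x y * (v x - v y) = 2 * ∑ x, v x * ∑ y, f x y := by
  have h : ∑ x, ∑ y, f x y * v y = - ∑ x, v x * ∑ y, f x y := by
    rw [Finset.sum_comm, ← Finset.sum_neg_distrib]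
    refine Finset.sum_congr rfl fun x _ => ?_
    rw [Finset.mul_sum, ← Finset.sum_neg_distrib]
    refine Finset.sum_congr rfl fun y _ => ?_
    rw [hf y x]; ring
  have h2 : ∑ x, ∑ y, f x y * v x = ∑ x, v x * ∑ y, f x y :=
    Finset.sum_congr rfl fun x _ => by
      rw [Finset.mul_sum]; exact Finset.sum_congr rfl fun y _ => mul_comm _ _
  simp only [mul_sub, Finset.sum_sub_distrib, h, h2]
  ring

variable [DecidableEq V]

lemma hitProb_le_one (G : WeightedGraph V) (s : V) (M : Finset V) (n : ℕ) (x : V) :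
    G.hitProb s M n x ≤ 1 := by
  induction n generalizing x with
  | zero => unfold hitProb; split_ifs <;> norm_num
  | succ n ih =>
    unfold hitProb
    split_ifs
    · norm_num
    · refine (G.killedStep_mono M ih x).trans ?_
      unfold killedStep
      split_ifs
      · norm_num
      · simp only [mul_one, ← Finset.sum_div]
        exact div_self_le_one _

lemma hitProb_le_succ (G : WeightedGraph V) (s : V) (M : Finset V) (n : ℕ) (x : V) :
    G.hitProb s M n x ≤ G.hitProb s M (n + 1) x := by
  induction n generalizing x with
  | zero =>
    by_cases h : x = s
    · simp [hitProb, h]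
    · rw [hitProb, if_neg h]; exact G.hitProb_nonneg s M 1 x
  | succ n ih =>
    by_cases h : x = s
    · simp [hitProb, h]
    · rw [hitProb, hitProb, if_neg h, if_neg h]; exact G.killedStep_mono M ih x

/-- The probability that the random walk from `x` meets `s` before `M`. -/
def hit (G : WeightedGraph V) (s : V) (M : Finset V) (x : V) : ℝ := ⨆ n, G.hitProb s M n x

lemma tendsto_hitProb (G : WeightedGraph V) (s : V) (M : Finset V) (x : V) :
    Filter.Tendsto (fun n => G.hitProb s M n x) Filter.atTop (nhds (G.hit s M x)) :=
  tendsto_atTop_ciSup (monotone_nat_of_le_succ fun n => G.hitProb_le_succ s M n x)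
    ⟨1, by rintro _ ⟨n, rfl⟩; exact G.hitProb_le_one s M n x⟩

lemma tendsto_killedStep (G : WeightedGraph V) (M : Finset V) {f : ℕ → V → ℝ} {g : V → ℝ}
    (h : ∀ x, Filter.Tendsto (fun n => f n x) Filter.atTop (nhds (g x))) (x : V) :
    Filter.Tendsto (fun n => G.killedStep M (f n) x) Filter.atTop (nhds (G.killedStep M g x)) := by
  unfold killedStep
  split_ifs
  · exact tendsto_const_nhds
  · exact tendsto_finsetSum _ fun y _ => (h y).const_mul _

lemma hit_nonneg (G : WeightedGraph V) (s : V) (M : Finset V) (x : V) : 0 ≤ G.hit s M x :=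
  ge_of_tendsto' (G.tendsto_hitProb s M x) fun n => G.hitProb_nonneg s M n x

lemma hit_source (G : WeightedGraph V) (s : V) (M : Finset V) : G.hit s M s = 1 := by
  refine tendsto_nhds_unique (G.tendsto_hitProb s M s) ?_
  have : (fun n => G.hitProb s M n s) = fun _ => 1 := by
    funext n; cases n <;> simp [hitProb]
  rw [this]; exact tendsto_const_nhds

lemma hit_of_mem (G : WeightedGraph V) {s : V} {M : Finset V} (hs : s ∉ M) {x : V}
    (hx : x ∈ M) : G.hit s M x = 0 := by
  refine tendsto_nhds_unique (G.tendsto_hitProb s M x) ?_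
  simp only [G.hitProb_of_mem hs _ hx]; exact tendsto_const_nhds

lemma hit_eq_killedStep (G : WeightedGraph V) (s : V) (M : Finset V) {x : V} (hx : x ≠ s) :
    G.hit s M x = G.killedStep M (G.hit s M) x := by
  refine tendsto_nhds_unique ((G.tendsto_hitProb s M x).comp (Filter.tendsto_add_atTop_nat 1)) ?_
  refine (G.tendsto_killedStep M (G.tendsto_hitProb s M) x).congr fun n => ?_
  simp [hitProb, hx]

/-- The effective conductance between `s` and `M`. -/
def effCond (G : WeightedGraph V) (s : V) (M : Finset V) : ℝ :=
  ∑ y, G.w s y * (1 - G.hit s M y)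

/-- `hit` is harmonic for the killed walk away from `s`, trivially so in `M`, where both terms
vanish. The defect at `s` is the current that leaves the source. -/
lemma deg_mul_sub_killedStep (G : WeightedGraph V) {s : V} {M : Finset V} (hs : s ∉ M) (x : V) :
    G.deg x * (G.hit s M x - G.killedStep M (G.hit s M) x) =
      if x = s then G.effCond s M else 0 := by
  split_ifs with h
  · subst h
    rw [G.hit_source, killedStep, if_neg hs, effCond, mul_sub, Finset.mul_sum]
    simp only [← mul_assoc, G.deg_mul_div, mul_sub, Finset.sum_sub_distrib, mul_one]
    rfl
  · rw [← G.hit_eq_killedStep s M h]; ring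

lemma sum_mul_hit_sub (G : WeightedGraph V) {s : V} {M : Finset V} (hs : s ∉ M) {x : V}
    (hx : x ∉ M) : ∑ y, G.w x y * (G.hit s M x - G.hit s M y) =
      if x = s then G.effCond s M else 0 := by
  rw [← G.deg_mul_sub_killedStep hs x, killedStep, if_neg hx, mul_sub, Finset.mul_sum]
  simp only [← mul_assoc, G.deg_mul_div, mul_sub, Finset.sum_sub_distrib]
  rw [← Finset.sum_mul]; rfl

lemma sum_mul_hit_sub_sq (G : WeightedGraph V) {s : V} {M : Finset V} (hs : s ∉ M) :
    ∑ x, ∑ y, G.w x y * (G.hit s M x - G.hit s M y) ^ 2 = 2 * G.effCond s M := by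
  have h := sum_mul_sub_of_antisymm (f := fun x y => G.w x y * (G.hit s M x - G.hit s M y))
    (fun x y => by rw [G.symm x y]; ring) (G.hit s M)
  calc _ = ∑ x, ∑ y, G.w x y * (G.hit s M x - G.hit s M y) * (G.hit s M x - G.hit s M y) := by
        refine Finset.sum_congr rfl fun x _ => Finset.sum_congr rfl fun y _ => by ring
    _ = _ := by
      rw [h, Finset.sum_eq_single s]
      · rw [G.sum_mul_hit_sub hs hs, if_pos rfl, G.hit_source, one_mul]
      · intro x _ hx
        by_cases hM : x ∈ M
        · rw [G.hit_of_mem hs hM, zero_mul]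
        · rw [G.sum_mul_hit_sub hs hM, if_neg hx, mul_zero]
      · simp

/-- Zero conductance means zero energy, so `hit` would be constant along edges, but it is 1 at `s`
and 0 at a reachable sink vertex. -/
lemma effCond_pos (G : WeightedGraph V) {s : V} {M : Finset V} (hs : s ∉ M)
    (hr : G.Reaches s M) : 0 < G.effCond s M := by
  have h0 : ∀ x y, 0 ≤ G.w x y * (G.hit s M x - G.hit s M y) ^ 2 := fun x y =>
    mul_nonneg (G.nonneg x y) (sq_nonneg _)
  have h := G.sum_mul_hit_sub_sq hs
  have hnn : 0 ≤ G.effCond s M := by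
    have : 0 ≤ ∑ x, ∑ y, G.w x y * (G.hit s M x - G.hit s M y) ^ 2 :=
      Finset.sum_nonneg fun x _ => Finset.sum_nonneg fun y _ => h0 x y
    linarith
  refine lt_of_le_of_ne hnn fun hc => ?_
  rw [← hc, mul_zero, Finset.sum_eq_zero_iff_of_nonneg
    fun x _ => Finset.sum_nonneg fun y _ => h0 x y] at h
  have hconst : ∀ x, Relation.ReflTransGen (fun x y => 0 < G.w x y) s x → G.hit s M x = 1 := by
    intro x hx
    induction hx with
    | refl => exact G.hit_source s M
    | tail _ hxy ih =>
      rename_i x y _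
      have h1 := (Finset.sum_eq_zero_iff_of_nonneg fun y _ => h0 x y).1
        (h x (Finset.mem_univ x)) y (Finset.mem_univ y)
      have h2 : (G.hit s M x - G.hit s M y) ^ 2 = 0 :=
        (mul_eq_zero.1 h1).resolve_left hxy.ne'
      have h3 := pow_eq_zero_iff (two_ne_zero) |>.1 h2
      linarith
  obtain ⟨m, hm, hsm⟩ := hr
  have := hconst m hsm
  rw [G.hit_of_mem hs hm] at this
  norm_num at this

lemma isUnitFlow_hit (G : WeightedGraph V) {s : V} {M : Finset V} (hs : s ∉ M)
    (hr : G.Reaches s M) :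
    G.IsUnitFlow s M fun x y => G.w x y * (G.hit s M x - G.hit s M y) / G.effCond s M := by
  have hc := (G.effCond_pos hs hr).ne'
  have hanti : ∀ x y, G.w x y * (G.hit s M x - G.hit s M y) / G.effCond s M =
      -(G.w y x * (G.hit s M y - G.hit s M x) / G.effCond s M) := fun x y => by
    rw [G.symm x y]; ring
  have hdiv : ∀ x ∉ M, ∑ y, G.w x y * (G.hit s M x - G.hit s M y) / G.effCond s M =
      if x = s then 1 else 0 := fun x hx => by
    rw [← Finset.sum_div, G.sum_mul_hit_sub hs hx]
    split_ifs
    · exact div_self hc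
    · simp
  refine ⟨fun x y h => by simp [h], hanti, by rw [hdiv s hs, if_pos rfl], ?_, fun x hx => ?_⟩
  -- Summation by parts against the constant 1: the total divergence is zero, so what leaves `s`
  -- arrives in `M`.
  · have h := sum_mul_sub_of_antisymm hanti fun _ => 1
    simp only [sub_self, mul_zero, Finset.sum_const_zero, one_mul] at h
    rw [← Finset.sum_add_sum_compl M] at h
    have h2 : ∑ x ∈ Mᶜ, ∑ y, G.w x y * (G.hit s M x - G.hit s M y) / G.effCond s M = 1 := by
      rw [Finset.sum_congr rfl fun x hx => hdiv x (Finset.mem_compl.1 hx)]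
      simp [hs]
    have h3 : ∑ m ∈ M, ∑ y, G.w y m * (G.hit s M y - G.hit s M m) / G.effCond s M =
        - ∑ x ∈ M, ∑ y, G.w x y * (G.hit s M x - G.hit s M y) / G.effCond s M := by
      rw [← Finset.sum_neg_distrib]
      refine Finset.sum_congr rfl fun x _ => ?_
      rw [← Finset.sum_neg_distrib]
      exact Finset.sum_congr rfl fun y _ => hanti y x
    rw [h3]; linarith
  · simp only [Finset.mem_insert, not_or] at hx
    rw [hdiv x hx.2, if_neg hx.1]

/-- Thomson's principle: the electric flow has minimal energy. -/
lemma effRes_eq_inv_effCond (G : WeightedGraph V) {s : V} {M : Finset V} (hs : s ∉ M)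
    (hr : G.Reaches s M) : G.effRes s M = (G.effCond s M)⁻¹ := by
  have hc := G.effCond_pos hs hr
  have hsq := G.sum_mul_hit_sub_sq hs
  refine IsLeast.csInf_eq ⟨⟨_, G.isUnitFlow_hit hs hr, ?_⟩, ?_⟩
  · have : ∀ x y, (G.w x y * (G.hit s M x - G.hit s M y) / G.effCond s M) ^ 2 / G.w x y =
        G.w x y * (G.hit s M x - G.hit s M y) ^ 2 * (G.effCond s M)⁻¹ ^ 2 := fun x y => by
      by_cases h : G.w x y = 0
      · simp [h]
      · field_simp
    simp only [energy, this, ← Finset.sum_mul, hsq]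
    field_simp
  · rintro e ⟨f, hf, rfl⟩
    have h1 : ∑ x, ∑ y, f x y * (G.hit s M x - G.hit s M y) = 2 := by
      rw [sum_mul_sub_of_antisymm hf.antisymm, Finset.sum_eq_single s]
      · rw [G.hit_source, hf.source]; norm_num
      · intro x _ hx
        by_cases hM : x ∈ M
        · rw [G.hit_of_mem hs hM, zero_mul]
        · rw [hf.conserved x (by simp [hx, hM]), mul_zero]
      · simp
    -- This is the nonnegativity of the squared difference between `f` and the electric flow,
    -- divided by the weight. Summed over all edges, it gives the lower bound on the energy.
    have h2 : ∀ x y, 2 * (G.effCond s M)⁻¹ * (f x y * (G.hit s M x - G.hit s M y)) -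
        (G.effCond s M)⁻¹ ^ 2 * (G.w x y * (G.hit s M x - G.hit s M y) ^ 2) ≤
        f x y ^ 2 / G.w x y := fun x y => by
      rcases (G.nonneg x y).eq_or_lt with h | h
      · rw [hf.supported x y h.symm, ← h]; simp
      · rw [le_div_iff₀ h]
        nlinarith [sq_nonneg (f x y - (G.effCond s M)⁻¹ * G.w x y * (G.hit s M x - G.hit s M y))]
    have h3 := Finset.sum_le_sum fun x (_ : x ∈ Finset.univ) =>
      Finset.sum_le_sum fun y (_ : y ∈ Finset.univ) => h2 x y
    simp only [Finset.sum_sub_distrib, ← Finset.mul_sum, h1, hsq] at h3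
    have h4 : 2 * (G.effCond s M)⁻¹ * 2 - (G.effCond s M)⁻¹ ^ 2 * (2 * G.effCond s M) =
        2 * (G.effCond s M)⁻¹ := by field_simp; ring
    rw [energy]; linarith

lemma effCond_le_deg (G : WeightedGraph V) (s : V) (M : Finset V) :
    G.effCond s M ≤ G.deg s := by
  unfold effCond deg
  refine Finset.sum_le_sum fun y _ => ?_
  nlinarith [G.nonneg s y, G.hit_nonneg s M y]

/-- Reversibility: the killed walk is self-adjoint for the weights `G.deg` on functions that vanish
on `M`. -/
lemma sum_deg_mul_killedStep (G : WeightedGraph V) {M : Finset V} {f g : V → ℝ}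
    (hf : ∀ x ∈ M, f x = 0) (hg : ∀ x ∈ M, g x = 0) :
    ∑ x, G.deg x * f x * G.killedStep M g x = ∑ x, G.deg x * G.killedStep M f x * g x := by
  have h : ∀ {f g : V → ℝ}, (∀ x ∈ M, f x = 0) →
      ∑ x, G.deg x * f x * G.killedStep M g x = ∑ x, ∑ y, G.w x y * (f x * g y) := by
    intro f g hf
    refine Finset.sum_congr rfl fun x _ => ?_
    by_cases hx : x ∈ M
    · simp [hf x hx]
    · rw [killedStep, if_neg hx, Finset.mul_sum]
      refine Finset.sum_congr rfl fun y _ => ?_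
      have := G.deg_mul_div x y
      linear_combination f x * g y * this
  rw [h hf]
  have h2 : ∑ x, G.deg x * G.killedStep M f x * g x = ∑ x, G.deg x * g x * G.killedStep M f x :=
    Finset.sum_congr rfl fun x _ => by ring
  rw [h2, h hg, Finset.sum_comm]
  exact Finset.sum_congr rfl fun x _ => Finset.sum_congr rfl fun y _ => by
    rw [G.symm]; ring

lemma iterate_killedStep_of_mem (G : WeightedGraph V) {M : Finset V} {f : V → ℝ}
    (hf : ∀ x ∈ M, f x = 0) (t : ℕ) {x : V} (hx : x ∈ M) : (G.killedStep M)^[t] f x = 0 := by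
  cases t with
  | zero => exact hf x hx
  | succ t => rw [Function.iterate_succ_apply']; exact G.killedStep_of_mem _ hx

/-- Self-adjointness moves one step of the walk from the iterate to `hit`, where the difference is
concentrated on `s`. -/
lemma sum_deg_hit_iterate_sub (G : WeightedGraph V) {s : V} {M : Finset V} (hs : s ∉ M) (t : ℕ) :
    ∑ x, G.deg x * G.hit s M x * (G.killedStep M)^[t] (G.hit s M) x -
      ∑ x, G.deg x * G.hit s M x * (G.killedStep M)^[t + 1] (G.hit s M) x =
      G.effCond s M * (G.killedStep M)^[t] (G.hit s M) s := by
  have hM : ∀ x ∈ M, G.hit s M x = 0 := fun x hx => G.hit_of_mem hs hx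
  simp only [Function.iterate_succ_apply']
  rw [G.sum_deg_mul_killedStep hM fun x hx => G.iterate_killedStep_of_mem hM t hx,
    ← Finset.sum_sub_distrib, Finset.sum_eq_single s]
  · rw [← sub_mul, ← mul_sub, G.deg_mul_sub_killedStep hs, if_pos rfl]
  · intro x _ hx
    rw [← sub_mul, ← mul_sub, G.deg_mul_sub_killedStep hs, if_neg hx, zero_mul]
  · simp

variable [MeasurableSpace V] [DiscreteMeasurableSpace V]

lemma sum_iterate_hit_le (G : WeightedGraph V) {s : V} {M : Finset V} (hs : s ∉ M) {E : ℝ}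
    (hE : G.escapeTime s M ≤ ENNReal.ofReal E) (hE0 : 0 ≤ E) (N : ℕ) :
    ∑ t ∈ Finset.range N, (G.killedStep M)^[t] (G.hit s M) s ≤ E := by
  have htend : ∀ t x, Filter.Tendsto (fun n => (G.killedStep M)^[t] (G.hitProb s M n) x)
      Filter.atTop (nhds ((G.killedStep M)^[t] (G.hit s M) x)) := by
    intro t
    induction t with
    | zero => exact G.tendsto_hitProb s M
    | succ t ih =>
      simp only [Function.iterate_succ_apply']
      exact G.tendsto_killedStep M ih
  refine le_of_tendsto' (tendsto_finsetSum _ fun t _ => htend t s) fun n => ?_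
  exact (ENNReal.ofReal_le_ofReal_iff hE0).1
    ((G.sum_iterate_hitProb_le_escapeTime hs n N).trans hE)

/-- The escape time dominates `∑_x d_x v_x² / R`, where `v` is the electric potential. -/
lemma sum_deg_hit_sq_le (G : WeightedGraph V) {s : V} {M : Finset V} (hs : s ∉ M) {E : ℝ}
    (hE : G.escapeTime s M ≤ ENNReal.ofReal E) (hE0 : 0 ≤ E) :
    ∑ x, G.deg x * G.hit s M x ^ 2 ≤ E * G.effCond s M := by
  have hM : ∀ x ∈ M, G.hit s M x = 0 := fun x hx => G.hit_of_mem hs hx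
  have hnn : ∀ t x, 0 ≤ (G.killedStep M)^[t] (G.hit s M) x := fun t x =>
    G.iterate_killedStep_nonneg M (G.hit_nonneg s M) t x
  have hsum := G.sum_iterate_hit_le hs hE hE0
  -- Telescoping needs the iterates of `hit` to die out. At `s` this follows from summability.
  have hs0 : Filter.Tendsto (fun t => (G.killedStep M)^[t] (G.hit s M) s) Filter.atTop (nhds 0) :=
    (summable_of_sum_range_le (hnn · s) hsum).tendsto_atTop_zero
  -- Decay spreads from `s`: if `y` is adjacent to `x` and outside `M`, then iterate t + 1 at `y` is
  -- at least the transition probability from `y` to `x` times iterate t at `x`. Vertices from which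
  -- `s` is never met have `hit` zero and do not contribute.
  have hpos : ∀ n x, 0 < G.hitProb s M n x →
      Filter.Tendsto (fun t => (G.killedStep M)^[t] (G.hit s M) x) Filter.atTop (nhds 0) := by
    intro n
    induction n with
    | zero =>
      intro x hx
      by_cases h : x = s
      · rw [h]; exact hs0
      · simp [hitProb, h] at hx
    | succ n ih =>
      intro x hx
      by_cases h : x = s
      · rw [h]; exact hs0
      rw [hitProb, if_neg h] at hx
      have hxM : x ∉ M := fun hx' => by rw [G.killedStep_of_mem _ hx'] at hx; exact lt_irrefl 0 hx
      rw [killedStep, if_neg hxM] at hx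
      obtain ⟨y, -, hy⟩ := Finset.exists_lt_of_sum_lt (s := Finset.univ) (f := fun _ => (0 : ℝ))
        (by simpa using hx)
      have hwd : 0 < G.w x y / G.deg x := by
        refine lt_of_le_of_ne (div_nonneg (G.nonneg x y) (G.deg_nonneg x)) fun h0 => ?_
        rw [← h0, zero_mul] at hy; exact lt_irrefl 0 hy
      have hny : 0 < G.hitProb s M n y := pos_of_mul_pos_right hy hwd.le
      have hw : 0 < G.w x y := by
        refine lt_of_le_of_ne (G.nonneg x y) fun h0 => ?_
        rw [← h0, zero_div] at hwd; exact lt_irrefl 0 hwd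
      have hyM : y ∉ M := fun hy' => by rw [G.hitProb_of_mem hs n hy'] at hny; exact lt_irrefl 0 hny
      have hdy : 0 < G.deg y := by
        have : G.w y x ≤ G.deg y := Finset.single_le_sum (f := fun z => G.w y z)
          (fun z _ => G.nonneg y z) (Finset.mem_univ x)
        rw [G.symm y x] at this; linarith
      have hpy : 0 < G.w y x / G.deg y := div_pos (by rw [G.symm]; exact hw) hdy
      have hlim := ((ih y hny).comp (Filter.tendsto_add_atTop_nat 1)).const_mul
        (G.w y x / G.deg y)⁻¹
      rw [mul_zero] at hlim
      refine squeeze_zero (fun t => hnn t x) (fun t => ?_) hlim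
      rw [Function.comp_apply, Function.iterate_succ_apply', ← div_eq_inv_mul, le_div_iff₀ hpy,
        killedStep, if_neg hyM, mul_comm]
      exact Finset.single_le_sum (f := fun z => G.w y z / G.deg y *
        (G.killedStep M)^[t] (G.hit s M) z)
        (fun z _ => mul_nonneg (div_nonneg (G.nonneg y z) (G.deg_nonneg y)) (hnn t z))
        (Finset.mem_univ x)
  have hall : Filter.Tendsto (fun t => ∑ x, G.deg x * G.hit s M x *
      (G.killedStep M)^[t] (G.hit s M) x) Filter.atTop (nhds 0) := by
    have : (0 : ℝ) = ∑ x : V, 0 := by simp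
    rw [this]
    refine tendsto_finsetSum _ fun x _ => ?_
    by_cases h : ∃ n, 0 < G.hitProb s M n x
    · obtain ⟨n, hn⟩ := h
      simpa using (hpos n x hn).const_mul (G.deg x * G.hit s M x)
    · have h0 : G.hit s M x = 0 := by
        refine le_antisymm ?_ (G.hit_nonneg s M x)
        exact le_of_tendsto' (G.tendsto_hitProb s M x) fun n => not_lt.1 fun h1 => h ⟨n, h1⟩
      simp [h0]
  have htel : ∀ N, ∑ x, G.deg x * G.hit s M x ^ 2 ≤ E * G.effCond s M +
      ∑ x, G.deg x * G.hit s M x * (G.killedStep M)^[N] (G.hit s M) x := by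
    intro N
    have h := Finset.sum_range_sub' (fun t => ∑ x, G.deg x * G.hit s M x *
      (G.killedStep M)^[t] (G.hit s M) x) N
    simp only [G.sum_deg_hit_iterate_sub hs, ← Finset.mul_sum] at h
    have h1 : ∑ x, G.deg x * G.hit s M x ^ 2 = ∑ x, G.deg x * G.hit s M x *
        (G.killedStep M)^[0] (G.hit s M) x :=
      Finset.sum_congr rfl fun x _ => by simp; ring
    have hc : 0 ≤ G.effCond s M := by
      have h2 := G.sum_mul_hit_sub_sq hs
      have : 0 ≤ ∑ x, ∑ y, G.w x y * (G.hit s M x - G.hit s M y) ^ 2 :=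
        Finset.sum_nonneg fun x _ => Finset.sum_nonneg fun y _ =>
          mul_nonneg (G.nonneg x y) (sq_nonneg _)
      linarith
    have h3 := mul_le_mul_of_nonneg_left (hsum N) hc
    rw [h1]; linarith
  have := ge_of_tendsto' (hall.const_add (E * G.effCond s M)) htel
  simpa using this

end WeightedGraph


/-! ### The walk operator and its action on the electric flow -/

lemma Complex.sq_norm_eq_re_im (z : ℂ) : ‖z‖ ^ 2 = z.re ^ 2 + z.im ^ 2 := by
  rw [Complex.sq_norm, Complex.normSq_apply]; ring

/-- The case `r = 0` is the star of an isolated vertex, whose star state is the zero vector; the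
walk operator is an isometry even then. -/
lemma sum_sq_reflection {ι : Type*} [Fintype ι] (r b : ι → ℝ) (hr : ∑ y, r y ^ 2 = 1 ∨ r = 0) :
    ∑ y, (2 * (r y * ∑ z, r z * b z) - b y) ^ 2 = ∑ y, b y ^ 2 := by
  rcases hr with hr | hr
  · set S := ∑ z, r z * b z with hS
    have : ∀ y, (2 * (r y * S) - b y) ^ 2 = 4 * S ^ 2 * r y ^ 2 - 4 * S * (r y * b y) + b y ^ 2 :=
      fun y => by ring
    simp only [this, Finset.sum_add_distrib, Finset.sum_sub_distrib, ← Finset.mul_sum, hr, ← hS]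
    ring
  · simp [hr]

namespace WeightedGraph

variable {V : Type u} [Fintype V]

lemma sum_div_deg (G : WeightedGraph V) (x : V) (h : G.deg x ≠ 0) :
    ∑ y, √(G.w x y / G.deg x) ^ 2 = 1 := by
  have : ∀ y, √(G.w x y / G.deg x) ^ 2 = G.w x y / G.deg x := fun y =>
    Real.sq_sqrt (div_nonneg (G.nonneg x y) (G.deg_nonneg x))
  simp only [this, ← Finset.sum_div]
  exact div_self h

lemma sqrt_div_deg_dichotomy (G : WeightedGraph V) (x : V) :
    ∑ y, √(G.w x y / G.deg x) ^ 2 = 1 ∨ (fun y => √(G.w x y / G.deg x)) = 0 := by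
  by_cases h : G.deg x = 0
  · right; funext y; simp [h]
  · exact Or.inl (G.sum_div_deg x h)

lemma sqrt_div_deg_mul_sqrt (G : WeightedGraph V) (x y : V) :
    √(G.w x y / G.deg x) * √(G.w x y) = G.w x y / √(G.deg x) := by
  rw [Real.sqrt_div (G.nonneg x y), div_mul_eq_mul_div, Real.mul_self_sqrt (G.nonneg x y)]

variable [DecidableEq V]

lemma swapOp_mulVec (φ : V × V → ℂ) : swapOp V *ᵥ φ = fun e => φ e.swap := by
  funext e
  simp only [swapOp, Matrix.mulVec, dotProduct, Matrix.of_apply, ite_mul, one_mul, zero_mul]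
  rw [Finset.sum_eq_single e.swap]
  · simp
  · intro b _ hb
    rw [if_neg]; rintro rfl; simp at hb
  · simp

lemma star_starState_dotProduct (G : WeightedGraph V) (x : V) (φ : V × V → ℂ) :
    star (G.starState x) ⬝ᵥ φ = ∑ z, ((√(G.w x z / G.deg x) : ℝ) : ℂ) * φ (x, z) := by
  simp only [dotProduct, Pi.star_apply, starState]
  rw [Fintype.sum_prod_type, Finset.sum_eq_single x]
  · simp
  · intro b _ hb; simp [hb]
  · simp

lemma walkOp_mulVec_apply (G : WeightedGraph V) (s : V) (M : Finset V) (φ : V × V → ℂ) (x y : V) :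
    (G.walkOp s M *ᵥ φ) (x, y) = (if x ∈ insert s M then 0 else
      2 * (((√(G.w x y / G.deg x) : ℝ) : ℂ) *
        ∑ z, ((√(G.w x z / G.deg x) : ℝ) : ℂ) * φ (z, x))) - φ (y, x) := by
  rw [walkOp, ← Matrix.mulVec_mulVec, swapOp_mulVec, Matrix.sub_mulVec, Matrix.smul_mulVec,
    Matrix.one_mulVec, Matrix.sum_mulVec]
  simp only [Matrix.vecMulVec_mulVec, star_starState_dotProduct, Pi.sub_apply, Pi.smul_apply,
    Finset.sum_apply, Prod.swap_prod_mk, smul_eq_mul, MulOpposite.smul_eq_mul_unop, MulOpposite.unop_op]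
  congr 1
  split_ifs with h
  · rw [Finset.sum_eq_zero, mul_zero]
    intro b hb
    have : x ≠ b := by rintro rfl; exact (Finset.mem_compl.1 hb) h
    simp [starState, this]
  · rw [Finset.sum_eq_single x]
    · simp [starState]
    · intro b _ hb; simp [starState, hb.symm]
    · exact fun h2 => absurd (Finset.mem_compl.2 h) h2

/-- The quantum walk operator is an isometry. -/
lemma sum_norm_walkOp_mulVec (G : WeightedGraph V) (s : V) (M : Finset V) (φ : V × V → ℂ) :
    ∑ e, ‖(G.walkOp s M *ᵥ φ) e‖ ^ 2 = ∑ e, ‖φ e‖ ^ 2 := by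
  have hswap : ∑ e, ‖φ e‖ ^ 2 = ∑ x, ∑ y, ‖φ (y, x)‖ ^ 2 := by
    rw [Fintype.sum_prod_type, Finset.sum_comm]
  rw [hswap, Fintype.sum_prod_type]
  refine Finset.sum_congr rfl fun x _ => ?_
  simp only [walkOp_mulVec_apply]
  split_ifs with h
  · simp
  · simp only [Complex.sq_norm_eq_re_im, Finset.sum_add_distrib]
    have h1 := sum_sq_reflection (fun y => √(G.w x y / G.deg x)) (fun y => (φ (y, x)).re)
      (G.sqrt_div_deg_dichotomy x)
    have h2 := sum_sq_reflection (fun y => √(G.w x y / G.deg x)) (fun y => (φ (y, x)).im)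
      (G.sqrt_div_deg_dichotomy x)
    rw [← h1, ← h2]
    congr 1 <;> refine Finset.sum_congr rfl fun y _ => ?_ <;> simp

/-- The vectors by which the quantum walk operator acts as a reflection up to a catalyst: `f` is the
electric flow state, and `c` is the symmetric part of the potential. -/
structure FlowVectors (U : Matrix (V × V) (V × V) ℂ) (ψ : V × V → ℂ) (x E : ℝ) (f c : V × V → ℝ) :
    Prop where
  antisymm : ∀ e, f e.swap = - f e
  symm : ∀ e, c e.swap = c e
  map_f : U *ᵥ (fun e => (f e : ℂ)) = fun e => (f e : ℂ)
  map_c : U *ᵥ (fun e => (c e : ℂ)) = fun e => (c e : ℂ) + 2 * (f e : ℂ) - 4 * x * ψ e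
  dot_f : star ψ ⬝ᵥ (fun e => (f e : ℂ)) = 1
  dot_c : star ψ ⬝ᵥ (fun e => (c e : ℂ)) = 2 * x - 1
  norm_f : ∑ e, f e ^ 2 = 2 * x
  norm_c : ∑ e, c e ^ 2 ≤ 4 * x * E
  one_le : 1 ≤ x
  le_E : x ≤ E

variable [MeasurableSpace V] [DiscreteMeasurableSpace V]

/-- On the star of an inner vertex, f is orthogonal to the star state since flow is conserved, and c
+ f is a multiple of the star state. As the swap negates f and fixes c, U maps f to f and c = (c +
f) - f to (c + f) + f. In `M` the potential vanishes, so c = -f there. At `s` nothing is reflected,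
and the discrepancy is 2(c + f) = 4x φ_s. The norm of f is the energy of the flow, and that of c is
controlled by the escape time. -/
lemma exists_flowVectors (G : WeightedGraph V) {s : V} {M : Finset V} (hs : s ∉ M)
    (hr : G.Reaches s M) {E : ℝ} (hE : G.escapeTime s M ≤ ENNReal.ofReal E) (hE0 : 0 ≤ E) :
    ∃ f c : V × V → ℝ, FlowVectors (G.walkOp s M) (G.starState s)
      (G.effRes s M * G.deg s) E f c := by
  have hc := G.effCond_pos hs hr
  have hd : 0 < G.deg s := hc.trans_le (G.effCond_le_deg s M)
  have hsq := G.sum_deg_hit_sq_le hs hE hE0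
  have hx : G.effRes s M * G.deg s = G.deg s / G.effCond s M := by
    rw [G.effRes_eq_inv_effCond hs hr]; field_simp
  set C := G.effCond s M with hC
  set κ := √(G.deg s) / C with hκ
  have hκ2 : κ ^ 2 = G.deg s / C ^ 2 := by
    rw [hκ, div_pow, Real.sq_sqrt hd.le]
  have hsd : √(G.deg s) * √(G.deg s) = G.deg s := Real.mul_self_sqrt hd.le
  have hsd0 : √(G.deg s) ≠ 0 := (Real.sqrt_pos.2 hd).ne'
  set h := G.hit s M with hh
  have hh1 : h s = 1 := G.hit_source s M
  have hdeg : ∑ z, G.w s z = G.deg s := rfl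
  have hxsum : ∀ x ∉ insert s M, ∑ y, G.w x y * h y = G.deg x * h x := by
    intro x hx
    simp only [Finset.mem_insert, not_or] at hx
    have := G.sum_mul_hit_sub hs hx.2
    rw [if_neg hx.1] at this
    simp only [mul_sub, Finset.sum_sub_distrib, ← Finset.sum_mul] at this
    rw [deg]; linarith
  have hssum : ∑ y, G.w s y * h y = G.deg s - C := by
    rw [hC, effCond, deg]
    simp only [mul_sub, mul_one, Finset.sum_sub_distrib]; ring
  have hψ : ∀ y, √(G.w s y / G.deg s) * (G.deg s / C) = κ * √(G.w s y) := by
    intro y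
    rw [hκ, Real.sqrt_div (G.nonneg s y)]
    field_simp
    rw [sq, hsd]
  have hprod : ∀ x y, √(G.w x y) * √(G.w x y) = G.w x y := fun x y =>
    Real.mul_self_sqrt (G.nonneg x y)
  -- The projection of √w · g to the star state replaces `g` by its weighted mean `b`.
  have hcoef : ∀ (x : V) (g : V → ℝ) (b : ℝ), (∑ z, G.w x z * g z = G.deg x * b) → ∀ y,
      √(G.w x y / G.deg x) * ∑ z, √(G.w x z / G.deg x) * (√(G.w x z) * g z) = √(G.w x y) * b := by
    intro x g b hg y
    have h1 : ∑ z, √(G.w x z / G.deg x) * (√(G.w x z) * g z) = G.deg x * b / √(G.deg x) := by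
      rw [← hg, Finset.sum_div]
      refine Finset.sum_congr rfl fun z _ => ?_
      rw [← mul_assoc, G.sqrt_div_deg_mul_sqrt]; ring
    rw [h1]
    by_cases h0 : G.deg x = 0
    · have : G.w x y = 0 := by rw [← G.deg_mul_div, h0, zero_mul]
      simp [h0, this]
    · have hp : 0 < G.deg x := lt_of_le_of_ne (G.deg_nonneg x) (Ne.symm h0)
      have := (Real.sqrt_pos.2 hp).ne'
      rw [Real.sqrt_div (G.nonneg x y)]
      field_simp
      rw [Real.sq_sqrt hp.le]
  refine ⟨fun e => κ * (√(G.w e.1 e.2) * (h e.1 - h e.2)),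
    fun e => κ * (√(G.w e.1 e.2) * (h e.1 + h e.2)), ?_, ?_, ?_, ?_, ?_, ?_, ?_, ?_, ?_, ?_⟩
  · rintro ⟨x, y⟩; simp only [Prod.swap_prod_mk, G.symm y x]; ring
  · rintro ⟨x, y⟩; simp only [Prod.swap_prod_mk, G.symm y x]; ring
  · funext ⟨x, y⟩
    rw [walkOp_mulVec_apply]
    simp only [G.symm _ x]
    split_ifs with hxm
    · push_cast; ring
    · have := hcoef x (fun z => h z - h x) 0 (by
        simp only [mul_sub, Finset.sum_sub_distrib, ← Finset.sum_mul, hxsum x hxm, deg]; ring) y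
      have h2 : ((√(G.w x y / G.deg x) : ℝ) : ℂ) * ∑ z, ((√(G.w x z / G.deg x) : ℝ) : ℂ) *
          ((κ * (√(G.w x z) * (h z - h x)) : ℝ) : ℂ) = (0 : ℝ) := by
        rw [← mul_zero κ, ← mul_zero (√(G.w x y)), ← this]
        push_cast
        simp only [Finset.mul_sum]
        exact Finset.sum_congr rfl fun z _ => by ring
      rw [h2]; push_cast; ring
  · funext ⟨x, y⟩
    rw [walkOp_mulVec_apply]
    simp only [G.symm _ x]
    split_ifs with hxm
    · rcases Finset.mem_insert.1 hxm with rfl | hxm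
      · simp only [starState, if_true]
        have h1 : h x = 1 := G.hit_source x M
        have h2 : ((√(G.w x y / G.deg x) : ℝ) : ℂ) * ((G.deg x / C : ℝ) : ℂ) =
            ((κ * √(G.w x y) : ℝ) : ℂ) := by rw [← hψ y]; push_cast; ring
        rw [hx, h1]
        push_cast at h2 ⊢
        linear_combination 4 * h2
      · have hxs : x ≠ s := fun hxs => hs (hxs ▸ hxm)
        have h1 : h x = 0 := G.hit_of_mem hs hxm
        simp only [starState, if_neg hxs, h1]
        push_cast; ring
    · have hxs : x ≠ s := by rintro rfl; simp at hxm
      have := hcoef x (fun z => h z + h x) (2 * h x) (by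
        simp only [mul_add, Finset.sum_add_distrib, ← Finset.sum_mul, hxsum x hxm, deg]; ring) y
      have h2 : ((√(G.w x y / G.deg x) : ℝ) : ℂ) * ∑ z, ((√(G.w x z / G.deg x) : ℝ) : ℂ) *
          ((κ * (√(G.w x z) * (h z + h x)) : ℝ) : ℂ) = (κ * (√(G.w x y) * (2 * h x)) : ℝ) := by
        rw [← this]
        push_cast
        simp only [Finset.mul_sum]
        exact Finset.sum_congr rfl fun z _ => by ring
      rw [h2]
      simp only [starState, if_neg hxs]
      push_cast; ring
  · rw [star_starState_dotProduct]
    have : ∑ z, √(G.w s z / G.deg s) * (κ * (√(G.w s z) * (h s - h z))) = 1 := by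
      have h1 : ∀ z, √(G.w s z / G.deg s) * (κ * (√(G.w s z) * (h s - h z))) =
          C⁻¹ * (G.w s z * (1 - h z)) := by
        intro z
        have := G.sqrt_div_deg_mul_sqrt s z
        rw [hh1, hκ]
        calc _ = √(G.deg s) / C * (√(G.w s z / G.deg s) * √(G.w s z)) * (1 - h z) := by ring
          _ = _ := by rw [this]; field_simp
      rw [Finset.sum_congr rfl fun z _ => h1 z, ← Finset.mul_sum]
      simp only [mul_sub, mul_one, Finset.sum_sub_distrib, hssum, hdeg]
      field_simp; ring
    rw [← Complex.ofReal_one, ← this]; push_cast; rfl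
  · rw [star_starState_dotProduct]
    have : ∑ z, √(G.w s z / G.deg s) * (κ * (√(G.w s z) * (h s + h z))) =
        2 * (G.deg s / C) - 1 := by
      have h1 : ∀ z, √(G.w s z / G.deg s) * (κ * (√(G.w s z) * (h s + h z))) =
          C⁻¹ * (G.w s z * (1 + h z)) := by
        intro z
        have := G.sqrt_div_deg_mul_sqrt s z
        rw [hh1, hκ]
        calc _ = √(G.deg s) / C * (√(G.w s z / G.deg s) * √(G.w s z)) * (1 + h z) := by ring
          _ = _ := by rw [this]; field_simp
      rw [Finset.sum_congr rfl fun z _ => h1 z, ← Finset.mul_sum]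
      simp only [mul_add, mul_one, Finset.sum_add_distrib, hssum, hdeg]
      field_simp; ring
    rw [hx]
    have h3 : ((2 * (G.deg s / C) - 1 : ℝ) : ℂ) = 2 * ((G.deg s / C : ℝ) : ℂ) - 1 := by push_cast; ring
    rw [← h3, ← this]; push_cast; rfl
  · have h1 : ∀ x y, (κ * (√(G.w x y) * (h x - h y))) ^ 2 =
        κ ^ 2 * (G.w x y * (h x - h y) ^ 2) := fun x y => by
      linear_combination κ ^ 2 * (h x - h y) ^ 2 * hprod x y
    rw [Fintype.sum_prod_type]
    simp only [h1, ← Finset.mul_sum]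
    rw [G.sum_mul_hit_sub_sq hs, hκ2, hx, ← hC]
    field_simp
  · have h1 : ∀ x y, (κ * (√(G.w x y) * (h x + h y))) ^ 2 ≤
        κ ^ 2 * (2 * (G.w x y * h x ^ 2) + 2 * (G.w y x * h y ^ 2)) := fun x y => by
      have : (κ * (√(G.w x y) * (h x + h y))) ^ 2 = κ ^ 2 * (G.w x y * (h x + h y) ^ 2) := by
        linear_combination κ ^ 2 * (h x + h y) ^ 2 * hprod x y
      rw [this, G.symm y x]
      refine mul_le_mul_of_nonneg_left ?_ (sq_nonneg κ)
      nlinarith [mul_nonneg (G.nonneg x y) (sq_nonneg (h x - h y))]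
    rw [Fintype.sum_prod_type]
    refine (Finset.sum_le_sum fun x _ => Finset.sum_le_sum fun y _ => h1 x y).trans ?_
    have h2 : ∑ x, ∑ y, G.w x y * h x ^ 2 = ∑ x, G.deg x * h x ^ 2 := by
      simp only [← Finset.sum_mul, deg]
    have h3 : ∑ x, ∑ y, G.w y x * h y ^ 2 = ∑ x, G.deg x * h x ^ 2 := by
      rw [Finset.sum_comm, h2]
    simp only [← Finset.mul_sum, Finset.sum_add_distrib, h2, h3, hκ2, hx]
    calc G.deg s / C ^ 2 * (2 * ∑ x, G.deg x * h x ^ 2 + 2 * ∑ x, G.deg x * h x ^ 2)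
        = 4 * (G.deg s / C ^ 2) * ∑ x, G.deg x * h x ^ 2 := by ring
      _ ≤ 4 * (G.deg s / C ^ 2) * (E * C) :=
        mul_le_mul_of_nonneg_left hsq (by positivity)
      _ = 4 * (G.deg s / C) * E := by field_simp
  · rw [hx, le_div_iff₀ hc, one_mul]; exact G.effCond_le_deg s M
  · rw [hx, div_le_iff₀ hc]
    refine le_trans ?_ hsq
    have := Finset.single_le_sum (f := fun x => G.deg x * h x ^ 2)
      (fun x _ => mul_nonneg (G.deg_nonneg x) (sq_nonneg _)) (Finset.mem_univ s)
    have h1 : h s = 1 := G.hit_source s M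
    simpa [h1] using this

end WeightedGraph


/-! ### Norms and unitaries -/

/-- The squared Euclidean norm of a vector of amplitudes. -/
def sqNorm {ι : Type*} [Fintype ι] (ψ : ι → ℂ) : ℝ := ∑ i, ‖ψ i‖ ^ 2

section SqNorm

variable {ι κ : Type*} [Fintype ι] [Fintype κ]

lemma sqNorm_nonneg (ψ : ι → ℂ) : 0 ≤ sqNorm ψ := Finset.sum_nonneg fun _ _ => sq_nonneg _

lemma sqNorm_smul (c : ℂ) (ψ : ι → ℂ) : sqNorm (c • ψ) = ‖c‖ ^ 2 * sqNorm ψ := by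
  simp [sqNorm, Finset.mul_sum, mul_pow]

lemma sq_norm_sub_le (a b : ℂ) : ‖a - b‖ ^ 2 ≤ 2 * ‖a‖ ^ 2 + 2 * ‖b‖ ^ 2 := by
  have h := norm_sub_le a b
  nlinarith [sq_nonneg (‖a‖ - ‖b‖), norm_nonneg (a - b), norm_nonneg a, norm_nonneg b]

lemma sqNorm_sub_le (ψ φ : ι → ℂ) : sqNorm (ψ - φ) ≤ 2 * sqNorm ψ + 2 * sqNorm φ := by
  unfold sqNorm
  rw [Finset.mul_sum, Finset.mul_sum, ← Finset.sum_add_distrib]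
  exact Finset.sum_le_sum fun i _ => sq_norm_sub_le (ψ i) (φ i)

lemma sqNorm_single [DecidableEq ι] (i : ι) : sqNorm (Pi.single i 1 : ι → ℂ) = 1 := by
  unfold sqNorm
  rw [Finset.sum_eq_single i]
  · simp
  · intro j _ hj; simp [hj]
  · simp

lemma sqNorm_eq_norm (ψ : ι → ℂ) : sqNorm ψ = ‖(WithLp.toLp 2 ψ : EuclideanSpace ℂ ι)‖ ^ 2 := by
  rw [EuclideanSpace.norm_sq_eq]; rfl

variable [DecidableEq ι]

lemma sqNorm_unitary_mulVec {Q : Matrix ι ι ℂ} (hQ : Q ∈ Matrix.unitaryGroup ι ℂ) (ψ : ι → ℂ) :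
    sqNorm (Q *ᵥ ψ) = sqNorm ψ := by
  have h : ∀ φ : ι → ℂ, ((sqNorm φ : ℝ) : ℂ) = star φ ⬝ᵥ φ := by
    intro φ
    simp only [sqNorm, dotProduct, Pi.star_apply, Complex.ofReal_sum, Complex.ofReal_pow]
    exact Finset.sum_congr rfl fun i _ => (Complex.conj_mul' (φ i)).symm
  have : ((sqNorm (Q *ᵥ ψ) : ℝ) : ℂ) = sqNorm ψ := by
    rw [h, h, Matrix.star_mulVec, Matrix.dotProduct_mulVec, Matrix.vecMul_vecMul,
      ← Matrix.star_eq_conjTranspose, Matrix.mem_unitaryGroup_iff'.1 hQ, Matrix.vecMul_one]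
  exact_mod_cast this

/-- A norm-preserving linear map is given by a unitary matrix. -/
lemma toMatrix'_mem_unitaryGroup (L : (ι → ℂ) →ₗ[ℂ] (ι → ℂ)) (hL : ∀ ψ, sqNorm (L ψ) = sqNorm ψ) :
    LinearMap.toMatrix' L ∈ Matrix.unitaryGroup ι ℂ := by
  let e := WithLp.linearEquiv 2 ℂ (ι → ℂ)
  let L' : EuclideanSpace ℂ ι →ₗ[ℂ] EuclideanSpace ℂ ι := e.symm.toLinearMap ∘ₗ L ∘ₗ e.toLinearMap
  have hnorm : ∀ x, ‖L' x‖ = ‖x‖ := by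
    intro x
    have h1 := hL (e x)
    rw [sqNorm_eq_norm, sqNorm_eq_norm] at h1
    exact (pow_left_inj₀ (norm_nonneg _) (norm_nonneg _) two_ne_zero).1 h1
  let I : EuclideanSpace ℂ ι →ₗᵢ[ℂ] EuclideanSpace ℂ ι := ⟨L', hnorm⟩
  rw [Matrix.mem_unitaryGroup_iff']
  ext i j
  have h := I.inner_map_map (EuclideanSpace.single i 1) (EuclideanSpace.single j 1)
  rw [EuclideanSpace.inner_single_left] at h
  have hI : ∀ (i k : ι), (I (EuclideanSpace.single i 1)) k = LinearMap.toMatrix' L k i := by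
    intro i k
    rw [LinearMap.toMatrix'_apply]
    change (L (e (EuclideanSpace.single i 1))) k = _
    congr 2
  rw [EuclideanSpace.inner_eq_star_dotProduct, dotProduct] at h
  rw [Matrix.mul_apply, Matrix.one_apply]
  have h2 : ∀ k, (star (LinearMap.toMatrix' L)) i k * LinearMap.toMatrix' L k j =
      (I (EuclideanSpace.single j 1)).ofLp k * star ((I (EuclideanSpace.single i 1)).ofLp k) := by
    intro k
    rw [hI, hI, Matrix.star_apply, mul_comm]
  rw [Finset.sum_congr rfl fun k _ => h2 k]
  refine h.trans ?_
  simp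

lemma exists_unitary_mulVec_single (i : ι) (v : ι → ℂ) (hv : sqNorm v = 1) :
    ∃ Q ∈ Matrix.unitaryGroup ι ℂ, Q *ᵥ Pi.single i 1 = v := by
  have hv1 : ‖(WithLp.toLp 2 v : EuclideanSpace ℂ ι)‖ = 1 := by
    have := sqNorm_eq_norm v
    rw [hv] at this
    exact (pow_eq_one_iff_of_nonneg (norm_nonneg _) two_ne_zero).1 this.symm
  obtain ⟨b, hb⟩ := Orthonormal.exists_orthonormalBasis_extension_of_card_eq (𝕜 := ℂ)
    (E := EuclideanSpace ℂ ι) (ι := ι) (by simp) (v := fun _ => WithLp.toLp 2 v) (s := {i}) (by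
      constructor
      · intro j; simpa using hv1
      · intro j k hjk; exact absurd (Subsingleton.elim j k) hjk)
  refine ⟨(EuclideanSpace.basisFun ι ℂ).toBasis.toMatrix b,
    OrthonormalBasis.toMatrix_orthonormalBasis_mem_unitary _ _, ?_⟩
  rw [Matrix.mulVec_single_one]
  funext j
  simp [Matrix.col_apply, Module.Basis.toMatrix_apply, hb i rfl]

end SqNorm

/-! ### Programs: instruction lists followed by a complete measurement -/

namespace WalkAlgorithm

variable {V : Type u} [Fintype V] [DecidableEq V]

section Programs

variable {k : ℕ}

lemma ctrl_smul (c : Finset (Fin (k + 1))) (O : Matrix (V × V) (V × V) ℂ) (a : ℂ)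
    (ψ : (V × V) × Fin (k + 1) → ℂ) : ctrl c O (a • ψ) = a • ctrl c O ψ := by
  funext i
  by_cases h : i.2 ∈ c
  · simp only [ctrl, if_pos h, Pi.smul_apply]
    exact congrFun (Matrix.mulVec_smul O a fun e => ψ (e, i.2)) i.1
  · simp only [ctrl, if_neg h, Pi.smul_apply]

lemma expect_smul (U P : Matrix (V × V) (V × V) ℂ) (g : ℝ → ℕ → ℝ) (A : WalkAlgorithm V k)
    (n : ℕ) (a : ℂ) (ψ : (V × V) × Fin (k + 1) → ℂ) :
    A.expect U P g n (a • ψ) = ‖a‖ ^ 2 * A.expect U P g n ψ := by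
  induction A generalizing n ψ with
  | output r =>
    have := sqNorm_smul a ψ
    simp only [sqNorm] at this
    simp only [expect, this, mul_assoc]
  | unitary Q next ih => simp only [expect, Matrix.mulVec_smul, ih]
  | walk c next ih => simp only [expect, ctrl_smul, ih]
  | prep c next ih => simp only [expect, ctrl_smul, ih]
  | prepInv c next ih => simp only [expect, ctrl_smul, ih]
  | measure l out next ih =>
    simp only [expect, Finset.mul_sum]
    refine Finset.sum_congr rfl fun j _ => ?_
    rw [← ih]
    congr 1
    funext i
    simp only [Pi.smul_apply, smul_eq_mul]
    split_ifs <;> simp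

/-- A unitary that moves the basis state `i` to the initial basis state. -/
lemma exists_reset (s : V) (i : (V × V) × Fin (k + 1)) :
    ∃ Q : Matrix.unitaryGroup ((V × V) × Fin (k + 1)) ℂ, Q.1 *ᵥ Pi.single i 1 = initState s := by
  obtain ⟨Q, hQ, h⟩ := exists_unitary_mulVec_single i (initState (k := k) s)
    (sqNorm_single _)
  exact ⟨⟨Q, hQ⟩, h⟩

/-- Measure everything, reset to the initial state, and go on depending on the outcome. -/
def measureAll (s : V) (cont : (V × V) × Fin (k + 1) → WalkAlgorithm V k) : WalkAlgorithm V k :=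
  measure (Fintype.card ((V × V) × Fin (k + 1))) (Fintype.equivFin _) fun j =>
    unitary (exists_reset s ((Fintype.equivFin _).symm j)).choose
      (cont ((Fintype.equivFin _).symm j))

/-- A complete measurement leaves a multiple of a basis state, which is reset to the initial state.
Hence successive runs combine like independent classical experiments. -/
lemma expect_measureAll (U P : Matrix (V × V) (V × V) ℂ) (g : ℝ → ℕ → ℝ) (s : V)
    (cont : (V × V) × Fin (k + 1) → WalkAlgorithm V k) (n : ℕ)
    (ψ : (V × V) × Fin (k + 1) → ℂ) :
    (measureAll s cont).expect U P g n ψ =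
      ∑ i, ‖ψ i‖ ^ 2 * (cont i).expect U P g n (initState s) := by
  simp only [measureAll, expect]
  rw [← (Fintype.equivFin ((V × V) × Fin (k + 1))).sum_comp]
  refine Finset.sum_congr rfl fun i _ => ?_
  simp only [Equiv.symm_apply_apply, EmbeddingLike.apply_eq_iff_eq]
  have h : (fun i' => if i' = i then ψ i' else 0) = ψ i • (Pi.single i 1 : _ → ℂ) := by
    funext i'
    by_cases hi : i' = i
    · subst hi; simp
    · simp [hi]
  rw [h, Matrix.mulVec_smul, expect_smul, (exists_reset s i).choose_spec]

end Programs

variable {W : Type} [Fintype W] [DecidableEq W]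

variable (V W) in
/-- The instructions of a `WalkAlgorithm` other than `output` and `measure`, for a workspace with
basis `W`. -/
inductive Op : Type u
  | fixed (Q : Matrix.unitaryGroup ((V × V) × W) ℂ) : Op
  | walk (c : Finset W) : Op
  | prep (c : Finset W) : Op
  | prepInv (c : Finset W) : Op

namespace Op

/-- Apply `O` to the register if the workspace is in a basis state of `c`. -/
def control (c : Finset W) (O : Matrix (V × V) (V × V) ℂ) (ψ : (V × V) × W → ℂ) :
    (V × V) × W → ℂ :=
  fun i => if i.2 ∈ c then (O *ᵥ fun e => ψ (e, i.2)) i.1 else ψ i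

/-- The action of an instruction on the state. -/
def act (U P : Matrix (V × V) (V × V) ℂ) : Op V W → ((V × V) × W → ℂ) → ((V × V) × W → ℂ)
  | fixed Q, ψ => Q.1 *ᵥ ψ
  | walk c, ψ => control c U ψ
  | prep c, ψ => control c P ψ
  | prepInv c, ψ => control c Pᴴ ψ

/-- The number of quantum walk steps of an instruction. -/
def cost : Op V W → ℕ
  | fixed _ => 0
  | _ => 1

/-- The instruction given by a norm-preserving linear map. -/
def ofIsometry (L : ((V × V) × W → ℂ) →ₗ[ℂ] ((V × V) × W → ℂ))
    (hL : ∀ ψ, sqNorm (L ψ) = sqNorm ψ) : Op V W :=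
  fixed ⟨LinearMap.toMatrix' L, toMatrix'_mem_unitaryGroup L hL⟩

lemma act_ofIsometry (U P : Matrix (V × V) (V × V) ℂ)
    (L : ((V × V) × W → ℂ) →ₗ[ℂ] ((V × V) × W → ℂ))
    (hL : ∀ ψ, sqNorm (L ψ) = sqNorm ψ) (ψ : (V × V) × W → ℂ) :
    (ofIsometry L hL).act U P ψ = L ψ := by
  simp only [ofIsometry, act]
  exact LinearMap.toMatrix'_mulVec L ψ

lemma control_sub (c : Finset W) (O : Matrix (V × V) (V × V) ℂ) (ψ φ : (V × V) × W → ℂ) :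
    control c O (ψ - φ) = control c O ψ - control c O φ := by
  funext i
  by_cases h : i.2 ∈ c
  · simp only [control, if_pos h, Pi.sub_apply]
    exact congrFun (Matrix.mulVec_sub O (fun e => ψ (e, i.2)) fun e => φ (e, i.2)) i.1
  · simp only [control, if_neg h, Pi.sub_apply]

lemma sqNorm_control (c : Finset W) {O : Matrix (V × V) (V × V) ℂ}
    (hO : ∀ φ, sqNorm (O *ᵥ φ) = sqNorm φ) (ψ : (V × V) × W → ℂ) :
    sqNorm (control c O ψ) = sqNorm ψ := by
  unfold sqNorm
  rw [Fintype.sum_prod_type_right, Fintype.sum_prod_type_right]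
  refine Finset.sum_congr rfl fun j _ => ?_
  by_cases h : j ∈ c
  · simp only [control, h, if_true]
    exact hO fun e => ψ (e, j)
  · simp only [control, h, if_false]

lemma act_sub (U P : Matrix (V × V) (V × V) ℂ) (op : Op V W) (ψ φ : (V × V) × W → ℂ) :
    op.act U P (ψ - φ) = op.act U P ψ - op.act U P φ := by
  cases op
  · exact Matrix.mulVec_sub _ _ _
  all_goals exact control_sub _ _ _ _

lemma sqNorm_act {U P : Matrix (V × V) (V × V) ℂ} (hU : ∀ φ, sqNorm (U *ᵥ φ) = sqNorm φ)
    (hP : P ∈ Matrix.unitaryGroup (V × V) ℂ) (op : Op V W) (ψ : (V × V) × W → ℂ) :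
    sqNorm (op.act U P ψ) = sqNorm ψ := by
  cases op with
  | fixed Q => exact sqNorm_unitary_mulVec Q.2 ψ
  | walk c => exact sqNorm_control c hU ψ
  | prep c => exact sqNorm_control c (sqNorm_unitary_mulVec hP) ψ
  | prepInv c => exact sqNorm_control c (sqNorm_unitary_mulVec (Unitary.star_mem hP)) ψ

/-- The instruction as part of a `WalkAlgorithm`. -/
def compile {k : ℕ} (e : W ≃ Fin (k + 1)) : Op V W → WalkAlgorithm V k → WalkAlgorithm V k
  | fixed Q, A => unitary ⟨Q.1.submatrix (Prod.map id e.symm) (Prod.map id e.symm), by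
      have := Q.2
      rw [Matrix.mem_unitaryGroup_iff'] at this ⊢
      rw [Matrix.star_eq_conjTranspose, Matrix.conjTranspose_submatrix,
        show Prod.map id e.symm = ((Equiv.refl (V × V)).prodCongr e.symm) from rfl,
        Matrix.submatrix_mul_equiv, ← Matrix.star_eq_conjTranspose, this,
        Matrix.submatrix_one_equiv]⟩ A
  | walk c, A => .walk (c.map e.toEmbedding) A
  | prep c, A => .prep (c.map e.toEmbedding) A
  | prepInv c, A => .prepInv (c.map e.toEmbedding) A

lemma ctrl_map {k : ℕ} (e : W ≃ Fin (k + 1)) (c : Finset W) (O : Matrix (V × V) (V × V) ℂ)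
    (ψ : (V × V) × W → ℂ) : ctrl (c.map e.toEmbedding) O (ψ ∘ Prod.map id e.symm) =
      control c O ψ ∘ Prod.map id e.symm := by
  funext i
  simp only [ctrl, control, Finset.mem_map_equiv, Function.comp_apply, Prod.map_apply, id,
    Prod.map_snd, Prod.map_fst]

lemma expect_compile {k : ℕ} (e : W ≃ Fin (k + 1)) (U P : Matrix (V × V) (V × V) ℂ)
    (g : ℝ → ℕ → ℝ) (op : Op V W) (A : WalkAlgorithm V k) (n : ℕ) (ψ : (V × V) × W → ℂ) :
    (op.compile e A).expect U P g n (ψ ∘ Prod.map id e.symm) =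
      A.expect U P g (n + op.cost) (op.act U P ψ ∘ Prod.map id e.symm) := by
  cases op with
  | fixed Q =>
    simp only [compile, expect, act, cost, add_zero]
    congr 1
    have := Matrix.submatrix_mulVec_equiv Q.1 (ψ ∘ Prod.map id e.symm) (Prod.map id e.symm)
      ((Equiv.refl (V × V)).prodCongr e.symm)
    rw [show Prod.map id e.symm = ((Equiv.refl (V × V)).prodCongr e.symm) from rfl] at this ⊢
    rw [this]
    congr 2
    funext ⟨a, b⟩
    simp
  | walk c => simp only [compile, expect, act, cost, ctrl_map]
  | prep c => simp only [compile, expect, act, cost, ctrl_map]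
  | prepInv c => simp only [compile, expect, act, cost, ctrl_map]

/-- The action of a list of instructions. -/
def actList (U P : Matrix (V × V) (V × V) ℂ) (l : List (Op V W)) (ψ : (V × V) × W → ℂ) :
    (V × V) × W → ℂ :=
  l.foldl (fun φ op => op.act U P φ) ψ

lemma actList_append (U P : Matrix (V × V) (V × V) ℂ) (l₁ l₂ : List (Op V W))
    (ψ : (V × V) × W → ℂ) : actList U P (l₁ ++ l₂) ψ = actList U P l₂ (actList U P l₁ ψ) := by
  simp [actList]

lemma actList_sub (U P : Matrix (V × V) (V × V) ℂ) (l : List (Op V W)) (ψ φ : (V × V) × W → ℂ) :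
    actList U P l (ψ - φ) = actList U P l ψ - actList U P l φ := by
  induction l generalizing ψ φ with
  | nil => rfl
  | cons op l ih =>
    simp only [actList, List.foldl_cons] at ih ⊢
    rw [act_sub, ih]

lemma sqNorm_actList {U P : Matrix (V × V) (V × V) ℂ} (hU : ∀ φ, sqNorm (U *ᵥ φ) = sqNorm φ)
    (hP : P ∈ Matrix.unitaryGroup (V × V) ℂ) (l : List (Op V W)) (ψ : (V × V) × W → ℂ) :
    sqNorm (actList U P l ψ) = sqNorm ψ := by
  induction l generalizing ψ with
  | nil => rfl
  | cons op l ih =>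
    simp only [actList, List.foldl_cons] at ih ⊢
    rw [ih, sqNorm_act hU hP]

/-- Perform a list of instructions, measure everything, reset, and go on depending on the
outcome. -/
def run {k : ℕ} (e : W ≃ Fin (k + 1)) (s : V) (l : List (Op V W))
    (cont : (V × V) × W → WalkAlgorithm V k) : WalkAlgorithm V k :=
  l.foldr (compile e) (measureAll s fun i => cont (i.1, e.symm i.2))

lemma expect_run {k : ℕ} (e : W ≃ Fin (k + 1)) (U P : Matrix (V × V) (V × V) ℂ)
    (g : ℝ → ℕ → ℝ) (s : V) (l : List (Op V W)) (cont : (V × V) × W → WalkAlgorithm V k) (n : ℕ) :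
    (run e s l cont).expect U P g n (initState s) =
      ∑ i, ‖actList U P l (Pi.single ((s, s), e.symm 0) 1) i‖ ^ 2 *
        (cont i).expect U P g (n + (l.map cost).sum) (initState s) := by
  have h : ∀ (l : List (Op V W)) (n : ℕ) (ψ : (V × V) × W → ℂ),
      (run e s l cont).expect U P g n (ψ ∘ Prod.map id e.symm) =
      ∑ i, ‖actList U P l ψ i‖ ^ 2 *
        (cont i).expect U P g (n + (l.map cost).sum) (initState s) := by
    intro l
    induction l with
    | nil =>
      intro n ψ
      simp only [run, List.foldr_nil, expect_measureAll, actList, List.foldl_nil, List.map_nil,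
        List.sum_nil, add_zero]
      exact ((Equiv.refl (V × V)).prodCongr e.symm).sum_comp
        (fun i => ‖ψ i‖ ^ 2 * (cont i).expect U P g n (initState s))
    | cons op l ih =>
      intro n ψ
      simp only [run, List.foldr_cons] at ih ⊢
      rw [expect_compile, ih]
      simp only [actList, List.foldl_cons, List.map_cons, List.sum_cons, add_assoc]
  rw [← h]
  congr 1
  funext i
  simp only [initState, Function.comp_apply, Pi.single_apply, Prod.ext_iff, Prod.map_fst,
    Prod.map_snd, id, Equiv.apply_eq_iff_eq]

end Op

end WalkAlgorithm


/-! ### The fixed unitaries of the pipeline -/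

/-- The workspace of the pipeline: a clock, a position, and two flags. The second flag tells the
register of the walk (`true`) from an additional edge (`false`), and the first flag tells the
private (`true`) from the public (`false`) vectors. -/
abbrev Lab (T L : ℕ) : Type := (Fin T × Fin L) × (Bool × Bool)

namespace Pipeline

variable {V : Type u} [Fintype V] [DecidableEq V] {T L : ℕ}

lemma sqNorm_eq_sum_fibers (ψ : (V × V) × Lab T L → ℂ) :
    sqNorm ψ = ∑ c : Fin T × Fin L, ∑ z : V × V,
      ((‖ψ (z, (c, (false, false)))‖ ^ 2 + ‖ψ (z, (c, (true, false)))‖ ^ 2) +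
      (‖ψ (z, (c, (false, true)))‖ ^ 2 + ‖ψ (z, (c, (true, true)))‖ ^ 2)) := by
  unfold sqNorm
  rw [Fintype.sum_prod_type_right, Fintype.sum_prod_type]
  refine Finset.sum_congr rfl fun c _ => ?_
  rw [Finset.sum_comm]
  refine Finset.sum_congr rfl fun z _ => ?_
  rw [Fintype.sum_prod_type]
  simp only [Fintype.sum_bool]
  ring

/-- Here a and b are the public and private amplitudes on an edge, and e' is the value of a - hb on
the reversed edge. The defect on the right changes sign under reversal and cancels in the sum over
all edges: `mixMap` is the reflection along (1, -h) on antisymmetric vectors. The additional edge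
counts as antisymmetric, with e' = -(a - hb). -/
lemma sq_norm_mix (h : ℝ) (a b e' : ℂ) :
    ‖a + ((-2 / (1 + h ^ 2) : ℝ) : ℂ) * ((a - h * b - e') / 2)‖ ^ 2 +
      ‖b + ((2 * h / (1 + h ^ 2) : ℝ) : ℂ) * ((a - h * b - e') / 2)‖ ^ 2 =
      ‖a‖ ^ 2 + ‖b‖ ^ 2 - (1 + h ^ 2)⁻¹ * (‖a - h * b‖ ^ 2 - ‖e'‖ ^ 2) := by
  have key : ∀ a b e' : ℝ, (a + (-2 / (1 + h ^ 2)) * ((a - h * b - e') / 2)) ^ 2 +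
      (b + (2 * h / (1 + h ^ 2)) * ((a - h * b - e') / 2)) ^ 2 =
      a ^ 2 + b ^ 2 - (1 + h ^ 2)⁻¹ * ((a - h * b) ^ 2 - e' ^ 2) := by
    intro a b e'
    have : 1 + h ^ 2 ≠ 0 := by positivity
    field_simp
    ring
  have h1 := key a.re b.re e'.re
  have h2 := key a.im b.im e'.im
  simp only [Complex.sq_norm_eq_re_im, Complex.add_re, Complex.add_im, Complex.sub_re,
    Complex.sub_im, Complex.re_ofReal_mul, Complex.im_ofReal_mul, Complex.div_ofNat_re,
    Complex.div_ofNat_im]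
  linarith

/-- The antisymmetric part of `ψ_pub - h ψ_priv`. -/
def antiPart (h : ℝ) (ψ : (V × V) × Lab T L → ℂ) (z : V × V) (c : Fin T × Fin L) (b : Bool) : ℂ :=
  ((ψ (z, (c, (false, b))) - h * ψ (z, (c, (true, b)))) -
    (if b then ψ (z.swap, (c, (false, b))) - h * ψ (z.swap, (c, (true, b)))
      else - (ψ (z, (c, (false, b))) - h * ψ (z, (c, (true, b)))))) / 2

/-- The beam splitter between the public and private antisymmetric vectors. -/
def mixMap (h : ℝ) (act : Fin T × Fin L → Prop) [DecidablePred act] :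
    ((V × V) × Lab T L → ℂ) →ₗ[ℂ] ((V × V) × Lab T L → ℂ) where
  toFun ψ i := ψ i + if act i.2.1 then
    (if i.2.2.1 then ((2 * h / (1 + h ^ 2) : ℝ) : ℂ) else ((-2 / (1 + h ^ 2) : ℝ) : ℂ)) *
      antiPart h ψ i.1 i.2.1 i.2.2.2 else 0
  map_add' ψ φ := by
    funext i
    simp only [antiPart, Pi.add_apply]
    split_ifs <;> ring
  map_smul' a ψ := by
    funext i
    simp only [antiPart, Pi.smul_apply, smul_eq_mul, RingHom.id_apply]
    split_ifs <;> ring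

lemma sqNorm_mixMap (h : ℝ) (act : Fin T × Fin L → Prop) [DecidablePred act]
    (ψ : (V × V) × Lab T L → ℂ) : sqNorm (mixMap h act ψ) = sqNorm ψ := by
  rw [sqNorm_eq_sum_fibers, sqNorm_eq_sum_fibers]
  refine Finset.sum_congr rfl fun c _ => ?_
  by_cases hc : act c
  · simp only [mixMap, LinearMap.coe_mk, AddHom.coe_mk, antiPart, if_pos hc, if_true,
      Bool.false_eq_true, if_false, sq_norm_mix, norm_neg, sub_self, mul_zero, sub_zero]
    set e : V × V → ℝ := fun z => ‖ψ (z, (c, (false, true))) - h * ψ (z, (c, (true, true)))‖ ^ 2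
    have hswap : ∑ z : V × V, e z.swap = ∑ z, e z := (Equiv.prodComm V V).sum_comp e
    change ∑ z : V × V, (_ + (_ - (1 + h ^ 2)⁻¹ * (e z - e z.swap))) = _
    simp only [Finset.sum_add_distrib, Finset.sum_sub_distrib, ← Finset.mul_sum, hswap, sub_self,
      mul_zero, sub_zero]
  · simp [mixMap, hc]

/-- The reflection along the direction (-t, 1), where a is the amplitude of the additional edge and
b that of the star state. -/
lemma sq_norm_refl (t : ℝ) (a b : ℂ) :
    ‖a + ((2 * t / (1 + t ^ 2) : ℝ) : ℂ) * (b - t * a)‖ ^ 2 +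
      ‖b - ((2 / (1 + t ^ 2) : ℝ) : ℂ) * (b - t * a)‖ ^ 2 = ‖a‖ ^ 2 + ‖b‖ ^ 2 := by
  have key : ∀ a b : ℝ, (a + (2 * t / (1 + t ^ 2)) * (b - t * a)) ^ 2 +
      (b - (2 / (1 + t ^ 2)) * (b - t * a)) ^ 2 = a ^ 2 + b ^ 2 := by
    intro a b
    have : 1 + t ^ 2 ≠ 0 := by positivity
    field_simp
    ring
  have h1 := key a.re b.re
  have h2 := key a.im b.im
  simp only [Complex.sq_norm_eq_re_im, Complex.add_re, Complex.add_im, Complex.sub_re,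
    Complex.sub_im, Complex.re_ofReal_mul, Complex.im_ofReal_mul]
  linarith

/-- The reflection at the star of the source in the graph with the additional edge. -/
def reflMap (s : V) (t : ℝ) (act : Fin T × Fin L → Prop) [DecidablePred act] :
    ((V × V) × Lab T L → ℂ) →ₗ[ℂ] ((V × V) × Lab T L → ℂ) where
  toFun ψ i := ψ i + if act i.2.1 ∧ i.2.2.1 = true ∧ i.1 = (s, s) then
    (if i.2.2.2 then - ((2 / (1 + t ^ 2) : ℝ) : ℂ) else ((2 * t / (1 + t ^ 2) : ℝ) : ℂ)) *
      (ψ (i.1, (i.2.1, (true, true))) - t * ψ (i.1, (i.2.1, (true, false)))) else 0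
  map_add' ψ φ := by
    funext i
    simp only [Pi.add_apply]
    split_ifs <;> ring
  map_smul' a ψ := by
    funext i
    simp only [Pi.smul_apply, smul_eq_mul, RingHom.id_apply]
    split_ifs <;> ring

lemma sqNorm_reflMap (s : V) (t : ℝ) (act : Fin T × Fin L → Prop) [DecidablePred act]
    (ψ : (V × V) × Lab T L → ℂ) : sqNorm (reflMap s t act ψ) = sqNorm ψ := by
  rw [sqNorm_eq_sum_fibers, sqNorm_eq_sum_fibers]
  refine Finset.sum_congr rfl fun c _ => Finset.sum_congr rfl fun z _ => ?_
  by_cases hc : act c ∧ z = (s, s)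
  · have := sq_norm_refl t (ψ (z, (c, (true, false)))) (ψ (z, (c, (true, true))))
    simp only [reflMap, LinearMap.coe_mk, AddHom.coe_mk, hc.1, hc.2, if_true, and_self,
      Bool.false_eq_true, false_and, and_false, if_false, add_zero, neg_mul,
      ← sub_eq_add_neg] at this ⊢
    linarith
  · have h2 : ∀ b b' : Bool, reflMap s t act ψ (z, (c, (b, b'))) = ψ (z, (c, (b, b'))) := fun b b' =>
      (congrArg _ (if_neg fun h => hc ⟨h.1, h.2.2⟩)).trans (add_zero _)
    simp only [h2]

/-- The reflection at the additional edge, on the public vectors. -/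
def signMap (s : V) (act : Fin T × Fin L → Prop) [DecidablePred act] :
    ((V × V) × Lab T L → ℂ) →ₗ[ℂ] ((V × V) × Lab T L → ℂ) where
  toFun ψ i := if act i.2.1 ∧ i.2.2.1 = false ∧ ¬ (i.1 = (s, s) ∧ i.2.2.2 = false) then - ψ i else ψ i
  map_add' ψ φ := by
    funext i
    simp only [Pi.add_apply]
    split_ifs <;> ring
  map_smul' a ψ := by
    funext i
    simp only [Pi.smul_apply, smul_eq_mul, RingHom.id_apply]
    split_ifs <;> ring

lemma sqNorm_signMap (s : V) (act : Fin T × Fin L → Prop) [DecidablePred act]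
    (ψ : (V × V) × Lab T L → ℂ) : sqNorm (signMap s act ψ) = sqNorm ψ := by
  unfold sqNorm
  refine Finset.sum_congr rfl fun i _ => ?_
  simp only [signMap, LinearMap.coe_mk, AddHom.coe_mk]
  split_ifs <;> simp

/-- Move the public vectors by one position. -/
def shiftEquiv (T L : ℕ) : Lab T L ≃ Lab T L where
  toFun j := ((j.1.1, if j.2.1 then j.1.2 else (finRotate L).symm j.1.2), j.2)
  invFun j := ((j.1.1, if j.2.1 then j.1.2 else finRotate L j.1.2), j.2)
  left_inv := by
    rintro ⟨⟨u, p⟩, ⟨b, b'⟩⟩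
    cases b
    · exact congrArg (fun q => ((u, q), (false, b'))) ((finRotate L).apply_symm_apply p)
    · rfl
  right_inv := by
    rintro ⟨⟨u, p⟩, ⟨b, b'⟩⟩
    cases b
    · exact congrArg (fun q => ((u, q), (false, b'))) ((finRotate L).symm_apply_apply p)
    · rfl

/-- Move the public vectors by one position. -/
def shiftMap (V : Type u) (T L : ℕ) :
    ((V × V) × Lab T L → ℂ) →ₗ[ℂ] ((V × V) × Lab T L → ℂ) where
  toFun ψ i := ψ (i.1, shiftEquiv T L i.2)
  map_add' _ _ := rfl
  map_smul' _ _ := rfl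

lemma sqNorm_shiftMap (ψ : (V × V) × Lab T L → ℂ) : sqNorm (shiftMap V T L ψ) = sqNorm ψ :=
  ((Equiv.refl (V × V)).prodCongr (shiftEquiv T L)).sum_comp fun i => ‖ψ i‖ ^ 2

/-- Apply a matrix to the clock. -/
def clockMap (V : Type u) (T L : ℕ) (F : Matrix (Fin T) (Fin T) ℂ) :
    ((V × V) × Lab T L → ℂ) →ₗ[ℂ] ((V × V) × Lab T L → ℂ) where
  toFun ψ i := (F *ᵥ fun u => ψ (i.1, ((u, i.2.1.2), i.2.2))) i.2.1.1
  map_add' ψ φ := by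
    funext i
    exact congrFun (F.mulVec_add (fun u => ψ (i.1, ((u, i.2.1.2), i.2.2))) _) i.2.1.1
  map_smul' a ψ := by
    funext i
    exact congrFun (F.mulVec_smul a (fun u => ψ (i.1, ((u, i.2.1.2), i.2.2)))) i.2.1.1

lemma sqNorm_clockMap {F : Matrix (Fin T) (Fin T) ℂ} (hF : F ∈ Matrix.unitaryGroup (Fin T) ℂ)
    (ψ : (V × V) × Lab T L → ℂ) : sqNorm (clockMap V T L F ψ) = sqNorm ψ := by
  have h : ∀ φ : (V × V) × Lab T L → ℂ, sqNorm φ =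
      ∑ z : V × V, ∑ b : Bool × Bool, ∑ p, sqNorm fun u => φ (z, ((u, p), b)) := by
    intro φ
    unfold sqNorm
    rw [Fintype.sum_prod_type]
    refine Finset.sum_congr rfl fun z _ => ?_
    rw [Fintype.sum_prod_type_right]
    refine Finset.sum_congr rfl fun b _ => ?_
    rw [Fintype.sum_prod_type_right]
  rw [h, h]
  refine Finset.sum_congr rfl fun z _ => Finset.sum_congr rfl fun b _ =>
    Finset.sum_congr rfl fun p _ => ?_
  exact sqNorm_unitary_mulVec hF fun u => ψ (z, ((u, p), b))

end Pipeline


/-! ### One step of the pipeline: a catalyzed rotation at each active position -/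

namespace Pipeline

open WalkAlgorithm

variable {V : Type u} [Fintype V] [DecidableEq V] {T L : ℕ}

/-- The vector with component `α` on the additional edge, and `β f + γ c` on the register. -/
def vec (s : V) (f c : V × V → ℝ) (α β γ : ℝ) (z : V × V) (b : Bool) : ℂ :=
  if b then ((β * f z + γ * c z : ℝ) : ℂ) else if z = (s, s) then (α : ℂ) else 0

/-- The coordinates of the `j`-th iterate of the rotation. -/
def coefs (y : ℝ) : ℕ → ℝ × ℝ
  | 0 => (1 / (1 + y), 1 / (1 + y))
  | j + 1 => (((1 - y) * (coefs y j).1 - 2 * y * (coefs y j).2) / (1 + y),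
      ((1 - y) * (coefs y j).2 + 2 * (coefs y j).1) / (1 + y))

/-- The public vector after `j` rotations. -/
def pubVec (s : V) (f c : V × V → ℝ) (t y : ℝ) (j : ℕ) : V × V → Bool → ℂ :=
  vec s f c ((coefs y j).1 + (coefs y j).2 * y) (((coefs y j).1 - (coefs y j).2) * t) 0

/-- The private vector that catalyzes the `j`-th rotation. -/
def privVec (s : V) (f c : V × V → ℝ) (t y h : ℝ) (j : ℕ) : V × V → Bool → ℂ :=
  vec s f c ((coefs y j).1 / h - (coefs y j).2 * h * y)
    (((coefs y j).1 / h + (coefs y j).2 * h) * t) ((coefs y j).2 * h * t)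

/-- The rotations that are performed in step `n`. -/
def Active (K n : ℕ) (c : Fin T × Fin L) : Prop :=
  K ≤ (c.2 : ℕ) ∧ (c.2 : ℕ) < K + c.1 ∧ n ≤ (c.2 : ℕ) ∧ (c.2 : ℕ) ≤ n + K

instance (K n : ℕ) : DecidablePred (Active (T := T) (L := L) K n) := fun c => by
  unfold Active; infer_instance

/-- The state of the pipeline of `K + 1` packets after `n` steps. -/
def ideal (s : V) (f c : V × V → ℝ) (t y h : ℝ) (K : ℕ) (ω : Fin T → ℝ) (n : ℕ)
    (i : (V × V) × Lab T L) : ℂ :=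
  (ω i.2.1.1 : ℂ) * if i.2.2.1 then
    (if K ≤ (i.2.1.2 : ℕ) ∧ (i.2.1.2 : ℕ) < K + i.2.1.1 then
      privVec s f c t y h (i.2.1.2 - K) i.1 i.2.2.2 else 0)
  else (if n ≤ (i.2.1.2 : ℕ) ∧ (i.2.1.2 : ℕ) ≤ n + K then
      pubVec s f c t y (min i.2.1.1 (i.2.1.2 - K)) i.1 i.2.2.2 else 0)

/-- The labels of the private registers that are acted on in step `n`. -/
def controlSet (T L K n : ℕ) : Finset (Lab T L) :=
  Finset.univ.filter fun j => Active K n j.1 ∧ j.2 = (true, true)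

/-- The instructions for step `n`. -/
def stepOps (s : V) (t h : ℝ) (T L K n : ℕ) : List (Op V (Lab T L)) :=
  [Op.ofIsometry (mixMap h (Active K n)) (sqNorm_mixMap h _),
    Op.walk (controlSet T L K n),
    Op.prepInv (controlSet T L K n),
    Op.ofIsometry (reflMap s t (Active K n)) (sqNorm_reflMap s t _),
    Op.prep (controlSet T L K n),
    Op.ofIsometry (signMap s (Active K n)) (sqNorm_signMap s _),
    Op.ofIsometry (shiftMap V T L) sqNorm_shiftMap]

lemma conjTranspose_mulVec_apply {P : Matrix (V × V) (V × V) ℂ} {ψ : V × V → ℂ} {s : V}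
    (hψ : P *ᵥ Pi.single (s, s) 1 = ψ) (g : V × V → ℂ) : (Pᴴ *ᵥ g) (s, s) = star ψ ⬝ᵥ g := by
  rw [← hψ, Matrix.mulVec_single_one]
  rfl

/-- Conjugated by the preparation of the star state, the reflection acts at the star state. -/
lemma star_reflection {U P : Matrix (V × V) (V × V) ℂ} {ψ : V × V → ℂ} {s : V}
    (hP : P ∈ Matrix.unitaryGroup (V × V) ℂ) (hψ : P *ᵥ Pi.single (s, s) 1 = ψ) (t : ℝ) (K n : ℕ)
    (φ : (V × V) × Lab T L → ℂ) (i : (V × V) × Lab T L) :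
    Op.actList U P [Op.prepInv (controlSet T L K n),
      Op.ofIsometry (reflMap s t (Active K n)) (sqNorm_reflMap s t _),
      Op.prep (controlSet T L K n)] φ i = φ i + if Active K n i.2.1 ∧ i.2.2.1 = true then
        (star ψ ⬝ᵥ (fun z => φ (z, (i.2.1, (true, true)))) - t * φ ((s, s), (i.2.1, (true, false)))) *
        (if i.2.2.2 then - ((2 / (1 + t ^ 2) : ℝ) : ℂ) * ψ i.1 else
          if i.1 = (s, s) then ((2 * t / (1 + t ^ 2) : ℝ) : ℂ) else 0) else 0 := by
  obtain ⟨z, c, b, b'⟩ := i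
  simp only [Op.actList, List.foldl_cons, List.foldl_nil, Op.act_ofIsometry]
  by_cases hc : Active K n c
  · cases b
    · simp [Op.act, Op.control, controlSet, reflMap]
    · cases b'
      · by_cases hz : z = (s, s)
        · subst hz
          simp [Op.act, Op.control, controlSet, reflMap, hc, conjTranspose_mulVec_apply hψ]
          ring
        · simp [Op.act, Op.control, controlSet, reflMap, hz]
      · set g : V × V → ℂ := fun z => φ (z, (c, (true, true))) with hg
        have h1 : (fun e => (reflMap s t (Active K n) (Op.control (controlSet T L K n) Pᴴ φ))
            (e, (c, (true, true)))) = Pᴴ *ᵥ g +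
            (-((2 / (1 + t ^ 2) : ℝ) : ℂ) * (star ψ ⬝ᵥ g - t * φ ((s, s), (c, (true, false))))) •
              (Pi.single (s, s) 1 : V × V → ℂ) := by
          funext e
          by_cases he : e = (s, s)
          · subst he
            simp [Op.control, controlSet, reflMap, hc, conjTranspose_mulVec_apply hψ, hg]
          · simp [Op.control, controlSet, reflMap, hc, he, hg]
        have h2 : P * Pᴴ = 1 := Matrix.mem_unitaryGroup_iff.1 hP
        have h3 : (c, (true, true)) ∈ controlSet T L K n := by simp [controlSet, hc]
        simp only [Op.act]
        rw [Op.control, if_pos h3]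
        simp only
        rw [h1, Matrix.mulVec_add, Matrix.mulVec_smul, hψ, Matrix.mulVec_mulVec, h2,
          Matrix.one_mulVec]
        simp [hc, hg]
        ring
  · simp [Op.act, Op.control, controlSet, reflMap, hc]

end Pipeline


namespace Pipeline

open WalkAlgorithm WeightedGraph

variable {V : Type u} [Fintype V] [DecidableEq V] {T L : ℕ}

/-- With A, B the coordinates `coefs`, the public vector is A(e + tf) + B(ye - tf). The private
vector is chosen so that the antisymmetric part of public - h·private is (1 + h²)B(ye - tf), free of
A. So mixing flips the sign of B in the public vector and changes the private one by 2hB(ye - tf).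
-/
lemma mixMap_ideal (s : V) {f c : V × V → ℝ} (hf : ∀ e, f e.swap = - f e)
    (hc : ∀ e, c e.swap = c e) (t y : ℝ) {h : ℝ} (hh : h ≠ 0) (K n : ℕ) (ω : Fin T → ℝ)
    (z : V × V) (d : Fin T × Fin L) (b b' : Bool) :
    mixMap h (Active K n) (ideal s f c t y h K ω n) (z, (d, (b, b'))) =
      if Active K n d then
        (ω d.1 : ℂ) * (if b then
          vec s f c ((coefs y (d.2 - K)).1 / h + (coefs y (d.2 - K)).2 * h * y)
            (((coefs y (d.2 - K)).1 / h - (coefs y (d.2 - K)).2 * h) * t)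
            ((coefs y (d.2 - K)).2 * h * t) z b'
        else vec s f c ((coefs y (d.2 - K)).1 - (coefs y (d.2 - K)).2 * y)
            (((coefs y (d.2 - K)).1 + (coefs y (d.2 - K)).2) * t) 0 z b')
      else ideal s f c t y h K ω n (z, (d, (b, b'))) := by
  by_cases hA : Active K n d
  · have hA' := hA
    obtain ⟨h1, h2, h3, h4⟩ := hA
    have hmin : min (d.1 : ℕ) (d.2 - K) = d.2 - K := min_eq_right (by omega)
    have hh2 : (1 : ℂ) + (h : ℂ) ^ 2 ≠ 0 := by
      have : (1 + h ^ 2 : ℝ) ≠ 0 := by positivity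
      exact_mod_cast this
    have hh1 : (h : ℂ) ≠ 0 := by exact_mod_cast hh
    generalize hA0 : (coefs y (d.2 - K)).1 = A
    generalize hB0 : (coefs y (d.2 - K)).2 = B
    cases b <;> cases b' <;>
    simp only [mixMap, LinearMap.coe_mk, AddHom.coe_mk, if_pos hA', antiPart, ideal, h1, h2, h3, h4,
      and_self, if_true, Bool.false_eq_true, if_false, hmin, pubVec, privVec, vec, hA0, hB0, hf, hc]
    · by_cases hz : z = (s, s)
      · simp only [hz, if_true]; push_cast; field_simp; ring
      · simp only [hz, if_false]; ring
    · push_cast; field_simp; ring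
    · by_cases hz : z = (s, s)
      · simp only [hz, if_true]; push_cast; field_simp; ring
      · simp only [hz, if_false]; ring
    · push_cast; field_simp; ring
  · simp [mixMap, hA]

lemma mulVec_vec {U : Matrix (V × V) (V × V) ℂ} {ψ : V × V → ℂ} {x E : ℝ} {f c : V × V → ℝ}
    (H : FlowVectors U ψ x E f c) (s : V) (a α β γ : ℝ) :
    (U *ᵥ fun z => (a : ℂ) * vec s f c α β γ z true) = fun z =>
      (a : ℂ) * (β * f z + γ * (c z + 2 * f z - 4 * x * ψ z)) := by
  have h : (fun z => (a : ℂ) * vec s f c α β γ z true) =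
      ((a * β : ℝ) : ℂ) • (fun z => (f z : ℂ)) + ((a * γ : ℝ) : ℂ) • fun z => (c z : ℂ) := by
    funext z
    simp [vec]; ring
  rw [h, Matrix.mulVec_add, Matrix.mulVec_smul, Matrix.mulVec_smul, H.map_f, H.map_c]
  funext z
  simp; ring

lemma dot_image {U : Matrix (V × V) (V × V) ℂ} {ψ : V × V → ℂ} {x E : ℝ} {f c : V × V → ℝ}
    (H : FlowVectors U ψ x E f c) (hψ : star ψ ⬝ᵥ ψ = 1) (a β γ : ℝ) :
    star ψ ⬝ᵥ (fun z => (a : ℂ) * (β * f z + γ * (c z + 2 * f z - 4 * x * ψ z))) =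
      a * (β + γ * (1 - 2 * x)) := by
  have h : (fun z => (a : ℂ) * (β * f z + γ * (c z + 2 * f z - 4 * x * ψ z))) =
      ((a * (β + 2 * γ) : ℝ) : ℂ) • (fun z => (f z : ℂ)) + ((a * γ : ℝ) : ℂ) • (fun z => (c z : ℂ)) +
        ((-(4 * a * γ * x) : ℝ) : ℂ) • ψ := by
    funext z
    simp; ring
  rw [h, dotProduct_add, dotProduct_add, dotProduct_smul, dotProduct_smul, dotProduct_smul,
    H.dot_f, H.dot_c, hψ]
  simp; ring

/-- One step of the pipeline maps the ideal state to the next ideal state. -/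
lemma actList_stepOps {U P : Matrix (V × V) (V × V) ℂ} {ψ : V × V → ℂ} {s : V} {x E : ℝ}
    {f c : V × V → ℝ} (H : FlowVectors U ψ x E f c) (hP : P ∈ Matrix.unitaryGroup (V × V) ℂ)
    (hψ : P *ᵥ Pi.single (s, s) 1 = ψ) {t y h : ℝ} (hy : y = 2 * x * t ^ 2) (hh : h ≠ 0)
    {K n : ℕ} (hL : n + K + 2 ≤ L) (ω : Fin T → ℝ) :
    Op.actList U P (stepOps s t h T L K n) (ideal s f c t y h K ω n) =
      ideal s f c t y h K ω (n + 1) := by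
  have hψ1 : star ψ ⬝ᵥ ψ = 1 := by
    rw [← conjTranspose_mulVec_apply hψ, ← hψ, Matrix.mulVec_mulVec, ← Matrix.star_eq_conjTranspose,
      Matrix.mem_unitaryGroup_iff'.1 hP, Matrix.one_mulVec, Pi.single_eq_same]
  have hy0 : 1 + y ≠ 0 := by
    have := H.one_le
    have : 0 ≤ y := by rw [hy]; positivity
    positivity
  have hsplit : stepOps s t h T L K n =
      [Op.ofIsometry (mixMap h (Active K n)) (sqNorm_mixMap h _), Op.walk (controlSet T L K n)] ++
      [Op.prepInv (controlSet T L K n),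
        Op.ofIsometry (reflMap s t (Active K n)) (sqNorm_reflMap s t _),
        Op.prep (controlSet T L K n)] ++
      [Op.ofIsometry (signMap s (Active K n)) (sqNorm_signMap s _),
        Op.ofIsometry (shiftMap V T L) sqNorm_shiftMap] := rfl
  rw [hsplit, Op.actList_append, Op.actList_append]
  set φ₁ := mixMap h (Active K n) (ideal s f c t y h K ω n) with hφ₁
  have hmix := mixMap_ideal (T := T) (L := L) s H.antisymm H.symm t y hh K n ω
  set φ₂ := Op.actList U P [Op.ofIsometry (mixMap h (Active K n)) (sqNorm_mixMap h _),
    Op.walk (controlSet T L K n)] (ideal s f c t y h K ω n) with hφ₂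
  have hφ₂' : φ₂ = Op.control (controlSet T L K n) U φ₁ := by
    rw [hφ₂, hφ₁, Op.actList, List.foldl_cons, List.foldl_cons, List.foldl_nil, Op.act_ofIsometry]
    rfl
  have h2 : ∀ (z : V × V) (d : Fin T × Fin L) (b b' : Bool),
      ¬ (Active K n d ∧ b = true ∧ b' = true) → φ₂ (z, (d, (b, b'))) = φ₁ (z, (d, (b, b'))) := by
    intro z d b b' hn
    rw [hφ₂', Op.control, if_neg]
    simp only [controlSet, Finset.mem_filter, Finset.mem_univ, true_and, Prod.mk.injEq]
    exact hn
  -- The term 2f in the image of c restores the coefficient of f in the private vector. What is left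
  -- over is -4xBht on the star state, and 2Bhy on the additional edge from the mixing.
  have h2' : ∀ (z : V × V) (d : Fin T × Fin L), Active K n d → φ₂ (z, (d, (true, true))) =
      (ω d.1 : ℂ) * (((((coefs y (d.2 - K)).1 / h - (coefs y (d.2 - K)).2 * h) * t : ℝ) : ℂ) * f z +
        (((coefs y (d.2 - K)).2 * h * t : ℝ) : ℂ) * (c z + 2 * f z - 4 * x * ψ z)) := by
    intro z d hA
    have h3 : (d, (true, true)) ∈ controlSet T L K n := by simp [controlSet, hA]
    rw [hφ₂', Op.control, if_pos h3]
    simp only [hmix, hφ₁, if_pos hA, if_true]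
    rw [mulVec_vec H]
  set φ₃ := Op.actList U P [Op.prepInv (controlSet T L K n),
        Op.ofIsometry (reflMap s t (Active K n)) (sqNorm_reflMap s t _),
        Op.prep (controlSet T L K n)] φ₂ with hφ₃
  have h3 : ∀ (z : V × V) (d : Fin T × Fin L) (b b' : Bool), φ₃ (z, (d, (b, b'))) =
      if Active K n d ∧ b = false then
        (ω d.1 : ℂ) * vec s f c ((coefs y (d.2 - K)).1 - (coefs y (d.2 - K)).2 * y)
            (((coefs y (d.2 - K)).1 + (coefs y (d.2 - K)).2) * t) 0 z b'
      else ideal s f c t y h K ω n (z, (d, (b, b'))) := by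
    intro z d b b'
    rw [hφ₃, star_reflection hP hψ]
    simp only
    by_cases hA : Active K n d
    · cases b
      · rw [h2 z d false b' (by simp), hφ₁, hmix]
        simp [hA]
      · have hA' := hA
        obtain ⟨ha1, ha2, ha3, ha4⟩ := hA'
        -- With this overlap, the reflection adds 4xBht on the star state and -4xt²Bh = -2Bhy on the
        -- additional edge, so the private vector is exactly restored.
        have hκ : star ψ ⬝ᵥ (fun z => φ₂ (z, (d, (true, true)))) - t * φ₂ ((s, s), (d, (true, false))) =
            - (ω d.1 : ℂ) * (2 * x * (1 + t ^ 2) * (coefs y (d.2 - K)).2 * h * t) := by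
          rw [h2 _ d true false (by simp), hφ₁, hmix, if_pos hA]
          simp only [h2' _ d hA, if_true]
          rw [dot_image H hψ1]
          simp only [vec, Bool.false_eq_true, if_false, if_true, hy]
          push_cast; ring
        rw [hκ]
        have ht2 : (1 : ℂ) + (t : ℂ) ^ 2 ≠ 0 := by
          have : (1 + t ^ 2 : ℝ) ≠ 0 := by positivity
          exact_mod_cast this
        have hh1 : (h : ℂ) ≠ 0 := by exact_mod_cast hh
        generalize hA0 : (coefs y (d.2 - K)).1 = A
        generalize hB0 : (coefs y (d.2 - K)).2 = B
        cases b'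
        · rw [h2 z d true false (by simp), hφ₁, hmix, if_pos hA]
          simp only [hA, and_self, if_true, Bool.false_eq_true, if_false, ideal, ha1, ha2, privVec,
            vec, hA0, hB0, reduceCtorEq, and_false]
          have hyc : (y : ℂ) = 2 * x * t ^ 2 := by rw [hy]; push_cast; ring
          by_cases hz : z = (s, s)
          · simp only [hz, if_true]; push_cast; rw [hyc]; field_simp; ring
          · simp only [hz, if_false]; ring
        · rw [h2' z d hA]
          simp only [hA, and_self, if_true, ideal, ha1, ha2, privVec,
            vec, hA0, hB0, reduceCtorEq, and_false, if_false]
          push_cast; field_simp; ring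
    · rw [h2 z d b b' (by simp [hA]), hφ₁, hmix]
      simp [hA]
  funext i
  obtain ⟨z, ⟨u, p⟩, b, b'⟩ := i
  simp only [Op.actList, List.foldl_cons, List.foldl_nil, Op.act_ofIsometry]
  change signMap s (Active K n) φ₃ (z, shiftEquiv T L ((u, p), (b, b'))) = _
  cases b
  · change signMap s (Active K n) φ₃ (z, ((u, (finRotate L).symm p), (false, b'))) = _
    obtain ⟨q, rfl⟩ := (finRotate L).surjective p
    rw [Equiv.symm_apply_apply]
    by_cases hq : (q : ℕ) + 1 < L
    · have hval : ((finRotate L q : Fin L) : ℕ) = q + 1 := by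
        obtain ⟨l, rfl⟩ : ∃ l, L = l + 1 := ⟨L - 1, by omega⟩
        exact coe_finRotate_of_ne_last fun hl => by
          have := congrArg Fin.val hl
          simp at this; omega
      simp only [signMap, LinearMap.coe_mk, AddHom.coe_mk, true_and, h3, and_true, ideal, hval,
        Bool.false_eq_true, if_false]
      by_cases hA : Active K n (u, q)
      · obtain ⟨ha1, ha2, ha3, ha4⟩ := hA
        simp only at ha1 ha2 ha3 ha4
        -- The catalyst of rotation j sits at position K + j, so a packet that moves from q to q + 1
        -- has made one more rotation.
        have hm : min (u : ℕ) (q + 1 - K) = (q - K) + 1 := by omega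
        have hw : n + 1 ≤ (q : ℕ) + 1 ∧ (q : ℕ) + 1 ≤ n + 1 + K := by omega
        have hA : Active K n (u, q) := ⟨ha1, ha2, ha3, ha4⟩
        have hy1 : (1 : ℂ) + (y : ℂ) ≠ 0 := by exact_mod_cast hy0
        simp only [hA, true_and, if_true, if_pos hw, hm, pubVec, coefs]
        cases b'
        · by_cases hz : z = (s, s)
          · simp only [hz, vec, and_self, not_true_eq_false, if_false, if_true, Bool.false_eq_true]
            push_cast; field_simp; ring
          · simp [vec, hz]
        · simp only [vec, reduceCtorEq, and_false, not_false_eq_true, if_true]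
          push_cast; field_simp; ring
      · simp only [hA, false_and, if_false]
        congr 1
        by_cases hw : n ≤ (q : ℕ) ∧ (q : ℕ) ≤ n + K
        · have hm : min (u : ℕ) (q - K) = min (u : ℕ) (q + 1 - K) := by
            have : ¬ (K ≤ (q : ℕ) ∧ (q : ℕ) < K + u) := fun h' => hA ⟨h'.1, h'.2, hw.1, hw.2⟩
            omega
          rw [if_pos hw, if_pos (by omega), hm]
        · rw [if_neg hw, if_neg (by omega)]
    -- The cyclic shift never wraps a packet around: the occupied window ends at n + K, before the
    -- last position.
    · have hval : ((finRotate L q : Fin L) : ℕ) = 0 := by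
        obtain ⟨l, rfl⟩ : ∃ l, L = l + 1 := ⟨L - 1, by omega⟩
        have : q = Fin.last l := Fin.ext (by simp; omega)
        rw [this, finRotate_last]; rfl
      have hA : ¬ Active K n (u, q) := fun hA => by
        have := hA.2.2.2
        simp only at this; omega
      simp only [signMap, LinearMap.coe_mk, AddHom.coe_mk, h3, ideal, hval, hA, false_and, if_false,
        Bool.false_eq_true]
      rw [if_neg (by omega), if_neg (by omega)]
  · change signMap s (Active K n) φ₃ (z, ((u, p), (true, b'))) = _
    simp only [signMap, LinearMap.coe_mk, AddHom.coe_mk, h3, reduceCtorEq, and_false, false_and,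
      if_false, ideal, if_true]

end Pipeline


/-! ### Running many packets without the catalyst -/

lemma sq_norm_le_add {η : ℝ} (hη : 0 < η) (a b : ℂ) :
    ‖a‖ ^ 2 ≤ (1 + η) * ‖b‖ ^ 2 + (1 + 1 / η) * ‖a - b‖ ^ 2 := by
  have h : ‖a‖ ≤ ‖b‖ + ‖a - b‖ := by simpa using norm_add_le b (a - b)
  have h1 : 2 * (‖b‖ * ‖a - b‖) ≤ η * ‖b‖ ^ 2 + 1 / η * ‖a - b‖ ^ 2 := by
    have h2 : 0 ≤ (η * ‖b‖ - ‖a - b‖) ^ 2 / η := by positivity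
    have h3 : (η * ‖b‖ - ‖a - b‖) ^ 2 / η =
        η * ‖b‖ ^ 2 + 1 / η * ‖a - b‖ ^ 2 - 2 * (‖b‖ * ‖a - b‖) := by
      field_simp; ring
    linarith
  nlinarith [norm_nonneg a, norm_nonneg b, norm_nonneg (a - b)]

namespace Pipeline

open WalkAlgorithm WeightedGraph

variable {V : Type u} [Fintype V] [DecidableEq V] {T L : ℕ}

/-- The probability of finding the clock at `m`. -/
def clockProb (φ : (V × V) × Lab T L → ℂ) (m : Fin T) : ℝ :=
  ∑ j : (V × V) × (Fin L × (Bool × Bool)), ‖φ (j.1, ((m, j.2.1), j.2.2))‖ ^ 2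

lemma clockProb_nonneg (φ : (V × V) × Lab T L → ℂ) (m : Fin T) : 0 ≤ clockProb φ m :=
  Finset.sum_nonneg fun _ _ => sq_nonneg _

lemma sum_mul_clock (φ : (V × V) × Lab T L → ℂ) (g : Fin T → ℝ) :
    ∑ i, ‖φ i‖ ^ 2 * g i.2.1.1 = ∑ m, clockProb φ m * g m := by
  simp only [clockProb, Finset.sum_mul, Fintype.sum_prod_type]
  rw [Finset.sum_comm' (t' := Finset.univ) (s' := fun _ => Finset.univ) (by simp)]
  rw [Finset.sum_comm]
  refine (Finset.sum_congr rfl fun z₂ _ => ?_).trans Finset.sum_comm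
  refine (Finset.sum_congr rfl fun z₁ _ => ?_).trans Finset.sum_comm
  rfl

lemma sum_clockProb (φ : (V × V) × Lab T L → ℂ) : ∑ m, clockProb φ m = sqNorm φ := by
  have := sum_mul_clock φ fun _ => 1
  simpa [sqNorm] using this.symm

lemma sum_clockProb_le {η : ℝ} (hη : 0 < η) (φ φ' : (V × V) × Lab T L → ℂ) (S : Finset (Fin T)) :
    ∑ m ∈ S, clockProb φ m ≤ (1 + η) * ∑ m ∈ S, clockProb φ' m + (1 + 1 / η) * sqNorm (φ - φ') := by
  have h1 : ∑ m ∈ S, clockProb (φ - φ') m ≤ sqNorm (φ - φ') := by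
    rw [← sum_clockProb]
    exact Finset.sum_le_sum_of_subset_of_nonneg (Finset.subset_univ S)
      fun m _ _ => clockProb_nonneg _ m
  have h2 : ∑ m ∈ S, clockProb φ m ≤
      (1 + η) * ∑ m ∈ S, clockProb φ' m + (1 + 1 / η) * ∑ m ∈ S, clockProb (φ - φ') m := by
    simp only [clockProb, Finset.mul_sum, ← Finset.sum_add_distrib]
    exact Finset.sum_le_sum fun m _ => Finset.sum_le_sum fun j _ => sq_norm_le_add hη _ _
  have : 0 ≤ 1 + 1 / η := by positivity
  nlinarith

/-- `K + 1` packets, before the first step. -/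
def startVec (s : V) (K : ℕ) (ω : Fin T → ℝ) (i : (V × V) × Lab T L) : ℂ :=
  if i.2.2.1 then 0 else (ω i.2.1.1 : ℂ) * if (i.2.1.2 : ℕ) ≤ K then
    (if i.1 = (s, s) ∧ i.2.2.2 = false then 1 else 0) else 0

/-- The private vectors. -/
def catalyst (s : V) (f c : V × V → ℝ) (t y h : ℝ) (K : ℕ) (ω : Fin T → ℝ)
    (i : (V × V) × Lab T L) : ℂ :=
  if i.2.2.1 then (ω i.2.1.1 : ℂ) *
    if K ≤ (i.2.1.2 : ℕ) ∧ (i.2.1.2 : ℕ) < K + i.2.1.1 then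
      privVec s f c t y h (i.2.1.2 - K) i.1 i.2.2.2 else 0 else 0

/-- `K + 1` packets in their final state, after `N` steps. -/
def finalVec (s : V) (f c : V × V → ℝ) (t y : ℝ) (K N : ℕ) (ω : Fin T → ℝ)
    (i : (V × V) × Lab T L) : ℂ :=
  if i.2.2.1 then 0 else (ω i.2.1.1 : ℂ) *
    if N ≤ (i.2.1.2 : ℕ) ∧ (i.2.1.2 : ℕ) ≤ N + K then pubVec s f c t y i.2.1.1 i.1 i.2.2.2 else 0

/-- Before any rotation the public vector is e, a basis state that can be prepared without knowledge
of the graph. -/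
lemma ideal_zero (s : V) (f c : V × V → ℝ) (t h : ℝ) {y : ℝ} (hy : 1 + y ≠ 0) (K : ℕ)
    (ω : Fin T → ℝ) :
    ideal (L := L) s f c t y h K ω 0 = startVec s K ω + catalyst s f c t y h K ω := by
  have hy' : 1 / (1 + y) + 1 / (1 + y) * y = 1 := by field_simp
  funext ⟨z, ⟨u, p⟩, b, b'⟩
  cases b
  · simp only [ideal, startVec, catalyst, Pi.add_apply, Bool.false_eq_true, if_false, zero_le,
      true_and, zero_add, add_zero]
    congr 1
    by_cases hp : (p : ℕ) ≤ K
    · rw [if_pos hp, if_pos hp, show (p : ℕ) - K = 0 by omega, Nat.min_zero]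
      simp only [pubVec, vec, coefs, hy', sub_self, zero_mul, add_zero, Complex.ofReal_one,
        Complex.ofReal_zero]
      cases b' <;> simp
    · rw [if_neg hp, if_neg hp]
  · simp [ideal, startVec, catalyst]

lemma ideal_eq_finalVec_add (s : V) (f c : V × V → ℝ) (t y h : ℝ) {K D : ℕ} {ω : Fin T → ℝ}
    (hω : ∀ u, ω u ≠ 0 → (u : ℕ) ≤ D) :
    ideal (L := L) s f c t y h K ω (K + D) =
      finalVec s f c t y K (K + D) ω + catalyst s f c t y h K ω := by
  funext ⟨z, ⟨u, p⟩, b, b'⟩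
  cases b
  · simp only [ideal, finalVec, catalyst, Pi.add_apply, Bool.false_eq_true, if_false, add_zero]
    by_cases hu : ω u = 0
    · simp [hu]
    · have := hω u hu
      congr 1
      by_cases hp : K + D ≤ (p : ℕ) ∧ (p : ℕ) ≤ K + D + K
      · rw [if_pos hp, if_pos hp, min_eq_left (by omega)]
      · rw [if_neg hp, if_neg hp]
  · simp [ideal, finalVec, catalyst]

lemma sum_if_window (N K : ℕ) (hL : N + K + 1 ≤ L) (a : ℝ) :
    ∑ p : Fin L, (if N ≤ (p : ℕ) ∧ (p : ℕ) ≤ N + K then a else 0) = (K + 1) * a := by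
  rw [Fin.sum_univ_eq_sum_range (fun p => if N ≤ p ∧ p ≤ N + K then a else 0), ← Finset.sum_filter,
    Finset.sum_const]
  have : (Finset.range L).filter (fun p => N ≤ p ∧ p ≤ N + K) = Finset.Ico N (N + (K + 1)) := by
    ext p; simp; omega
  rw [this]; simp

lemma sqNorm_startVec (s : V) {K : ℕ} (hL : K + 1 ≤ L) (ω : Fin T → ℝ) :
    sqNorm (startVec (L := L) s K ω) = (K + 1) * ∑ u, ω u ^ 2 := by
  rw [← sum_clockProb, Finset.mul_sum]
  refine Finset.sum_congr rfl fun u _ => ?_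
  have h := sum_if_window (L := L) 0 K (by omega) (ω u ^ 2)
  simp only [zero_le, true_and, zero_add] at h
  rw [← h, clockProb, Fintype.sum_prod_type]
  simp only [Fintype.sum_prod_type, Fintype.sum_bool, startVec]
  rw [Finset.sum_eq_single s (by intro z _ hz; simp [hz]) (by simp),
    Finset.sum_eq_single s (by intro z _ hz; simp [hz]) (by simp)]
  refine Finset.sum_congr rfl fun p _ => ?_
  by_cases hp : (p : ℕ) ≤ K <;> simp [hp]

/-- Only the rotations that are really made enter the bound `W`; the scale test needs just the first
one, whose catalyst is smaller. -/
lemma sqNorm_catalyst_le (s : V) (f c : V × V → ℝ) (t y h : ℝ) {K D : ℕ} (hL : K + D ≤ L)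
    (ω : Fin T → ℝ) {W : ℝ} (hW : 0 ≤ W) (hω : ∀ u, ω u ≠ 0 → (u : ℕ) ≤ D ∧ ∀ j < (u : ℕ),
      sqNorm (fun i : (V × V) × Bool => privVec s f c t y h j i.1 i.2) ≤ W) :
    sqNorm (catalyst (L := L) s f c t y h K ω) ≤ D * W * ∑ u, ω u ^ 2 := by
  rw [← sum_clockProb, Finset.mul_sum]
  refine Finset.sum_le_sum fun u _ => ?_
  by_cases hu : ω u = 0
  · have : clockProb (catalyst (L := L) s f c t y h K ω) u = 0 := by simp [clockProb, catalyst, hu]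
    rw [this, hu]; simp
  obtain ⟨huD, huW⟩ := hω u hu
  -- Clock value 0 is separate because the window below ends at `u - 1`, a truncated subtraction.
  rcases Nat.eq_zero_or_pos (u : ℕ) with hu0 | hu0
  · have hn : ∀ p : ℕ, ¬ (K ≤ p ∧ p < K) := by omega
    have : clockProb (catalyst (L := L) s f c t y h K ω) u = 0 := by
      simp [clockProb, catalyst, hu0, hn]
    rw [this]
    positivity
  have key : ∀ p : Fin L, (∑ z : V × V, ∑ b : Bool × Bool,
      ‖catalyst s f c t y h K ω (z, ((u, p), b))‖ ^ 2) ≤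
      if K ≤ (p : ℕ) ∧ (p : ℕ) ≤ K + (u - 1) then W * ω u ^ 2 else 0 := by
    intro p
    by_cases hp : K ≤ (p : ℕ) ∧ (p : ℕ) < K + u
    · rw [if_pos (by omega)]
      have h1 := huW (p - K) (by omega)
      have h2 : ∀ z : V × V, ∑ b : Bool × Bool, ‖catalyst s f c t y h K ω (z, ((u, p), b))‖ ^ 2 =
          ω u ^ 2 * ∑ b, ‖privVec s f c t y h (p - K) z b‖ ^ 2 := by
        intro z
        rw [Fintype.sum_prod_type, Fintype.sum_bool]
        simp [catalyst, hp, mul_pow]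
        ring
      rw [Finset.sum_congr rfl fun z _ => h2 z, ← Finset.mul_sum, ← Fintype.sum_prod_type', mul_comm]
      exact mul_le_mul_of_nonneg_right h1 (sq_nonneg _)
    · rw [if_neg (by omega)]
      simp [catalyst, hp]
  have h3 : clockProb (catalyst (L := L) s f c t y h K ω) u = ∑ p : Fin L, ∑ z : V × V,
      ∑ b : Bool × Bool, ‖catalyst s f c t y h K ω (z, ((u, p), b))‖ ^ 2 := by
    simp only [clockProb]
    rw [Fintype.sum_prod_type, Finset.sum_comm' (t' := Finset.univ) (s' := fun _ => Finset.univ)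
      (by simp), Fintype.sum_prod_type]
    refine Finset.sum_congr rfl fun p _ => ?_
    rw [Finset.sum_comm]
  rw [h3]
  refine (Finset.sum_le_sum fun p _ => key p).trans ?_
  rw [sum_if_window K (u - 1) (by omega)]
  have h4 : (((u : ℕ) - 1 : ℕ) : ℝ) + 1 ≤ D := by
    rw [Nat.cast_sub hu0]; push_cast
    have : ((u : ℕ) : ℝ) ≤ D := by exact_mod_cast huD
    linarith
  rw [mul_assoc]
  exact mul_le_mul_of_nonneg_right h4 (by positivity)

lemma clockProb_finalVec (s : V) (f c : V × V → ℝ) (t y : ℝ) {K N : ℕ} (hL : N + K + 1 ≤ L)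
    (ω : Fin T → ℝ) (F : Matrix (Fin T) (Fin T) ℂ) (m : Fin T) :
    clockProb (clockMap V T L F (finalVec s f c t y K N ω)) m =
      (K + 1) * sqNorm (fun i : (V × V) × Bool =>
        (F *ᵥ fun u => (ω u : ℂ) * pubVec s f c t y u i.1 i.2) m) := by
  have h3 : clockProb (clockMap V T L F (finalVec s f c t y K N ω)) m =
      ∑ p : Fin L, ∑ z : V × V, ∑ b : Bool × Bool,
        ‖clockMap V T L F (finalVec s f c t y K N ω) (z, ((m, p), b))‖ ^ 2 := by
    simp only [clockProb]
    rw [Fintype.sum_prod_type, Finset.sum_comm' (t' := Finset.univ) (s' := fun _ => Finset.univ)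
      (by simp), Fintype.sum_prod_type]
    refine Finset.sum_congr rfl fun p _ => ?_
    rw [Finset.sum_comm]
  rw [h3, ← sum_if_window N K hL]
  refine Finset.sum_congr rfl fun p _ => ?_
  simp only [clockMap, LinearMap.coe_mk, AddHom.coe_mk, finalVec]
  by_cases hp : N ≤ (p : ℕ) ∧ (p : ℕ) ≤ N + K
  · simp only [if_pos hp, sqNorm]
    refine Eq.symm ((Fintype.sum_prod_type _).trans (Finset.sum_congr rfl fun z _ => ?_))
    refine Eq.symm ((Fintype.sum_prod_type _).trans ?_)
    rw [Fintype.sum_bool]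
    simp [show (fun _ : Fin T => (0 : ℂ)) = 0 from rfl]
  · simp [hp, show (fun _ : Fin T => (0 : ℂ)) = 0 from rfl]

/-- The program of the pipeline. -/
def program (s : V) (t h : ℝ) (T L K N : ℕ) (Q : Matrix.unitaryGroup ((V × V) × Lab T L) ℂ)
    {F : Matrix (Fin T) (Fin T) ℂ} (hF : F ∈ Matrix.unitaryGroup (Fin T) ℂ) : List (Op V (Lab T L)) :=
  Op.fixed Q :: ((List.range N).flatMap (stepOps s t h T L K) ++
    [Op.ofIsometry (clockMap V T L F) (sqNorm_clockMap hF)])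

lemma cost_program (s : V) (t h : ℝ) (T L K N : ℕ)
    (Q : Matrix.unitaryGroup ((V × V) × Lab T L) ℂ)
    {F : Matrix (Fin T) (Fin T) ℂ} (hF : F ∈ Matrix.unitaryGroup (Fin T) ℂ) :
    ((program s t h T L K N Q hF).map Op.cost).sum = 3 * N := by
  have : (((List.range N).flatMap (stepOps s t h T L K)).map Op.cost).sum = 3 * N := by
    induction N with
    | zero => simp
    | succ N ih =>
      rw [List.range_succ, List.flatMap_append, List.map_append, List.sum_append, ih]
      simp [stepOps, Op.cost, Op.ofIsometry]
      ring
  simp [program, Op.cost, Op.ofIsometry, this]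

lemma actList_range {U P : Matrix (V × V) (V × V) ℂ} {ψ : V × V → ℂ} {s : V} {x E : ℝ}
    {f c : V × V → ℝ} (H : FlowVectors U ψ x E f c) (hP : P ∈ Matrix.unitaryGroup (V × V) ℂ)
    (hψ : P *ᵥ Pi.single (s, s) 1 = ψ) {t y h : ℝ} (hy : y = 2 * x * t ^ 2) (hh : h ≠ 0)
    {K N : ℕ} (hL : N + K + 1 ≤ L) (ω : Fin T → ℝ) :
    Op.actList U P ((List.range N).flatMap (stepOps s t h T L K)) (ideal s f c t y h K ω 0) =
      ideal s f c t y h K ω N := by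
  induction N with
  | zero => rfl
  | succ N ih =>
    rw [List.range_succ, List.flatMap_append, Op.actList_append, ih (by omega)]
    simp only [List.flatMap_cons, List.flatMap_nil, List.append_nil]
    exact actList_stepOps H hP hψ hy hh (by omega) ω

/-- The program is chosen before the graph, the vectors and x. The outcome probabilities of `F` on
the ideal clock state and on the real one are compared in both directions, with a free parameter
`η`, so that bounds can be made nearly multiplicative. -/
lemma exists_program (s : V) {T L K D : ℕ} (i₀ : Lab T L) (t : ℝ) {h : ℝ} (hh : h ≠ 0)
    {a : Fin T → ℝ} (ha : ∑ u, a u ^ 2 = 1) (haD : ∀ u, a u ≠ 0 → (u : ℕ) ≤ D)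
    (hL : 2 * K + D + 2 ≤ L) {F : Matrix (Fin T) (Fin T) ℂ}
    (hF : F ∈ Matrix.unitaryGroup (Fin T) ℂ) :
    ∃ l : List (Op V (Lab T L)), (l.map Op.cost).sum = 3 * (K + D) ∧
      ∀ (U P : Matrix (V × V) (V × V) ℂ) (ψ : V × V → ℂ) (x E : ℝ) (f c : V × V → ℝ),
        FlowVectors U ψ x E f c → (∀ φ, sqNorm (U *ᵥ φ) = sqNorm φ) →
        P ∈ Matrix.unitaryGroup (V × V) ℂ → P *ᵥ Pi.single (s, s) 1 = ψ →
        ∑ m, clockProb (Op.actList U P l (Pi.single ((s, s), i₀) 1)) m = 1 ∧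
        ∀ (W : ℝ), 0 ≤ W → (∀ u, a u ≠ 0 → ∀ j < (u : ℕ),
          sqNorm (fun i : (V × V) × Bool =>
            privVec s f c t (2 * x * t ^ 2) h j i.1 i.2) ≤ W) →
        ∀ (S : Finset (Fin T)) (η : ℝ), 0 < η →
          (∑ m ∈ S, clockProb (Op.actList U P l (Pi.single ((s, s), i₀) 1)) m ≤
            (1 + η) * (∑ m ∈ S, sqNorm (fun i : (V × V) × Bool =>
              (F *ᵥ fun u => (a u : ℂ) * pubVec s f c t (2 * x * t ^ 2) u i.1 i.2) m)) +
            (1 + 1 / η) * (4 * (D * W / (K + 1)))) ∧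
          (∑ m ∈ S, sqNorm (fun i : (V × V) × Bool =>
              (F *ᵥ fun u => (a u : ℂ) * pubVec s f c t (2 * x * t ^ 2) u i.1 i.2) m) ≤
            (1 + η) * (∑ m ∈ S, clockProb (Op.actList U P l (Pi.single ((s, s), i₀) 1)) m) +
            (1 + 1 / η) * (4 * (D * W / (K + 1)))) := by
  set ω : Fin T → ℝ := fun u => a u / √(K + 1) with hω
  have hK : (0 : ℝ) < K + 1 := by positivity
  have hω2 : ∀ u, ω u ^ 2 = a u ^ 2 / (K + 1) := by
    intro u; rw [hω]; simp only [div_pow, Real.sq_sqrt hK.le]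
  have hωs : ∑ u, ω u ^ 2 = 1 / (K + 1) := by
    simp only [hω2, ← Finset.sum_div, ha]
  have hω0 : ∀ u, ω u ≠ 0 → a u ≠ 0 := by
    intro u hu ha0; exact hu (by simp [hω, ha0])
  obtain ⟨Q, hQ, hQ1⟩ := exists_unitary_mulVec_single ((s, s), i₀) (startVec (L := L) s K ω) (by
    rw [sqNorm_startVec s (by omega), hωs, mul_one_div_cancel hK.ne'])
  refine ⟨program s t h T L K (K + D) ⟨Q, hQ⟩ hF, cost_program .., ?_⟩
  intro U P ψ x E f c H hU hP hψ
  refine ⟨by rw [sum_clockProb, Op.sqNorm_actList hU hP, sqNorm_single], ?_⟩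
  intro W hW hpriv S η hη
  set y := 2 * x * t ^ 2 with hy
  have hy0 : 1 + y ≠ 0 := by
    have := H.one_le
    have : 0 ≤ y := by rw [hy]; positivity
    positivity
  set l₀ := (List.range (K + D)).flatMap (stepOps s t h T L K) with hl₀
  have hact : Op.actList U P (program s t h T L K (K + D) ⟨Q, hQ⟩ hF) (Pi.single ((s, s), i₀) 1) =
      clockMap V T L F (Op.actList U P l₀ (startVec s K ω)) := by
    rw [program, ← List.singleton_append, Op.actList_append, Op.actList_append]
    rw [show Op.actList U P [Op.fixed ⟨Q, hQ⟩] (Pi.single ((s, s), i₀) 1) = startVec s K ω from hQ1]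
    exact Op.act_ofIsometry U P _ (sqNorm_clockMap hF) _
  set cat := catalyst (L := L) s f c t y h K ω with hcat
  -- By linearity the error of starting without the catalyst is the catalyst minus its image, and
  -- the run preserves norms.
  have hdiff : Op.actList U P l₀ (startVec s K ω) - finalVec s f c t y K (K + D) ω =
      cat - Op.actList U P l₀ cat := by
    have h1 := actList_range (T := T) (L := L) (N := K + D) H hP hψ hy hh (K := K) (by omega) ω
    rw [ideal_eq_finalVec_add s f c t y h fun u hu => haD u (hω0 u hu), ← hl₀] at h1
    have h2 : startVec (L := L) s K ω = ideal s f c t y h K ω 0 - cat := by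
      rw [ideal_zero s f c t h hy0, add_sub_cancel_right]
    rw [h2, Op.actList_sub, h1]
    abel
  have hcatn : sqNorm cat ≤ D * W / (K + 1) := by
    have := sqNorm_catalyst_le s f c t y h (K := K) (D := D) (L := L) (by omega) ω hW
      fun u hu => ⟨haD u (hω0 u hu), hpriv u (hω0 u hu)⟩
    rwa [hωs, mul_one_div] at this
  have hd : sqNorm (clockMap V T L F (Op.actList U P l₀ (startVec s K ω)) -
      clockMap V T L F (finalVec s f c t y K (K + D) ω)) ≤ 4 * (D * W / (K + 1)) := by
    rw [← map_sub, sqNorm_clockMap hF, hdiff]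
    have h1 := sqNorm_sub_le cat (Op.actList U P l₀ cat)
    rw [Op.sqNorm_actList hU hP] at h1
    linarith
  have hq : ∀ m, clockProb (clockMap V T L F (finalVec s f c t y K (K + D) ω)) m =
      sqNorm (fun i : (V × V) × Bool =>
              (F *ᵥ fun u => (a u : ℂ) * pubVec s f c t y u i.1 i.2) m) := by
    intro m
    rw [clockProb_finalVec s f c t y (by omega)]
    have : (fun i : (V × V) × Bool => (F *ᵥ fun u => (ω u : ℂ) * pubVec s f c t y u i.1 i.2) m) =
        ((1 / √(K + 1) : ℝ) : ℂ) • fun i : (V × V) × Bool =>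
          (F *ᵥ fun u => (a u : ℂ) * pubVec s f c t y u i.1 i.2) m := by
      funext i
      rw [Pi.smul_apply, ← Pi.smul_apply _ _ m, ← Matrix.mulVec_smul]
      congr 2
      funext u
      simp [hω]; ring
    rw [this, sqNorm_smul, Complex.norm_real, Real.norm_eq_abs, sq_abs, div_pow, Real.sq_sqrt hK.le]
    field_simp
  simp only [← hq]
  rw [hact]
  have hη' : 0 ≤ 1 + 1 / η := by positivity
  constructor
  · refine (sum_clockProb_le hη _ (clockMap V T L F (finalVec s f c t y K (K + D) ω)) S).trans ?_
    gcongr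
  · refine (sum_clockProb_le hη _ (clockMap V T L F (Op.actList U P l₀ (startVec s K ω))) S).trans ?_
    have h1 : sqNorm (clockMap V T L F (finalVec s f c t y K (K + D) ω) -
        clockMap V T L F (Op.actList U P l₀ (startVec s K ω))) ≤ 4 * (D * W / (K + 1)) := by
      rw [← neg_sub, ← neg_one_smul ℂ, sqNorm_smul]
      simpa using hd
    gcongr

end Pipeline

/-! ### Norms of public and private vectors -/

namespace Pipeline

open WalkAlgorithm WeightedGraph

variable {V : Type u} [Fintype V] [DecidableEq V] {T : ℕ}

section Norms

variable {U : Matrix (V × V) (V × V) ℂ} {ψ : V × V → ℂ} {x E : ℝ} {f c : V × V → ℝ}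

lemma sum_mul_eq_zero (H : FlowVectors U ψ x E f c) : ∑ z, f z * c z = 0 := by
  have h1 : ∑ z : V × V, f z.swap * c z.swap = ∑ z, f z * c z :=
    (Equiv.prodComm V V).sum_comp fun z => f z * c z
  simp only [H.antisymm, H.symm, neg_mul, Finset.sum_neg_distrib] at h1
  linarith

lemma sqNorm_vec (H : FlowVectors U ψ x E f c) (s : V) (α β γ : ℝ) :
    sqNorm (fun i : (V × V) × Bool => vec s f c α β γ i.1 i.2) =
      α ^ 2 + 2 * x * β ^ 2 + γ ^ 2 * ∑ z, c z ^ 2 := by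
  have h1 : ∀ z : V × V, ‖vec s f c α β γ z true‖ ^ 2 =
      β ^ 2 * f z ^ 2 + γ ^ 2 * c z ^ 2 + 2 * β * γ * (f z * c z) := by
    intro z
    simp only [vec, if_true, Complex.norm_real, Real.norm_eq_abs, sq_abs]
    ring
  have h2 : ∑ z : V × V, ‖vec s f c α β γ z false‖ ^ 2 = α ^ 2 := by
    rw [Finset.sum_eq_single (s, s)]
    · simp [vec]
    · intro z _ hz; simp [vec, hz]
    · simp
  rw [sqNorm, Fintype.sum_prod_type_right, Fintype.sum_bool, h2, Finset.sum_congr rfl fun z _ => h1 z,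
    Finset.sum_add_distrib, Finset.sum_add_distrib, ← Finset.mul_sum, ← Finset.mul_sum,
    ← Finset.mul_sum, sum_mul_eq_zero H, H.norm_f]
  ring

/-- Conservation of norm: e + tf and ye - tf are orthogonal, with squared norms 1 + y and y(1 + y).
-/
lemma coefs_invariant {y : ℝ} (hy : 0 ≤ y) (j : ℕ) :
    (coefs y j).1 ^ 2 + y * (coefs y j).2 ^ 2 = 1 / (1 + y) := by
  induction j with
  | zero => simp only [coefs]; field_simp
  | succ j ih =>
    have h : ((1 - y) * (coefs y j).1 - 2 * y * (coefs y j).2) ^ 2 +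
        y * ((1 - y) * (coefs y j).2 + 2 * (coefs y j).1) ^ 2 =
        (1 + y) ^ 2 * ((coefs y j).1 ^ 2 + y * (coefs y j).2 ^ 2) := by ring
    rw [ih] at h
    simp only [coefs, div_pow]
    rw [mul_div_assoc', ← add_div, h]
    field_simp

lemma sqNorm_pubVec (H : FlowVectors U ψ x E f c) (s : V) (t : ℝ) (j : ℕ) :
    sqNorm (fun i : (V × V) × Bool => pubVec s f c t (2 * x * t ^ 2) j i.1 i.2) = 1 := by
  have hx := H.one_le
  have hy : 0 ≤ 2 * x * t ^ 2 := by positivity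
  have h := coefs_invariant hy j
  simp only [pubVec]
  rw [sqNorm_vec H]
  rw [eq_div_iff (by positivity)] at h
  linear_combination h

lemma sqNorm_privVec (H : FlowVectors U ψ x E f c) (s : V) (t : ℝ) {h : ℝ} (hh : h ≠ 0) (j : ℕ) :
    sqNorm (fun i : (V × V) × Bool => privVec s f c t (2 * x * t ^ 2) h j i.1 i.2) =
      (1 + 2 * x * t ^ 2) * ((coefs (2 * x * t ^ 2) j).1 ^ 2 / h ^ 2 +
        2 * x * t ^ 2 * (coefs (2 * x * t ^ 2) j).2 ^ 2 * h ^ 2) +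
      (coefs (2 * x * t ^ 2) j).2 ^ 2 * h ^ 2 * t ^ 2 * ∑ z, c z ^ 2 := by
  simp only [privVec]
  rw [sqNorm_vec H]
  field_simp
  ring

/-- The dominant terms are (1 + y)A²/h² and B²h²t²‖c‖² ≤ 2yB²h²E. The choice h² = 1/√E balances
them, and the invariant bounds (1 + y)A² and yB² by 1. -/
lemma sqNorm_privVec_le (H : FlowVectors U ψ x E f c) (s : V) (t : ℝ) {h : ℝ} (hh : 0 < h)
    (hE : h ^ 2 * √E = 1) (j : ℕ) :
    sqNorm (fun i : (V × V) × Bool => privVec s f c t (2 * x * t ^ 2) h j i.1 i.2) ≤ 4 * √E := by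
  have hx := H.one_le
  have hE1 : 1 ≤ E := hx.trans H.le_E
  have hy : 0 ≤ 2 * x * t ^ 2 := by positivity
  have hinv := coefs_invariant hy j
  rw [sqNorm_privVec H s t hh.ne']
  have hc := H.norm_c
  have hr : 1 ≤ √E := Real.one_le_sqrt.2 hE1
  have hr2 : √E ^ 2 = E := Real.sq_sqrt (by linarith)
  generalize (coefs (2 * x * t ^ 2) j).1 = A at *
  generalize (coefs (2 * x * t ^ 2) j).2 = B at *
  set y := 2 * x * t ^ 2 with hyd
  have h2 : h ^ 2 = 1 / √E := by field_simp; linarith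
  rw [h2]
  rw [eq_div_iff (by positivity)] at hinv
  have h3 : B ^ 2 * (1 / √E) * t ^ 2 * ∑ z, c z ^ 2 ≤ B ^ 2 * (1 / √E) * t ^ 2 * (4 * x * E) := by
    gcongr
  have h4 : B ^ 2 * (1 / √E) * t ^ 2 * (4 * x * E) = 2 * (y * B ^ 2) * √E := by
    rw [hyd]; field_simp; rw [hr2]; ring
  have h5 : (1 + y) * (A ^ 2 / (1 / √E) + y * B ^ 2 * (1 / √E)) =
      (1 + y) * (A ^ 2 * √E + y * B ^ 2 / √E) := by field_simp
  have h6 : y * B ^ 2 / √E ≤ y * B ^ 2 * √E := by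
    rw [div_le_iff₀ (by positivity)]
    have : 0 ≤ y * B ^ 2 := by positivity
    nlinarith [mul_nonneg this (show 0 ≤ √E * √E - 1 by nlinarith)]
  have h7 : (1 + y) * (A ^ 2 * √E + y * B ^ 2 / √E) ≤ √E := by
    calc _ ≤ (1 + y) * (A ^ 2 * √E + y * B ^ 2 * √E) := by gcongr
      _ = ((A ^ 2 + y * B ^ 2) * (1 + y)) * √E := by ring
      _ = √E := by rw [hinv, one_mul]
  have h8 : y * B ^ 2 ≤ 1 := by nlinarith [sq_nonneg A, sq_nonneg B, mul_nonneg hy (sq_nonneg B), mul_nonneg hy (sq_nonneg A), mul_nonneg hy (mul_nonneg hy (sq_nonneg B))]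
  rw [h5]
  nlinarith

/-- Initially A = B = 1/(1 + y), so the first catalyst shrinks like 1/(1 + y), the pass probability
of the scale test. This makes the error of the test relative, which keeps false passes rare at large
y. -/
lemma sqNorm_privVec_zero_le (H : FlowVectors U ψ x E f c) (s : V) {t : ℝ} {h : ℝ} (hh : 0 < h)
    (hE : h ^ 2 * √E = 1) (ht : t ^ 2 ≤ 1) :
    sqNorm (fun i : (V × V) × Bool => privVec s f c t (2 * x * t ^ 2) h 0 i.1 i.2) ≤
      5 * √E / (1 + 2 * x * t ^ 2) := by
  have hx := H.one_le
  have hE1 : 1 ≤ E := hx.trans H.le_E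
  have hy : 0 ≤ 2 * x * t ^ 2 := by positivity
  rw [sqNorm_privVec H s t hh.ne']
  have hc := H.norm_c
  have hr : 1 ≤ √E := Real.one_le_sqrt.2 hE1
  have hr2 : √E ^ 2 = E := Real.sq_sqrt (by linarith)
  simp only [coefs]
  have hyE : 2 * x * t ^ 2 ≤ 2 * E := by nlinarith [H.le_E]
  set y := 2 * x * t ^ 2 with hyd
  have h2 : h ^ 2 = 1 / √E := by field_simp; linarith
  rw [h2]
  have h3 : (1 / (1 + y)) ^ 2 * (1 / √E) * t ^ 2 * ∑ z, c z ^ 2 ≤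
      (1 / (1 + y)) ^ 2 * (1 / √E) * t ^ 2 * (4 * x * E) := by
    gcongr
  have h4 : (1 / (1 + y)) ^ 2 * (1 / √E) * t ^ 2 * (4 * x * E) = 2 * y / (1 + y) ^ 2 * √E := by
    rw [hyd]; field_simp; rw [hr2]; ring
  have h5 : 2 * y / (1 + y) ^ 2 * √E ≤ 2 * √E / (1 + y) := by
    rw [div_mul_eq_mul_div, div_le_div_iff₀ (by positivity) (by positivity)]
    have : 0 ≤ √E * (1 + y) := by positivity
    nlinarith
  have h6 : (1 + y) * ((1 / (1 + y)) ^ 2 / (1 / √E) + y * (1 / (1 + y)) ^ 2 * (1 / √E)) =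
      (√E + y / √E) / (1 + y) := by field_simp
  have h7 : y / √E ≤ 2 * √E := by
    rw [div_le_iff₀ (by positivity)]; nlinarith
  have h8 : (√E + y / √E) / (1 + y) ≤ 3 * √E / (1 + y) := by gcongr; linarith
  rw [h6]
  have h9 : 5 * √E / (1 + y) = 3 * √E / (1 + y) + 2 * √E / (1 + y) := by ring
  linarith

end Norms

end Pipeline

/-! ### Phase estimation and the scale test for ideal public vectors -/

lemma sqNorm_smul_add_smul_le {ι : Type*} [Fintype ι] {a b B : ℝ} (ha : a ^ 2 ≤ B) (hb : b ^ 2 ≤ B)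
    {ψ φ : ι → ℂ} (hψ : sqNorm ψ = 1) (hφ : sqNorm φ = 1) :
    sqNorm (((a / 2 : ℝ) : ℂ) • ψ + ((b / 2 : ℝ) : ℂ) • φ) ≤ B := by
  have h := sqNorm_sub_le (((a / 2 : ℝ) : ℂ) • ψ) (-((b / 2 : ℝ) : ℂ) • φ)
  rw [neg_smul, sub_neg_eq_add, ← neg_smul, sqNorm_smul, sqNorm_smul, hψ, hφ, norm_neg,
    Complex.norm_real, Complex.norm_real, Real.norm_eq_abs, Real.norm_eq_abs, sq_abs, sq_abs] at h
  linarith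

lemma sum_sq_mul_sq_sub (m : ℝ) (n : ℕ) :
    ∑ u ∈ Finset.range n, ((u : ℝ) * (m - u)) ^ 2 =
      m ^ 2 * ((n - 1) * n * (2 * n - 1) / 6) - 2 * m * ((n - 1) * n / 2) ^ 2 +
        (n - 1) * n * (2 * n - 1) * (3 * (n - 1) ^ 2 + 3 * (n - 1) - 1) / 30 := by
  induction n with
  | zero => simp
  | succ n ih => rw [Finset.sum_range_succ, ih]; push_cast; ring

lemma le_sum_sq_mul_sq_sub {T : ℕ} (hT : 2 ≤ T) :
    (T : ℝ) ^ 5 / 60 ≤ ∑ u ∈ Finset.range T, ((u : ℝ) * (T - u)) ^ 2 := by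
  rw [sum_sq_mul_sq_sub]
  have h : (2 : ℝ) ≤ T := by exact_mod_cast hT
  have h4 : (16 : ℝ) ≤ (T : ℝ) ^ 4 := by
    calc (16 : ℝ) = 2 ^ 4 := by norm_num
      _ ≤ _ := by gcongr
  have : 0 ≤ (T : ℝ) * ((T : ℝ) ^ 4 - 16) := by
    apply mul_nonneg <;> linarith
  nlinarith

/-- Half the adjacency matrix of the path. -/
def halfPath (T : ℕ) : Matrix (Fin T) (Fin T) ℂ :=
  Matrix.of fun i j => if (j : ℕ) = i + 1 ∨ (j : ℕ) + 1 = i then 1 / 2 else 0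

lemma isHermitian_halfPath (T : ℕ) : (halfPath T).IsHermitian := by
  ext i j
  simp only [halfPath, Matrix.conjTranspose_apply, Matrix.of_apply]
  have : ((i : ℕ) = j + 1 ∨ (i : ℕ) + 1 = j) ↔ ((j : ℕ) = i + 1 ∨ (j : ℕ) + 1 = i) := by omega
  simp only [this]
  split_ifs <;> simp

lemma halfPath_mulVec {T : ℕ} {g : ℕ → ℂ} (hg : g T = 0) (u : Fin T) :
    (halfPath T *ᵥ fun j => g j) u = (g (u + 1) + if (u : ℕ) = 0 then 0 else g (u - 1)) / 2 := by
  simp only [Matrix.mulVec, dotProduct, halfPath, Matrix.of_apply]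
  have h1 : ∀ j : ℕ, (if j = u + 1 ∨ j + 1 = u then (1 / 2 : ℂ) else 0) * g j =
      (if j = u + 1 then g (u + 1) / 2 else 0) +
      (if j = u - 1 then (if (u : ℕ) = 0 then 0 else g (u - 1) / 2) else 0) := by
    intro j
    by_cases h2 : j = u + 1
    · rw [if_pos (Or.inl h2), if_pos h2, if_neg (by omega), h2]; ring
    · by_cases h3 : j + 1 = u
      · rw [if_pos (Or.inr h3), if_neg h2, if_pos (by omega), if_neg (by omega),
          show (u : ℕ) - 1 = j by omega]; ring
      · rw [if_neg (by omega), if_neg h2]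
        by_cases h4 : j = u - 1
        · rw [if_pos h4, if_pos (by omega)]; ring
        · rw [if_neg h4]; ring
  rw [Finset.sum_congr rfl fun (j : Fin T) _ => h1 j, Finset.sum_add_distrib,
    Fin.sum_univ_eq_sum_range (fun j => if j = (u : ℕ) + 1 then g (u + 1) / 2 else 0),
    Fin.sum_univ_eq_sum_range
      (fun j => if j = (u : ℕ) - 1 then (if (u : ℕ) = 0 then 0 else g (u - 1) / 2) else 0),
    Finset.sum_ite_eq', Finset.sum_ite_eq']
  have h5 : (if (u : ℕ) + 1 ∈ Finset.range T then g (u + 1) / 2 else 0) = g (u + 1) / 2 := by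
    by_cases h6 : (u : ℕ) + 1 < T
    · rw [if_pos (Finset.mem_range.2 h6)]
    · rw [if_neg (by simpa using h6), show (u : ℕ) + 1 = T by omega, hg, zero_div]
  rw [h5, if_pos (Finset.mem_range.2 (by omega))]
  split_ifs <;> ring

namespace Pipeline

open WalkAlgorithm WeightedGraph

variable {V : Type u} [Fintype V] [DecidableEq V] {T : ℕ}

/-- The Chebyshev recurrence for iterates of a plane rotation with cosine (1 - y)/(1 + y). It makes
the sequence of public vectors a formal eigenvector of `halfPath`. -/
lemma pubVec_recurrence (s : V) (f c : V × V → ℝ) (t : ℝ) {y : ℝ} (hy : 0 ≤ y) (j : ℕ) (z : V × V)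
    (b : Bool) : pubVec s f c t y (j + 2) z b =
      2 * (((1 - y) / (1 + y) : ℝ) : ℂ) * pubVec s f c t y (j + 1) z b - pubVec s f c t y j z b := by
  have hy1 : 1 + y ≠ 0 := by positivity
  have h1 : (coefs y (j + 2)).1 = 2 * ((1 - y) / (1 + y)) * (coefs y (j + 1)).1 - (coefs y j).1 := by
    simp only [coefs]; field_simp; ring
  have h2 : (coefs y (j + 2)).2 = 2 * ((1 - y) / (1 + y)) * (coefs y (j + 1)).2 - (coefs y j).2 := by
    simp only [coefs]; field_simp; ring
  simp only [pubVec, vec, h1, h2]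
  cases b
  · simp only [Bool.false_eq_true, if_false]
    split_ifs
    · push_cast; ring
    · ring
  · simp only [if_true]
    push_cast; ring

/-- Phase estimation: the outcome `μ m` of the clock is close to `(1 - y) / (1 + y)`. -/
lemma exists_phaseEstimation (V : Type u) [Fintype V] [DecidableEq V] (hT : 2 ≤ T) :
    ∃ (a μ : Fin T → ℝ) (F : Matrix (Fin T) (Fin T) ℂ), ∑ u, a u ^ 2 = 1 ∧
      F ∈ Matrix.unitaryGroup (Fin T) ℂ ∧
      ∀ (U : Matrix (V × V) (V × V) ℂ) (ψ : V × V → ℂ) (x E : ℝ) (f c : V × V → ℝ),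
        FlowVectors U ψ x E f c → ∀ (s : V) (t : ℝ),
        ∑ m, (μ m - (1 - 2 * x * t ^ 2) / (1 + 2 * x * t ^ 2)) ^ 2 *
          sqNorm (fun i : (V × V) × Bool =>
            (F *ᵥ fun u => (a u : ℂ) * pubVec s f c t (2 * x * t ^ 2) u i.1 i.2) m) ≤
          60 / (T : ℝ) ^ 2 := by
  set S : ℝ := ∑ u ∈ Finset.range T, ((u : ℝ) * (T - u)) ^ 2 with hS
  have hTpos : (0 : ℝ) < T := by exact_mod_cast (by omega : 0 < T)
  have hS1 : (T : ℝ) ^ 5 / 60 ≤ S := le_sum_sq_mul_sq_sub hT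
  have hS0 : 0 < S := lt_of_lt_of_le (by positivity) hS1
  -- The window vanishes at both ends of the path, where the recurrence is cut off, and its
  -- increments are at most T/√S.
  set a : ℕ → ℝ := fun u => u * (T - u) / √S with ha
  set hA := isHermitian_halfPath T
  set F : Matrix (Fin T) (Fin T) ℂ := star (hA.eigenvectorUnitary : Matrix (Fin T) (Fin T) ℂ) with hF
  have hFu : F ∈ Matrix.unitaryGroup (Fin T) ℂ := Unitary.star_mem hA.eigenvectorUnitary.2
  have hFA : F * halfPath T = Matrix.diagonal (fun m => (hA.eigenvalues m : ℂ)) * F := by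
    have h1 := hA.spectral_theorem
    have h2 : F * (hA.eigenvectorUnitary : Matrix (Fin T) (Fin T) ℂ) = 1 :=
      Matrix.mem_unitaryGroup_iff'.1 hA.eigenvectorUnitary.2
    rw [Unitary.conjStarAlgAut_apply] at h1
    conv_lhs => rw [h1]
    rw [← mul_assoc, ← mul_assoc, h2, one_mul]
    rfl
  refine ⟨fun u => a u, hA.eigenvalues, F, ?_, hFu, ?_⟩
  · rw [Fin.sum_univ_eq_sum_range (fun u => a u ^ 2)]
    simp only [ha, div_pow, Real.sq_sqrt hS0.le, ← Finset.sum_div]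
    exact div_self hS0.ne'
  intro U ψ x E f c H s t
  have hy : 0 ≤ 2 * x * t ^ 2 := by have := H.one_le; positivity
  set y := 2 * x * t ^ 2 with hyd
  set C := (1 - y) / (1 + y) with hC
  set ξ : ℕ → (V × V) × Bool → ℂ := fun u i => pubVec s f c t y u i.1 i.2 with hξ
  have hξ1 : ∀ u, sqNorm (ξ u) = 1 := fun u => sqNorm_pubVec H s t u
  set g : (V × V) × Bool → Fin T → ℂ := fun i u => (a u : ℂ) * ξ u i with hg
  set r : (V × V) × Bool → Fin T → ℂ := fun i => halfPath T *ᵥ g i - (C : ℂ) • g i with hr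
  have h1 : ∀ m i, ((hA.eigenvalues m : ℂ) - C) * (F *ᵥ g i) m = (F *ᵥ r i) m := by
    intro m i
    rw [hr]
    simp only
    rw [Matrix.mulVec_sub, Matrix.mulVec_mulVec, hFA, ← Matrix.mulVec_mulVec, Matrix.mulVec_smul,
      Pi.sub_apply, Matrix.mulVec_diagonal, Pi.smul_apply, smul_eq_mul]
    ring
  have h2 : ∀ m, (hA.eigenvalues m - C) ^ 2 * sqNorm (fun i => (F *ᵥ g i) m) =
      ∑ i, ‖(F *ᵥ r i) m‖ ^ 2 := by
    intro m
    rw [sqNorm, Finset.mul_sum]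
    refine Finset.sum_congr rfl fun i _ => ?_
    rw [← h1, norm_mul, mul_pow, ← Complex.ofReal_sub, Complex.norm_real, Real.norm_eq_abs, sq_abs]
  -- In the residual of the approximate eigenvector, Cξ_u is the mean of its neighbours ξ_(u±1), so
  -- only increments of the window remain.
  have h3 : ∀ u : Fin T, sqNorm (fun i => r i u) ≤ (T : ℝ) ^ 2 / S := by
    intro u
    have hu : ((u : ℕ) : ℝ) + 1 ≤ T := by exact_mod_cast u.2
    have hu0 : (0 : ℝ) ≤ (u : ℕ) := Nat.cast_nonneg _
    have hb : ∀ v : ℝ, |v| ≤ T → (v / √S) ^ 2 ≤ (T : ℝ) ^ 2 / S := by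
      intro v hv
      rw [div_pow, Real.sq_sqrt hS0.le]
      exact div_le_div_of_nonneg_right (sq_le_sq.2 (by rwa [abs_of_pos hTpos])) hS0.le
    have hgT : ∀ i, (a T : ℂ) * ξ T i = 0 := by intro i; simp [ha]
    have hru : ∀ i, r i u = ((a (u + 1) : ℂ) * ξ (u + 1) i +
        if (u : ℕ) = 0 then 0 else (a (u - 1) : ℂ) * ξ (u - 1) i) / 2 - C * (a u * ξ u i) := by
      intro i
      have := halfPath_mulVec (g := fun u => (a u : ℂ) * ξ u i) (hgT i) u
      rw [hr]
      simp only [Pi.sub_apply, Pi.smul_apply, smul_eq_mul, hg, this]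
    rcases Nat.eq_zero_or_pos (u : ℕ) with h0 | h0
    · have h4 : (fun i => r i u) = (((((T : ℝ) - 1) / √S) / 2 : ℝ) : ℂ) • ξ 1 +
          (((0 : ℝ) / 2 : ℝ) : ℂ) • ξ 1 := by
        funext i
        rw [hru i, h0]
        simp [ha]
        ring
      rw [h4]
      refine sqNorm_smul_add_smul_le (hb _ ?_) (by simp; positivity) (hξ1 1) (hξ1 1)
      rw [abs_le]; constructor <;> linarith
    · obtain ⟨v, hv⟩ : ∃ v : ℕ, (u : ℕ) = v + 1 := ⟨u - 1, by omega⟩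
      have hvr : ((u : ℕ) : ℝ) = v + 1 := by rw [hv]; push_cast; ring
      have hv0 : (0 : ℝ) ≤ v := Nat.cast_nonneg _
      have h4 : (fun i => r i u) = (((((T : ℝ) - 2 * v - 3) / √S) / 2 : ℝ) : ℂ) • ξ (v + 2) +
          ((((2 * v + 1 - T : ℝ) / √S) / 2 : ℝ) : ℂ) • ξ v := by
        funext i
        have h5 : ξ (v + 2) i = 2 * (C : ℂ) * ξ (v + 1) i - ξ v i :=
          pubVec_recurrence s f c t hy v i.1 i.2
        rw [hru i, hv, if_neg (by omega)]
        simp only [Pi.add_apply, Pi.smul_apply, smul_eq_mul, add_tsub_cancel_right, ha,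
          show v + 1 + 1 = v + 2 from rfl]
        rw [show (C : ℂ) * ((((v + 1 : ℕ) : ℝ) * (T - ((v + 1 : ℕ) : ℝ)) / √S : ℝ) * ξ (v + 1) i) =
          ((((v + 1 : ℕ) : ℝ) * (T - ((v + 1 : ℕ) : ℝ)) / √S : ℝ) : ℂ) *
            ((ξ (v + 2) i + ξ v i) / 2) by rw [h5]; ring]
        push_cast
        ring
      rw [h4]
      refine sqNorm_smul_add_smul_le (hb _ ?_) (hb _ ?_) (hξ1 _) (hξ1 _)
      all_goals rw [abs_le]; constructor <;> linarith
  calc _ = ∑ m, ∑ i, ‖(F *ᵥ r i) m‖ ^ 2 := Finset.sum_congr rfl fun m _ => h2 m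
    _ = ∑ i, sqNorm (F *ᵥ r i) := Finset.sum_comm
    _ = ∑ i, sqNorm (r i) := Finset.sum_congr rfl fun i _ => sqNorm_unitary_mulVec hFu (r i)
    _ = ∑ u, sqNorm (fun i => r i u) := Finset.sum_comm
    _ ≤ ∑ _u : Fin T, (T : ℝ) ^ 2 / S := Finset.sum_le_sum fun u _ => h3 u
    _ = (T : ℝ) ^ 3 / S := by simp; ring
    _ ≤ 60 / (T : ℝ) ^ 2 := by
      rw [div_le_div_iff₀ hS0 (by positivity)]
      linarith

/-- A test that is passed with probability `1 / (1 + y)`. -/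
lemma exists_test (V : Type u) [Fintype V] [DecidableEq V] (hT : 2 ≤ T) :
    ∃ (a : Fin T → ℝ) (m₀ : Fin T) (F : Matrix (Fin T) (Fin T) ℂ), ∑ u, a u ^ 2 = 1 ∧
      (∀ u, a u ≠ 0 → (u : ℕ) ≤ 1) ∧ F ∈ Matrix.unitaryGroup (Fin T) ℂ ∧
      ∀ (U : Matrix (V × V) (V × V) ℂ) (ψ : V × V → ℂ) (x E : ℝ) (f c : V × V → ℝ),
        FlowVectors U ψ x E f c → ∀ (s : V) (t : ℝ),
          sqNorm (fun i : (V × V) × Bool =>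
            (F *ᵥ fun u => (a u : ℂ) * pubVec s f c t (2 * x * t ^ 2) u i.1 i.2) m₀) =
          1 / (1 + 2 * x * t ^ 2) := by
  obtain ⟨n, rfl⟩ : ∃ n, T = n + 2 := ⟨T - 2, by omega⟩
  -- The clock starts in the uniform superposition of 0 and 1 and is tested for the same state. This
  -- leaves half the sum of e and its rotated image, whose squared norm is the squared cosine of
  -- half the angle.
  set a : Fin (n + 2) → ℝ := Fin.cons (1 / √2) (Fin.cons (1 / √2) fun _ => 0) with ha
  have h2 : (1 / √2 : ℝ) ^ 2 = 1 / 2 := by rw [div_pow, Real.sq_sqrt (by norm_num)]; norm_num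
  have hsum : ∑ u, a u ^ 2 = 1 := by
    rw [Fin.sum_univ_succ, Fin.sum_univ_succ]
    simp only [ha, Fin.cons_zero, Fin.cons_succ, h2]
    norm_num
  obtain ⟨Q, hQ, hQ1⟩ := exists_unitary_mulVec_single (0 : Fin (n + 2)) (fun u => (a u : ℂ)) (by
    simpa [sqNorm] using hsum)
  refine ⟨a, 0, Qᴴ, hsum, ?_, Unitary.star_mem hQ, ?_⟩
  · intro u hu
    by_contra hn
    obtain ⟨v, rfl⟩ : ∃ v : Fin n, u = v.succ.succ := ⟨⟨u - 2, by omega⟩, Fin.ext (by simp; omega)⟩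
    exact hu (by simp [ha])
  intro U ψ x E f c H s t
  have hx := H.one_le
  have hy : 0 ≤ 2 * x * t ^ 2 := by positivity
  have hrow : ∀ g : Fin (n + 2) → ℂ, (Qᴴ *ᵥ g) 0 = ∑ u, (a u : ℂ) * g u := by
    intro g
    have : ∀ u, Q u 0 = a u := by
      intro u
      have := congrFun hQ1 u
      rwa [Matrix.mulVec_single_one] at this
    simp [Matrix.mulVec, dotProduct, this]
  have hval : (fun i : (V × V) × Bool => (Qᴴ *ᵥ fun u => (a u : ℂ) *
      pubVec s f c t (2 * x * t ^ 2) u i.1 i.2) 0) = fun i => vec s f c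
        (1 / (1 + 2 * x * t ^ 2)) (-(t / (1 + 2 * x * t ^ 2))) 0 i.1 i.2 := by
    funext i
    rw [hrow, Fin.sum_univ_succ, Fin.sum_univ_succ]
    have h2' : ((1 / √2 : ℝ) : ℂ) * ((1 / √2 : ℝ) : ℂ) = 1 / 2 := by
      rw [← Complex.ofReal_mul, ← sq, h2]; norm_num
    simp only [ha, Fin.cons_zero, Fin.cons_succ, ← mul_assoc, h2', Complex.ofReal_zero, zero_mul,
      Finset.sum_const_zero, add_zero, pubVec, vec, coefs, Fin.val_zero, Fin.val_succ, zero_add]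
    have hy1 : (1 : ℂ) + 2 * x * t ^ 2 ≠ 0 := by
      have : (1 + 2 * x * t ^ 2 : ℝ) ≠ 0 := by positivity
      exact_mod_cast this
    split_ifs
    · push_cast; field_simp; ring
    · push_cast; field_simp; ring
    · ring
  rw [hval, sqNorm_vec H]
  field_simp
  ring

end Pipeline

/-! ### Error analysis of the estimate and of the scale test -/

namespace Pipeline

open WalkAlgorithm WeightedGraph

variable {V : Type u} [Fintype V] [DecidableEq V] {T L : ℕ}

/-- The map y ↦ (1 - y)/(1 + y) is an involution, so the same formula recovers y from μ. On [1/64,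
64] one has (1 + y)² ≤ 67y, which turns precision ε/70 for μ into relative precision ε for y. -/
lemma abs_div_sub_le {x t ε μ : ℝ} (hx : 0 < x) (ht : t ≠ 0) (hε1 : ε < 1)
    (hy1 : 1 / 64 ≤ 2 * x * t ^ 2) (hy2 : 2 * x * t ^ 2 ≤ 64)
    (hμ : |μ - (1 - 2 * x * t ^ 2) / (1 + 2 * x * t ^ 2)| ≤ ε / 70) :
    |(1 - μ) / (1 + μ) / (2 * t ^ 2) - x| ≤ ε * x := by
  set y := 2 * x * t ^ 2 with hy
  have hy0 : 0 < y := by linarith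
  have ht2 : 0 < t ^ 2 := by positivity
  have hε : 0 ≤ ε := by have := (abs_nonneg _).trans hμ; linarith
  obtain ⟨δ, rfl⟩ : ∃ δ, μ = (1 - y) / (1 + y) + δ := ⟨_, (add_sub_cancel _ _).symm⟩
  rw [add_sub_cancel_left] at hμ
  have hδ := abs_le.1 hμ
  have hden : 0 < 2 + δ * (1 + y) := by nlinarith
  have h1 : (1 - ((1 - y) / (1 + y) + δ)) / (1 + ((1 - y) / (1 + y) + δ)) - y =
      -(δ * (1 + y) ^ 2) / (2 + δ * (1 + y)) := by
    have h2 : 1 + ((1 - y) / (1 + y) + δ) = (2 + δ * (1 + y)) / (1 + y) := by field_simp; ring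
    have h3 : 1 - ((1 - y) / (1 + y) + δ) = (2 * y - δ * (1 + y)) / (1 + y) := by field_simp; ring
    rw [h2, h3]
    field_simp
    ring
  have h4 : |(1 - ((1 - y) / (1 + y) + δ)) / (1 + ((1 - y) / (1 + y) + δ)) - y| ≤ ε * y := by
    rw [h1, abs_div, abs_neg, abs_mul, abs_of_pos hden, abs_of_nonneg (sq_nonneg (1 + y)),
      div_le_iff₀ hden]
    have h5 : |δ| * (1 + y) ^ 2 ≤ ε / 70 * (1 + y) ^ 2 := by gcongr
    have h6 : (1 + y) ^ 2 ≤ 67 * y := by nlinarith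
    have h7 : 1 ≤ 2 + δ * (1 + y) := by nlinarith
    have h8 : ε * y * 1 ≤ ε * y * (2 + δ * (1 + y)) := by gcongr
    nlinarith
  have hxy : x = y / (2 * t ^ 2) := by rw [hy]; field_simp
  rw [hxy, ← sub_div, abs_div, abs_of_pos (by positivity : 0 < 2 * t ^ 2), mul_div_assoc']
  gcongr

/-- The program that estimates `x` at the scale `t`. -/
lemma exists_estimate (s : V) (i₀ : Lab T L) (hT : 2 ≤ T) {K : ℕ} (hL : 2 * K + T + 2 ≤ L)
    {E h θ : ℝ} (hh : 0 < h) (hhE : h ^ 2 * √E = 1) (hK : 1600 * T * √E ≤ K)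
    (hθ : 0 < θ) (hTθ : 2400 ≤ (T * θ) ^ 2) (t : ℝ) :
    ∃ (l : List (Op V (Lab T L))) (μ : Fin T → ℝ), (l.map Op.cost).sum = 3 * (K + T) ∧
      ∀ (U P : Matrix (V × V) (V × V) ℂ) (ψ : V × V → ℂ) (x : ℝ) (f c : V × V → ℝ),
        FlowVectors U ψ x E f c → (∀ φ, sqNorm (U *ᵥ φ) = sqNorm φ) →
        P ∈ Matrix.unitaryGroup (V × V) ℂ → P *ᵥ Pi.single (s, s) 1 = ψ →
        ∑ m, clockProb (Op.actList U P l (Pi.single ((s, s), i₀) 1)) m = 1 ∧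
        ∀ S : Finset (Fin T),
          (∀ m, |μ m - (1 - 2 * x * t ^ 2) / (1 + 2 * x * t ^ 2)| ≤ θ → m ∈ S) →
          9 / 10 ≤ ∑ m ∈ S, clockProb (Op.actList U P l (Pi.single ((s, s), i₀) 1)) m := by
  obtain ⟨a, μ, F, ha, hF, hq⟩ := exists_phaseEstimation V hT
  obtain ⟨l, hl, hprog⟩ := exists_program s i₀ t hh.ne' ha (D := T) (fun u _ => u.2.le) hL hF
  refine ⟨l, μ, hl, ?_⟩
  intro U P ψ x f c H hU hP hψ
  obtain ⟨h1, h2⟩ := hprog U P ψ x E f c H hU hP hψ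
  refine ⟨h1, fun S hS => ?_⟩
  have h3 := (h2 (4 * √E) (by positivity) (fun u _ j _ => sqNorm_privVec_le H s t hh hhE j)
    Sᶜ 1 one_pos).1
  have h4 := hq U ψ x E f c H s t
  set q : Fin T → ℝ := fun m => sqNorm (fun i : (V × V) × Bool =>
            (F *ᵥ fun u => (a u : ℂ) * pubVec s f c t (2 * x * t ^ 2) u i.1 i.2) m) with hqd
  set C := (1 - 2 * x * t ^ 2) / (1 + 2 * x * t ^ 2) with hC
  have hq0 : ∀ m, 0 ≤ q m := fun m => sqNorm_nonneg _
  have h5 : θ ^ 2 * ∑ m ∈ Sᶜ, q m ≤ 60 / (T : ℝ) ^ 2 := by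
    refine le_trans ?_ h4
    rw [Finset.mul_sum]
    refine (Finset.sum_le_sum fun m hm => ?_).trans
      (Finset.sum_le_sum_of_subset_of_nonneg (Finset.subset_univ Sᶜ)
        fun m _ _ => mul_nonneg (sq_nonneg _) (hq0 m))
    have hm' : θ < |μ m - C| := by
      by_contra hn
      exact (Finset.mem_compl.1 hm) (hS m (not_lt.1 hn))
    refine mul_le_mul_of_nonneg_right ?_ (hq0 m)
    rw [← sq_abs (μ m - C)]
    gcongr
  have hT0 : (0 : ℝ) < T := by exact_mod_cast (by omega : 0 < T)
  -- Chebyshev's inequality, with 60/2400 = 1/40. For η = 1 the failure probability is then at most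
  -- 2/40 + 2 · 4/400 < 1/10.
  have h6 : ∑ m ∈ Sᶜ, q m ≤ 1 / 40 := by
    rw [le_div_iff₀ (by positivity)] at h5
    nlinarith [Finset.sum_nonneg fun m (_ : m ∈ Sᶜ) => hq0 m]
  have h7 : (T : ℝ) * (4 * √E) / (K + 1) ≤ 1 / 400 := by
    rw [div_le_iff₀ (by positivity)]
    linarith
  have h8 := Finset.sum_add_sum_compl S
    (clockProb (Op.actList U P l (Pi.single ((s, s), i₀) 1)))
  rw [h1] at h8
  linarith

/-- The program that tests if the scale `t` is small enough. -/
lemma exists_scaleTest (s : V) (i₀ : Lab T L) (hT : 2 ≤ T) {K : ℕ} (hL : 2 * K + 3 ≤ L)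
    {E h : ℝ} (hh : 0 < h) (hhE : h ^ 2 * √E = 1) (hK : 8000 * √E ≤ K) {t : ℝ}
    (ht : t ^ 2 ≤ 1) :
    ∃ (l : List (Op V (Lab T L))) (m₀ : Fin T), (l.map Op.cost).sum = 3 * (K + 1) ∧
      ∀ (U P : Matrix (V × V) (V × V) ℂ) (ψ : V × V → ℂ) (x : ℝ) (f c : V × V → ℝ),
        FlowVectors U ψ x E f c → (∀ φ, sqNorm (U *ᵥ φ) = sqNorm φ) →
        P ∈ Matrix.unitaryGroup (V × V) ℂ → P *ᵥ Pi.single (s, s) 1 = ψ →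
        ∑ m, clockProb (Op.actList U P l (Pi.single ((s, s), i₀) 1)) m = 1 ∧
        9 / 10 / (1 + 2 * x * t ^ 2) ≤
          clockProb (Op.actList U P l (Pi.single ((s, s), i₀) 1)) m₀ ∧
        clockProb (Op.actList U P l (Pi.single ((s, s), i₀) 1)) m₀ ≤
          6 / 5 / (1 + 2 * x * t ^ 2) := by
  obtain ⟨a, m₀, F, ha, haD, hF, hq⟩ := exists_test V hT
  obtain ⟨l, hl, hprog⟩ := exists_program s i₀ t hh.ne' ha haD (K := K) (by omega) hF
  refine ⟨l, m₀, hl, ?_⟩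
  intro U P ψ x f c H hU hP hψ
  obtain ⟨h1, h2⟩ := hprog U P ψ x E f c H hU hP hψ
  refine ⟨h1, ?_⟩
  have hx := H.one_le
  have hy : 0 < 1 + 2 * x * t ^ 2 := by positivity
  obtain ⟨h3, h4⟩ := h2 (5 * √E / (1 + 2 * x * t ^ 2)) (by positivity) (fun u hu j hj => by
    have : j = 0 := by have := haD u hu; omega
    subst this
    exact sqNorm_privVec_zero_le H s hh hhE ht) {m₀} (1 / 20) (by norm_num)
  simp only [Finset.sum_singleton, hq U ψ x E f c H s t] at h3 h4
  -- For η = 1/20 this error is multiplied by 21, which still fits between the factors 9/10 and 6/5.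
  have h5 : 4 * (((1 : ℕ) : ℝ) * (5 * √E / (1 + 2 * x * t ^ 2)) / (K + 1)) ≤
      1 / 400 * (1 / (1 + 2 * x * t ^ 2)) := by
    have : 4 * (((1 : ℕ) : ℝ) * (5 * √E / (1 + 2 * x * t ^ 2)) / (K + 1)) =
      (20 * √E / (K + 1)) * (1 / (1 + 2 * x * t ^ 2)) := by field_simp; push_cast; ring
    rw [this]
    refine mul_le_mul_of_nonneg_right ?_ (by positivity)
    rw [div_le_iff₀ (by positivity)]
    linarith
  have h6 : (0 : ℝ) < 1 / (1 + 2 * x * t ^ 2) := by positivity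
  rw [div_eq_mul_one_div (9 / 10 : ℝ), div_eq_mul_one_div (6 / 5 : ℝ)]
  generalize 1 / (1 + 2 * x * t ^ 2) = v at *
  constructor <;> linarith

end Pipeline

/-! ### Analysis of the search for the scale -/

/-- `σ n i` is the success probability from scale `i` with `n` scales left, and `e i` that of an
estimate at scale `i`. A pass at y > 64 is counted as a failure. Its probability is at most 6/5/(1 +
y), which sums geometrically as y drops by factors of 4; the term 2/5/(y + 3) in the bound absorbs
these losses. Between 1/64 and 64 a pass is good with probability 9/10. -/
lemma search_success {y π e : ℕ → ℝ} {σ : ℕ → ℕ → ℝ} (hy : ∀ i, 0 < y i)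
    (hy4 : ∀ i, y (i + 1) = y i / 4) (hπ : ∀ i, 9 / 10 / (1 + y i) ≤ π i)
    (hπ' : ∀ i, π i ≤ 6 / 5 / (1 + y i)) (hπ1 : ∀ i, π i ≤ 1)
    (he : ∀ i, 1 / 64 ≤ y i → y i ≤ 64 → 9 / 10 ≤ e i) (he0 : ∀ i, 0 ≤ e i)
    (h0 : ∀ n i, 0 ≤ σ n i) (hσ : ∀ n i, σ (n + 1) i = π i * e i + (1 - π i) * σ n (i + 1))
    (n i : ℕ) (hi : 1 / 4 ≤ y i) (hn : 64 * y i < 4 ^ n) :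
    7 / 10 + 2 / 5 / (y i + 3) ≤ σ n i := by
  have step : ∀ n i b, 1 / 64 ≤ y i → y i ≤ 64 → b ≤ 9 / 10 → b ≤ σ n (i + 1) →
      b + (9 / 10 - b) * (9 / 10 / (1 + y i)) ≤ σ (n + 1) i := by
    intro n i b h1 h2 hb hbσ
    rw [hσ]
    have hπ0 : 0 ≤ π i := le_trans (by have := hy i; positivity) (hπ i)
    nlinarith [mul_le_mul_of_nonneg_left (he i h1 h2) hπ0,
      mul_le_mul_of_nonneg_left hbσ (sub_nonneg.2 (hπ1 i)),
      mul_le_mul_of_nonneg_left (hπ i) (sub_nonneg.2 hb)]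
  induction n generalizing i with
  | zero => rw [pow_zero] at hn; linarith
  | succ n ih =>
    rcases lt_or_ge (y i) 1 with h1 | h1
    -- As 1/4 ≤ y < 1, the scales y, y/4 and y/16 are all at least 1/64, and three tests with high
    -- pass probability suffice.
    · obtain ⟨m, rfl⟩ : ∃ m, n = m + 2 := by
        refine ⟨n - 2, ?_⟩
        have : 2 ≤ n := by
          by_contra hlt
          have h4 : (4 : ℝ) ^ (n + 1) ≤ 4 ^ 2 := pow_le_pow_right₀ (by norm_num) (by omega)
          linarith
        omega
      have hy1 := hy4 i
      have hy2 := hy4 (i + 1)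
      have low : ∀ r v : ℝ, 0 < v → v ≤ r → 9 / 10 / (1 + r) ≤ 9 / 10 / (1 + v) := by
        intro r v hv hvr; gcongr
      have s2 : 3 / 4 ≤ σ (m + 1) (i + 2) := by
        have := step m (i + 2) 0 (by linarith) (by linarith) (by norm_num) (h0 _ _)
        have := low (1 / 16) (y (i + 2)) (hy _) (by linarith)
        linarith
      have s1 : 85 / 100 ≤ σ (m + 2) (i + 1) := by
        have := step (m + 1) (i + 1) (3 / 4) (by linarith) (by linarith) (by norm_num) s2
        have := low (1 / 4) (y (i + 1)) (hy _) (by linarith)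
        linarith
      have s0 := step (m + 2) i (85 / 100) (by linarith) (by linarith) (by norm_num) s1
      have h5 : 2 / 5 / (y i + 3) ≤ 2 / 5 / (1 / 4 + 3) := by gcongr
      have h6 : 0 ≤ 9 / 10 / (1 + y i) := by have := hy i; positivity
      linarith
    · have hyi := hy4 i
      have hb := ih (i + 1) (by linarith) (by rw [pow_succ] at hn; linarith)
      rw [hyi] at hb
      have h7 : 2 / 5 / (y i + 3) ≤ 2 / 5 / (y i / 4 + 3) := by gcongr; linarith [hy i]
      rcases le_or_gt (y i) 64 with h2 | h2
      · have h5 : 2 / 5 / (y i / 4 + 3) ≤ 2 / 5 / (1 / 4 + 3) := by gcongr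
        have h6 : 0 ≤ 9 / 10 / (1 + y i) := by have := hy i; positivity
        have := step n i _ (by linarith) h2 (by linarith) hb
        nlinarith
      · rw [hσ]
        have hπ0 : 0 ≤ π i := le_trans (by have := hy i; positivity) (hπ i)
        have h8 : (1 - 6 / 5 / (1 + y i)) * (7 / 10 + 2 / 5 / (y i / 4 + 3)) ≤
            (1 - π i) * σ n (i + 1) :=
          mul_le_mul (by linarith [hπ' i]) hb (by positivity) (by linarith [hπ1 i])
        have h9 : 7 / 10 + 2 / 5 / (y i + 3) ≤
            (1 - 6 / 5 / (1 + y i)) * (7 / 10 + 2 / 5 / (y i / 4 + 3)) := by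
          obtain ⟨z, hz⟩ : ∃ z, y i = 64 + z := ⟨y i - 64, by ring⟩
          have hz0 : 0 < z := by linarith
          rw [hz, ← sub_nonneg]
          have : (1 - 6 / 5 / (1 + (64 + z))) * (7 / 10 + 2 / 5 / ((64 + z) / 4 + 3)) -
              (7 / 10 + 2 / 5 / (64 + z + 3)) =
              ((9 / 25) * z ^ 2 + 819 / 25 * z + 14652 / 25) / ((65 + z) * (76 + z) * (67 + z)) := by
            field_simp
            ring
          rw [this]
          positivity
        nlinarith [mul_nonneg hπ0 (he0 i)]

/-- `c₁` is the cost of a test and `c₂` that of the estimate, which is made at most once. Below y =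
1 each test passes with probability at least 9/20, so fewer than 23/10 are expected. Above, each
failed test lowers log y by log 4 > 1, which pays for it. -/
lemma search_steps {y π : ℕ → ℝ} {τ : ℕ → ℕ → ℕ → ℝ} (c₁ c₂ : ℕ) (hy : ∀ i, 0 < y i)
    (hy4 : ∀ i, y (i + 1) = y i / 4) (hπ : ∀ i, 9 / 10 / (1 + y i) ≤ π i) (hπ1 : ∀ i, π i ≤ 1)
    (h0 : ∀ i k, τ 0 i k = k)
    (hτ : ∀ n i k, τ (n + 1) i k = π i * (k + c₁ + c₂) + (1 - π i) * τ n (i + 1) (k + c₁))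
    (n i k : ℕ) (hi : 1 / 4 ≤ y i) :
    τ n i k ≤ k + c₂ + (23 / 10 + Real.log (4 * y i)) * c₁ := by
  have hc₁ : (0 : ℝ) ≤ c₁ := Nat.cast_nonneg _
  have hc₂ : (0 : ℝ) ≤ c₂ := Nat.cast_nonneg _
  have small : ∀ n i k, y i < 1 → τ n i k ≤ k + c₂ + 23 / 10 * c₁ := by
    intro n
    induction n with
    | zero => intro i k _; rw [h0]; linarith
    | succ n ih =>
      intro i k hi
      have h1 := ih (i + 1) (k + c₁) (by rw [hy4]; linarith [hy i])
      have h2 : 9 / 20 ≤ π i := by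
        refine le_trans ?_ (hπ i)
        rw [le_div_iff₀ (by linarith [hy i])]
        linarith
      rw [hτ]
      push_cast at h1
      nlinarith [mul_le_mul_of_nonneg_left h1 (sub_nonneg.2 (hπ1 i)), mul_le_mul_of_nonneg_right h2 hc₁]
  induction n generalizing i k with
  | zero =>
    rw [h0]
    have : 0 ≤ Real.log (4 * y i) := Real.log_nonneg (by linarith)
    nlinarith [mul_nonneg this hc₁]
  | succ n ih =>
    have hlog : 0 ≤ Real.log (4 * y i) := Real.log_nonneg (by linarith)
    rcases lt_or_ge (y i) 1 with h1 | h1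
    · have := small (n + 1) i k h1
      nlinarith [mul_nonneg hlog hc₁]
    · have h2 := ih (i + 1) (k + c₁) (by rw [hy4]; linarith)
      rw [hy4, mul_div_cancel₀ _ (by norm_num : (4 : ℝ) ≠ 0)] at h2
      have h3 : Real.log (4 * y i) = 2 * Real.log 2 + Real.log (y i) := by
        rw [Real.log_mul (by norm_num) (by linarith), show (4 : ℝ) = 2 ^ 2 by norm_num, Real.log_pow]
        push_cast; ring
      have h4 := Real.log_two_gt_d9
      have h5 : 0 ≤ Real.log (y i) := Real.log_nonneg h1
      have hπ0 : 0 ≤ π i := le_trans (by have := hy i; positivity) (hπ i)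
      rw [hτ, h3]
      push_cast at h2
      nlinarith [mul_le_mul_of_nonneg_left h2 (sub_nonneg.2 (hπ1 i)), mul_nonneg h5 hc₁,
        mul_nonneg hπ0 (mul_nonneg h5 hc₁), mul_nonneg hπ0 hc₁]

/-! ### The algorithm -/

namespace WalkAlgorithm

variable {V : Type u} [Fintype V] [DecidableEq V] {k : ℕ}

lemma expect_nonneg (U P : Matrix (V × V) (V × V) ℂ) {g : ℝ → ℕ → ℝ} (hg : ∀ r n, 0 ≤ g r n)
    (A : WalkAlgorithm V k) (n : ℕ) (ψ : (V × V) × Fin (k + 1) → ℂ) : 0 ≤ A.expect U P g n ψ := by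
  induction A generalizing n ψ with
  | output r => exact mul_nonneg (Finset.sum_nonneg fun _ _ => sq_nonneg _) (hg r n)
  | unitary Q next ih => exact ih _ _
  | walk c next ih => exact ih _ _
  | prep c next ih => exact ih _ _
  | prepInv c next ih => exact ih _ _
  | measure l out next ih => exact Finset.sum_nonneg fun j _ => ih j _ _

lemma expect_of_output (U P : Matrix (V × V) (V × V) ℂ) (g : ℝ → ℝ)
    (A : WalkAlgorithm V k) (n m : ℕ) (ψ : (V × V) × Fin (k + 1) → ℂ) :
    A.expect U P (fun r _ => g r) n ψ = A.expect U P (fun r _ => g r) m ψ := by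
  induction A generalizing n m ψ with
  | output r => rfl
  | unitary Q next ih => exact ih _ _ _
  | walk c next ih => exact ih _ _ _
  | prep c next ih => exact ih _ _ _
  | prepInv c next ih => exact ih _ _ _
  | measure l out next ih => exact Finset.sum_congr rfl fun j _ => ih j _ _ _

lemma expect_output_initState (U P : Matrix (V × V) (V × V) ℂ) (g : ℝ → ℕ → ℝ) (r : ℝ) (n : ℕ)
    (s : V) : (output r : WalkAlgorithm V k).expect U P g n (initState s) = g r n := by
  have := sqNorm_single (((s, s), 0) : (V × V) × Fin (k + 1))
  rw [sqNorm] at this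
  simp only [expect, initState, this, one_mul]

end WalkAlgorithm

namespace Pipeline

open WalkAlgorithm WeightedGraph

variable {V : Type u} [Fintype V] [DecidableEq V] {T L k : ℕ}

lemma expect_run_clock (e : Lab T L ≃ Fin (k + 1)) (U P : Matrix (V × V) (V × V) ℂ)
    (g : ℝ → ℕ → ℝ) (s : V) (l : List (Op V (Lab T L))) (B : Fin T → WalkAlgorithm V k) (n : ℕ) :
    (Op.run e s l fun i => B i.2.1.1).expect U P g n (initState s) =
      ∑ m, clockProb (Op.actList U P l (Pi.single ((s, s), e.symm 0) 1)) m *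
        (B m).expect U P g (n + (l.map Op.cost).sum) (initState s) := by
  rw [Op.expect_run]
  exact sum_mul_clock _ fun m => (B m).expect U P g (n + (l.map Op.cost).sum) (initState s)

/-- Go through the scales until a test is passed, then estimate at this scale. -/
def search (e : Lab T L ≃ Fin (k + 1)) (s : V) (test : ℕ → List (Op V (Lab T L)))
    (m₀ : ℕ → Fin T) (est : ℕ → WalkAlgorithm V k) : ℕ → ℕ → WalkAlgorithm V k
  | 0, _ => output 0
  | n + 1, i => Op.run e s (test i) fun o =>
      if o.2.1.1 = m₀ i then est i else search e s test m₀ est n (i + 1)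

lemma expect_search_succ (e : Lab T L ≃ Fin (k + 1)) (U P : Matrix (V × V) (V × V) ℂ)
    (g : ℝ → ℕ → ℝ) (s : V) (test : ℕ → List (Op V (Lab T L)))
    (m₀ : ℕ → Fin T) (est : ℕ → WalkAlgorithm V k) (n i c : ℕ)
    (h : ∑ m, clockProb (Op.actList U P (test i) (Pi.single ((s, s), e.symm 0) 1)) m = 1) :
    (search e s test m₀ est (n + 1) i).expect U P g c (initState s) =
      clockProb (Op.actList U P (test i) (Pi.single ((s, s), e.symm 0) 1)) (m₀ i) *
        (est i).expect U P g (c + ((test i).map Op.cost).sum) (initState s) +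
      (1 - clockProb (Op.actList U P (test i) (Pi.single ((s, s), e.symm 0) 1)) (m₀ i)) *
        (search e s test m₀ est n (i + 1)).expect U P g (c + ((test i).map Op.cost).sum)
          (initState s) := by
  rw [search, expect_run_clock e U P g s (test i)
    (fun m => if m = m₀ i then est i else search e s test m₀ est n (i + 1))]
  rw [← Finset.add_sum_erase _ _ (Finset.mem_univ (m₀ i))] at h ⊢
  rw [if_pos rfl, ← h, add_sub_cancel_left, Finset.sum_mul]
  congr 1
  exact Finset.sum_congr rfl fun m hm => by rw [if_neg (Finset.ne_of_mem_erase hm)]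

/-- Estimate at a fixed scale `t`. -/
def estimate (e : Lab T L ≃ Fin (k + 1)) (s : V) (l : List (Op V (Lab T L))) (μ : Fin T → ℝ)
    (t : ℝ) : WalkAlgorithm V k :=
  Op.run e s l fun o => output ((1 - μ o.2.1.1) / (1 + μ o.2.1.1) / (2 * t ^ 2))

lemma expect_estimate (e : Lab T L ≃ Fin (k + 1)) (U P : Matrix (V × V) (V × V) ℂ)
    (g : ℝ → ℕ → ℝ) (s : V) (l : List (Op V (Lab T L))) (μ : Fin T → ℝ) (t : ℝ) (n : ℕ) :
    (estimate e s l μ t).expect U P g n (initState s) =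
      ∑ m, clockProb (Op.actList U P l (Pi.single ((s, s), e.symm 0) 1)) m *
        g ((1 - μ m) / (1 + μ m) / (2 * t ^ 2)) (n + (l.map Op.cost).sum) := by
  rw [estimate, expect_run_clock e U P g s l
    (fun m => output ((1 - μ m) / (1 + μ m) / (2 * t ^ 2)))]
  simp only [expect_output_initState]

/-- The algorithm, for an upper bound `E ≥ 1` on the escape time and a precision `ε < 1`. -/
theorem exists_algorithm (s : V) {E ε : ℝ} (hE : 1 ≤ E) (hε : 0 < ε) (hε1 : ε < 1) :
    ∃ (k : ℕ) (A : WalkAlgorithm V k),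
      ∀ (U P : Matrix (V × V) (V × V) ℂ) (ψ : V × V → ℂ) (x : ℝ) (f c : V × V → ℝ),
        FlowVectors U ψ x E f c → (∀ φ, sqNorm (U *ᵥ φ) = sqNorm φ) →
        P ∈ Matrix.unitaryGroup (V × V) ℂ → P *ᵥ Pi.single (s, s) 1 = ψ →
        2 / 3 ≤ A.outputProb s U P {r | |r - x| ≤ ε * x} ∧
        A.expectedSteps s U P ≤ 20000000 * √E * (1 / ε + Real.log x) := by
  have hr : 1 ≤ √E := Real.one_le_sqrt.2 hE
  -- 3500 = 50 · 70: at precision θ = ε/70 one gets (Tθ)² ≥ 2500, above the required 2400.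
  set T : ℕ := ⌈3500 / ε⌉₊ with hTd
  have hT1 : 3500 / ε ≤ T := Nat.le_ceil _
  have hT2 : (T : ℝ) < 3500 / ε + 1 := Nat.ceil_lt_add_one (by positivity)
  have hε' : 1 < 1 / ε := by rwa [lt_div_iff₀ hε, one_mul]
  have hT3 : (2 : ℝ) ≤ T := by
    have : 3500 / ε = 3500 * (1 / ε) := by ring
    linarith
  have hT : 2 ≤ T := by exact_mod_cast hT3
  set K₁ : ℕ := ⌈8000 * √E⌉₊ with hK₁d
  have hK₁ : 8000 * √E ≤ K₁ := Nat.le_ceil _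
  have hK₁' : (K₁ : ℝ) < 8000 * √E + 1 := Nat.ceil_lt_add_one (by positivity)
  set K₂ : ℕ := ⌈1600 * T * √E⌉₊ with hK₂d
  have hK₂ : 1600 * T * √E ≤ K₂ := Nat.le_ceil _
  have hK₂' : (K₂ : ℝ) < 1600 * T * √E + 1 := Nat.ceil_lt_add_one (by positivity)
  -- Tests and estimates share one workspace, so `L` is long enough for both.
  set L : ℕ := 2 * K₁ + 2 * K₂ + T + 3 with hLd
  set h : ℝ := 1 / √(√E) with hh
  have hh0 : 0 < h := by positivity
  have hhE : h ^ 2 * √E = 1 := by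
    rw [hh, div_pow, Real.sq_sqrt (by positivity)]; field_simp
  obtain ⟨k, hk⟩ : ∃ k, Fintype.card (Lab T L) = k + 1 := by
    have : NeZero T := ⟨by omega⟩
    have : NeZero L := ⟨by omega⟩
    exact Nat.exists_eq_succ_of_ne_zero Fintype.card_ne_zero
  have e : Lab T L ≃ Fin (k + 1) := Fintype.equivFinOfCardEq hk
  have ht : ∀ i : ℕ, ((1 / 2 : ℝ) ^ i) ^ 2 ≤ 1 := fun i => by
    rw [← pow_mul]; exact pow_le_one₀ (by norm_num) (by norm_num)
  choose test m₀ htest hspec₁ using fun i : ℕ => exists_scaleTest s (e.symm 0) hT (K := K₁) (L := L)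
    (by omega) hh0 hhE hK₁ (ht i)
  choose prog μ hprog hspec₂ using fun i : ℕ => exists_estimate s (e.symm 0) hT (K := K₂) (L := L)
    (by omega) hh0 hhE hK₂ (θ := ε / 70) (by positivity) (by
      have : 50 ≤ T * (ε / 70) := by
        rw [div_le_iff₀ hε] at hT1; linarith
      nlinarith) ((1 / 2 : ℝ) ^ i)
  -- The search starts at y = 2x ≤ 2E, and `search_success` needs 64y < 4^N. Here `N` depends on the
  -- bound `E` only, not on the graph.
  obtain ⟨N, hN⟩ := pow_unbounded_of_one_lt (128 * E) (by norm_num : (1 : ℝ) < 4)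
  set est : ℕ → WalkAlgorithm V k := fun i => estimate e s (prog i) (μ i) ((1 / 2 : ℝ) ^ i) with hest
  refine ⟨k, search e s test m₀ est N 0, ?_⟩
  intro U P ψ x f c H hU hP hψ
  have hx := H.one_le
  set y : ℕ → ℝ := fun i => 2 * x * ((1 / 2 : ℝ) ^ i) ^ 2 with hyd
  have hy : ∀ i, 0 < y i := fun i => by positivity
  have hy4 : ∀ i, y (i + 1) = y i / 4 := fun i => by simp only [hyd, pow_succ]; ring
  have hy0 : y 0 = 2 * x := by simp [hyd]
  set π : ℕ → ℝ := fun i =>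
    clockProb (Op.actList U P (test i) (Pi.single ((s, s), e.symm 0) 1)) (m₀ i) with hπd
  have h₁ := fun i => hspec₁ i U P ψ x f c H hU hP hψ
  have h₂ := fun i => hspec₂ i U P ψ x f c H hU hP hψ
  have hπ1 : ∀ i, π i ≤ 1 := fun i => by
    rw [← (h₁ i).1]
    exact Finset.single_le_sum (f := fun m => clockProb _ m) (fun m _ => clockProb_nonneg _ m)
      (Finset.mem_univ (m₀ i))
  constructor
  · set S : Set ℝ := {r | |r - x| ≤ ε * x} with hS
    have hg : ∀ (r : ℝ) (_ : ℕ), (0 : ℝ) ≤ S.indicator 1 r := fun r _ =>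
      Set.indicator_nonneg (fun _ _ => zero_le_one) r
    have key := search_success (y := y) (π := π)
      (e := fun i => (est i).expect U P (fun r _ => S.indicator 1 r) 0 (initState s))
      (σ := fun n i => (search e s test m₀ est n i).expect U P (fun r _ => S.indicator 1 r) 0
        (initState s)) hy hy4 (fun i => (h₁ i).2.1) (fun i => (h₁ i).2.2) hπ1 ?_
      (fun i => expect_nonneg U P hg _ _ _) (fun n i => expect_nonneg U P hg _ _ _) ?_ N 0
      (by rw [hy0]; linarith) (by rw [hy0]; linarith [H.le_E])
    · refine le_trans ?_ key
      have : 0 < 2 / 5 / (y 0 + 3) := by have := hy 0; positivity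
      linarith
    · intro i hi1 hi2
      classical
      refine le_trans ((h₂ i).2 (Finset.univ.filter fun m =>
        |μ i m - (1 - y i) / (1 + y i)| ≤ ε / 70) fun m hm => Finset.mem_filter.2 ⟨Finset.mem_univ m, hm⟩) ?_
      simp only [hest]
      rw [expect_estimate, Finset.sum_filter]
      refine Finset.sum_le_sum fun m _ => ?_
      split_ifs with hm
      · rw [Set.indicator_of_mem]
        · simp
        · exact abs_div_sub_le (by linarith) (by positivity) hε1 hi1 hi2 hm
      · exact mul_nonneg (clockProb_nonneg _ _) (hg _ 0)
    · intro n i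
      rw [expect_search_succ e U P _ s test m₀ est n i 0 (h₁ i).1,
        expect_of_output U P (S.indicator 1) (est i) _ 0,
        expect_of_output U P (S.indicator 1) (search e s test m₀ est n (i + 1)) _ 0]
  · have hest' : ∀ i n, (est i).expect U P (fun _ n => (n : ℝ)) n (initState s) =
        n + (3 * (K₂ + T) : ℕ) := by
      intro i n
      simp only [hest]
      rw [expect_estimate, ← Finset.sum_mul, (h₂ i).1, hprog, one_mul]
      push_cast; ring
    have key := search_steps (y := y) (π := π) (τ := fun n i k =>
      (search e s test m₀ est n i).expect U P (fun _ n => (n : ℝ)) k (initState s))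
      (3 * (K₁ + 1)) (3 * (K₂ + T)) hy hy4 (fun i => (h₁ i).2.1) hπ1
      (fun i k => expect_output_initState _ _ _ _ _ _) (fun n i k => by
        rw [expect_search_succ e U P _ s test m₀ est n i k (h₁ i).1, hest', htest]
        push_cast; ring) N 0 0 (by rw [hy0]; linarith)
    refine key.trans ?_
    have hlogx : 0 ≤ Real.log x := Real.log_nonneg hx
    have hlog : Real.log (4 * y 0) ≤ 21 / 10 + Real.log x := by
      have h2 := Real.log_two_lt_d9
      rw [hy0, show 4 * (2 * x) = 2 ^ 3 * x by ring, Real.log_mul (by norm_num) (by linarith),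
        Real.log_pow]
      push_cast; linarith
    have hc₁ : ((3 * (K₁ + 1) : ℕ) : ℝ) ≤ 24006 * √E := by push_cast; linarith
    have hc₂ : ((3 * (K₂ + T) : ℕ) : ℝ) ≤ 16900000 * (√E * (1 / ε)) := by
      have h1 : (T : ℝ) ≤ 3501 * (1 / ε) := by
        have : 3500 / ε = 3500 * (1 / ε) := by ring
        linarith
      have h2 : (T : ℝ) ≤ T * √E := le_mul_of_one_le_right (by positivity) hr
      have h3 : (T : ℝ) * √E ≤ 3501 * (1 / ε) * √E := by gcongr
      push_cast
      nlinarith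
    have h5 : (23 / 10 + Real.log (4 * y 0)) * ((3 * (K₁ + 1) : ℕ) : ℝ) ≤
        (44 / 10 + Real.log x) * (24006 * √E) := by
      refine mul_le_mul (by linarith) hc₁ (by positivity) (by positivity)
    have h6 : √E ≤ √E * (1 / ε) := le_mul_of_one_le_right (by positivity) hε'.le
    have h7 : 0 ≤ √E * Real.log x := by positivity
    rw [Nat.cast_zero, zero_add]
    nlinarith

end Pipeline

end

theorem theorem2 :
    ∃ C : ℝ, 0 < C ∧
      ∀ (V : Type u) [Fintype V] [DecidableEq V] [MeasurableSpace V] [DiscreteMeasurableSpace V]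
        (s : V) (ETbar ε : ℝ), 0 < ε →
        ∃ (k : ℕ) (A : WalkAlgorithm V k),
          ∀ (G : WeightedGraph V) (M : Finset V), s ∉ M → G.Reaches s M →
            G.escapeTime s M ≤ ENNReal.ofReal ETbar →
            ∀ P ∈ Matrix.unitaryGroup (V × V) ℂ, P *ᵥ Pi.single (s, s) 1 = G.starState s →
              2 / 3 ≤ A.outputProb s (G.walkOp s M) P
                  {r | |r - G.effRes s M * G.deg s| ≤ ε * (G.effRes s M * G.deg s)} ∧
              A.expectedSteps s (G.walkOp s M) P ≤
                C * √ETbar * (1 / ε + Real.log (G.effRes s M * G.deg s)) := by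
  refine ⟨20000000, by norm_num, ?_⟩
  intro V _ _ _ _ s E ε hε
  -- No instance has E < 1, because 1 ≤ x ≤ E.
  rcases lt_or_ge E 1 with hE | hE
  · refine ⟨0, .output 0, ?_⟩
    intro G M hs hr hET P hP hψ
    obtain ⟨f, c, H⟩ := G.exists_flowVectors hs hr (E := max E 0)
      (hET.trans (ENNReal.ofReal_le_ofReal (le_max_left _ _))) (le_max_right _ _)
    exact absurd (H.one_le.trans H.le_E) (not_le.2 (max_lt hE one_pos))
  rcases lt_or_ge ε 1 with hε1 | hε1
  · obtain ⟨k, A, hA⟩ := Pipeline.exists_algorithm s hE hε hε1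
    refine ⟨k, A, ?_⟩
    intro G M hs hr hET P hP hψ
    obtain ⟨f, c, H⟩ := G.exists_flowVectors hs hr hET (by linarith)
    exact hA _ P _ _ f c H (G.sum_norm_walkOp_mulVec s M) hP hψ
  -- For ε ≥ 1 the answer 0 is precise enough and costs nothing.
  · refine ⟨0, .output 0, ?_⟩
    intro G M hs hr hET P hP hψ
    obtain ⟨f, c, H⟩ := G.exists_flowVectors hs hr hET (by linarith)
    have hx := H.one_le
    rw [WalkAlgorithm.outputProb, WalkAlgorithm.expectedSteps,
      WalkAlgorithm.expect_output_initState, WalkAlgorithm.expect_output_initState]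
    constructor
    · rw [Set.indicator_of_mem]
      · norm_num
      · rw [Set.mem_ofPred_eq, zero_sub, abs_neg, abs_of_pos (by linarith)]
        nlinarith
    · have := Real.log_nonneg hx
      rw [Nat.cast_zero]
      positivity
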